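/- Let $F=F(x_1,x_2,x_3)$ be the free group. A triple $(r_1,r_2,r_3)\in F^3$ is a \emph{W-Artinian $3$-presentation} if $r_1^{-1}x_1r_1\cdot r_2^{-1}x_2r_2\cdot r_3^{-1}x_3r_3=x_1x_2x_3$ in $F$; it presents the trivial group if $\langle x_1,x_2,x_3: r_1,r_2,r_3\rangle=1$. The \emph{hexatangle} has six boxes, corresponding to the edges of a tetrahedron with vertices $0,1,2,3$. An integral filling is a tuple $(\alpha,\beta,\gamma,\delta,\epsilon,\eta)\in\mathbb Z^6$ that puts the parameters $\alpha,\beta,\gamma,\delta,\epsilon,\eta$ on the edges $01,12,13,02,23,03$, respectively. The filled hexatangle $\mathcal H(\alpha,\beta,\gamma,\delta,\epsilon,\eta)$ is the link whose diagram is obtained as follows: draw the edge graph of the tetrahedron in the plane, replace each vertex by a disk, and join the disks at the two ends of each edge by a row of $|n|$ crossings, where $n$ is the parameter of the edge, all of the type given by the sign of $n$ (each crossing being one half-twisted band between the two disks; $n=0$ means that the disks are not joined along that edge). The associated Artin presentation (of the fundamental group of the double branched cover) has the relators $$r_1=x_1^{-\alpha}\bigl(x_1(x_2x_3)^{\gamma}x_2(x_2x_3)^{-\gamma}\bigr)^{-\delta}(x_1x_2x_3)^{-\eta},$$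 $$r_2=x_2^{-\beta}(x_2x_3)^{-\gamma}\bigl(x_1(x_2x_3)^{\gamma}x_2(x_2x_3)^{-\gamma}\bigr)^{-\delta}(x_1x_2x_3)^{-\eta},$$ $$r_3=x_3^{-\epsilon}(x_2x_3)^{-\gamma}(x_1x_2x_3)^{-\eta}.$$ Each of the triples $(r_1,r_2,r_3)$ listed below is a W-Artinian $3$-presentation and presents the trivial group. Moreover each of them is the Artin presentation associated to an integral filling of the hexatangle for which the filled hexatangle is the trivial knot, and this filling is obtained from one of the fillings named at the head of its list by one of the $24$ symmetries of the tetrahedron. \textbf{Table I} (each coming from one of the fillings $(\pm1,\pm1,\pm1,0,0,0)$, $(\pm1,0,\pm1,0,\pm1,0)$, with independent signs): 1. $x_1^{-1}$,\; $x_2^{-1}x_3^{-1}x_2^{-1}$,\; $x_3^{-1}x_2^{-1}$; 2. $x_2^{-1}x_1^{-1}$,\; $x_2^{-2}x_1^{-1}$,\; $x_3^{-1}$; 3. $x_3^{-1}x_2^{-1}x_1^{-1}$,\; $x_3^{-1}x_2^{-1}x_3^{-1}x_2^{-1}x_1^{-1}$,\; $x_3^{-2}x_2^{-1}x_3^{-1}x_2^{-1}x_1^{-1}$;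 4. $x_1^{-1}x_2^{-1}x_1^{-1}x_3^{-1}x_2^{-1}x_1^{-1}$,\; $x_2^{-1}x_1^{-1}x_3^{-1}x_2^{-1}x_1^{-1}$,\; $x_3^{-1}x_2^{-1}x_1^{-1}$; 5. $x_1^{-1}$,\; $x_3$,\; $x_2x_3$; 6. $x_1^{-1}$,\; $x_2x_3^{-1}x_2^{-1}$,\; $x_3^{-1}x_2^{-1}$; 7. $x_3^{-1}x_2^{-1}x_1^{-1}$,\; $x_3^{-1}x_2^{-1}x_3^{-1}x_2^{-1}x_1^{-1}$,\; $x_2^{-1}x_3^{-1}x_2^{-1}x_1^{-1}$; 8. $x_2x_3^{-1}x_2^{-1}x_1^{-1}$,\; $x_1x_2x_3^{-1}x_2^{-1}x_1^{-1}$,\; $x_3^{-1}x_2^{-1}x_1^{-1}$; 9. $x_1x_2x_3$,\; $x_3^{-1}x_2^{-1}x_1x_2x_3$,\; $x_3^{-2}x_2^{-1}x_1x_2x_3$; 10. $x_1^{-1}x_3$,\; $x_3$,\; $x_1x_2x_3$; 11. $x_3^{-1}x_2^{-1}x_1^{-1}$,\; $x_1^{-1}$,\; $x_3^{-1}x_1^{-1}$;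 12. $x_1x_2^{-1}x_1^{-1}x_3^{-1}x_2^{-1}x_1^{-1}$,\; $x_2^{-1}x_1^{-1}x_3^{-1}x_2^{-1}x_1^{-1}$,\; $x_3^{-1}x_2^{-1}x_1^{-1}$; 13. $x_1^{-1}x_2x_3x_2^{-1}x_3^{-1}x_2^{-1}x_1^{-1}$,\; $x_2^{-1}x_3^{-1}x_2^{-1}x_1^{-1}$,\; $x_3^{-1}x_2^{-1}$; 14. $x_1^{-1}$,\; $x_2^{-1}$,\; $x_3^{-1}$; 15. $x_2x_3x_2^{-1}x_3^{-1}x_2^{-1}x_1^{-1}$,\; $x_2^{-2}x_3^{-1}x_2^{-1}x_1^{-1}$,\; $x_3^{-1}x_2^{-1}$; 16. $x_1^{-1}x_3^{-1}x_2^{-1}x_1^{-1}$,\; $x_2^{-1}x_3^{-1}x_2^{-1}x_1^{-1}$,\; $x_3^{-1}x_2^{-1}x_1^{-1}$; 17. $x_3^{-1}x_2^{-1}x_1^{-1}$,\; $(x_2^{-1}x_3^{-1})(x_2^{-1}x_3^{-1})x_2^{-1}x_1^{-1}$,\; $x_3^{-1}x_2^{-1}x_3^{-1}x_2^{-1}x_1^{-1}$;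 18. $x_2x_3x_2^{-1}x_3^{-1}x_2^{-1}x_1^{-1}$,\; $x_2^{-1}x_3^{-1}x_2^{-1}x_1^{-1}$,\; $x_3^{-2}x_2^{-1}$; 19. $x_3^{-1}x_2^{-1}x_1^{-1}$,\; $x_2^{-1}x_3^{-1}x_2^{-1}x_1^{-1}$,\; $x_3^{-2}x_2^{-1}x_1^{-1}$; 20. $x_2^{-1}x_1^{-1}x_3^{-1}x_2^{-1}x_1^{-1}$,\; $x_2^{-2}x_1^{-1}x_3^{-1}x_2^{-1}x_1^{-1}$,\; $x_3^{-1}x_2^{-1}x_1^{-1}$. \textbf{Table II} (coming from the filling $(-1,0,2,-1,1,0)$): 1. $x_1^2(x_2x_3)^2x_2(x_2x_3)^{-2}$,\; $(x_2x_3)^{-2}x_1(x_2x_3)^2x_2(x_2x_3)^{-2}$,\; $x_3^{-2}x_2^{-1}x_3^{-1}x_2^{-1}$; 2. $x_1^{-2}x_3^{-1}x_2^{-1}x_3x_1^{-1}$,\; $x_3x_1^{-1}$,\; $x_3x_2x_3$; 3. $x_1^2x_2x_3$,\; $x_2^{-2}x_1x_2x_3$,\; $x_3^{-1}x_1x_2x_3$;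 4. $x_3^{-1}x_2^{-1}x_3x_2x_3$,\; $x_2^{-2}x_3x_2x_3$,\; $x_2x_3x_1x_2x_3$; 5. $x_1^{-2}x_3^{-1}x_2^{-1}x_1^{-1}$,\; $x_2x_3^{-1}x_2^{-1}x_1^{-1}$,\; $x_2^{-1}x_1^{-1}$; 6. $x_1(x_2x_3)^2x_2(x_2x_3)^{-3}x_1^{-1}$,\; $x_2(x_2x_3)^{-2}x_1(x_2x_3)^{2}x_2(x_2x_3)^{-3}x_1^{-1}$,\; $(x_2x_3)^{-1}(x_2x_3)^{-2}x_1^{-1}$; 7. $x_1^2x_2x_3x_2x_3^{-1}x_2^{-1}$,\; $x_3^{-1}x_2^{-1}x_1x_2x_3x_2x_3^{-1}x_2^{-1}$,\; $x_3^{-3}x_2^{-1}$; 8. $x_1^{-1}x_3^{-1}x_2^{-1}x_3x_1^{-1}x_3^{-1}x_2^{-1}x_3x_1^{-1}$,\; $x_3x_1^{-1}x_3^{-1}x_2^{-1}x_3x_1^{-1}$,\; $x_3x_2x_3$; 9. $x_1^2x_2x_3$,\; $x_2^{-1}x_1x_2x_3$,\; $x_3^{-2}x_1x_2x_3$; 10.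 $x_3^{-1}x_2^{-1}x_3x_1^{-1}x_3^{-1}x_2^{-1}x_3x_2x_3$,\; $x_2^{-1}x_3x_1^{-1}x_3^{-1}x_2^{-1}x_3x_2x_3$,\; $x_2x_3x_1x_2x_3$; 11. $x_1^{-1}x_3^{-1}x_2^{-1}x_1^{-1}x_3^{-1}x_2^{-1}x_1^{-1}$,\; $x_2x_3^{-1}x_2^{-1}x_1^{-1}x_3^{-1}x_2^{-1}x_1^{-1}$,\; $x_2^{-1}x_1^{-1}x_3^{-1}x_2^{-1}x_1^{-1}$; 12. $x_1x_2x_3x_2(x_2x_3)^{-2}(x_1x_2x_3x_1)^{-1}$,\; $x_2(x_2x_3)^{-1}x_1x_2x_3x_2(x_2x_3)^{-2}(x_1x_2x_3x_1)^{-1}$,\; $(x_2x_3)^{-2}x_1^{-1}x_3^{-1}x_2^{-1}x_1^{-1}$; 13. $x_1x_2x_3x_2x_3^{-1}x_2^{-1}x_1x_2x_3$,\; $x_2^{-2}x_3^{-1}x_2^{-1}x_1x_2x_3x_2x_3^{-1}x_2^{-1}x_1x_2x_3$,\; $x_3^{-1}x_2^{-1}x_1x_2x_3$; 14. $x_2x_3$,\;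 $x_2^{-2}x_1x_2x_3$,\; $x_3x_1x_2x_3$; 15. $x_1(x_2x_3)^2x_2(x_2x_3)^{-2}x_1x_2x_3$,\; $(x_3x_2)^{-2}x_2^{-1}x_1(x_2x_3)^2x_2(x_2x_3)^{-2}x_1x_2x_3$,\; $(x_2x_3)^{-2}x_1x_2x_3$; 16. $x_1^{-1}x_2x_3$,\; $x_2^{-1}x_1x_2x_3$,\; $x_3x_1x_2x_3$; 17. $(x_2x_3)^2x_2(x_2x_3)^{-2}$,\; $(x_2x_3)^{-2}x_1(x_2x_3)^{2}x_2(x_2x_3)^{-2}$,\; $x_2^{-1}x_3^{-1}x_2^{-1}$; 18. $x_1^{-1}x_2x_3x_2x_3^{-1}x_2^{-1}$,\; $x_3^{-1}x_2^{-1}x_1x_2x_3x_2x_3^{-1}x_2^{-1}$,\; $x_2^{-1}$; 19. $(x_3^{-1}x_2^{-1}x_3x_1^{-1})(x_3^{-1}x_2^{-1}x_3x_1^{-1})x_3^{-1}x_2^{-1}x_1^{-1}$,\; $x_2(x_3x_1^{-1}x_3^{-1}x_2^{-1})(x_3x_1^{-1}x_3^{-1}x_2^{-1})x_1^{-1}$,\;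 $x_1^{-1}$; 20. $x_1x_3^{-1}x_2^{-1}x_1^{-1}$,\; $x_2x_3^{-1}x_2^{-1}x_1^{-1}$,\; $x_3^{-3}x_2^{-1}x_1^{-1}$. \textbf{Table III} (for every $\gamma\in\mathbb Z$; coming from the filling $(1,-1,\gamma,-1,1-\gamma,0)$): 1. $(x_2x_3)^{\gamma}x_2(x_2x_3)^{-\gamma}$,\; $x_2(x_2x_3)^{-\gamma}x_1(x_2x_3)^{\gamma}x_2(x_2x_3)^{-\gamma}$,\; $x_3^{\gamma-1}(x_2x_3)^{-\gamma}$; 2. $x_1^{-\gamma}(x_1x_2x_3x_2x_3^{-1}x_2^{-1})^{\gamma-1}$,\; $x_2x_3^{-1}x_2^{-1}(x_1x_2x_3x_2x_3^{-1}x_2^{-1})^{\gamma-1}$,\; $x_2^{-1}$; 3. $x_2x_3$,\; $x_2^{-\gamma+1}x_3x_1x_2x_3$,\; $x_3^{\gamma-1}x_2x_3x_1x_2x_3$; 4. $x_1(x_1x_2x_3x_2x_3^{-1}x_2^{-1})^{\gamma-1}x_1x_2x_3$,\; $x_2^{-\gamma}x_3^{-1}x_2^{-1}(x_1x_2x_3x_2x_3^{-1}x_2^{-1})^{\gamma-1}x_1x_2x_3$,\;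 $x_3^{-1}x_2^{-1}x_1x_2x_3$; 5. $x_1^{-\gamma}(x_1x_2x_3)^{\gamma-1}$,\; $x_3(x_1x_2x_3)^{\gamma-1}$,\; $x_3x_2x_3(x_1x_2x_3)^{\gamma-1}$; 6. $x_1^2(x_2x_3)^{\gamma}x_2(x_2x_3)^{-\gamma}(x_1x_2x_3)^{\gamma-1}$,\; $x_2^{-1}(x_2x_3)^{-\gamma}x_1(x_2x_3)^{\gamma}x_2(x_2x_3)^{-\gamma}(x_1x_2x_3)^{\gamma-1}$,\; $(x_2x_3)^{-\gamma}(x_1x_2x_3)^{\gamma-1}$; 7. $x_1(x_2x_3)^{-\gamma+1}x_2^{-1}(x_2x_3)^{\gamma-1}x_1^{-1}$,\; $(x_2x_3)^{\gamma-1}x_1^{-1}$,\; $x_3^{-\gamma}(x_2x_3)^{\gamma-1}$; 8. $x_1^{\gamma-1}(x_1x_3^{-1}x_2x_3)^{-\gamma}$,\; $x_2^2x_3(x_1x_3^{-1}x_2x_3)^{-\gamma}$,\; $x_3^{-1}x_2x_3$; 9. $x_1x_3^{-1}x_2^{-1}x_1^{-1}$,\; $x_2^{\gamma-1}x_1^{-1}$,\;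 $x_3^{-\gamma}x_1^{-1}$; 10. $x_1(x_1x_3^{-1}x_2x_3)^{-\gamma}x_3^{-1}x_2^{-1}x_1^{-1}$,\; $x_2^{\gamma}x_3(x_1x_3^{-1}x_2x_3)^{-\gamma}x_3^{-1}x_2^{-1}x_1^{-1}$,\; $x_1^{-1}$; 11. $x_1^{\gamma-1}(x_1x_2x_3)^{-\gamma}$,\; $x_2^2x_3(x_1x_2x_3)^{-\gamma}$,\; $x_3^{-1}x_2x_3(x_1x_2x_3)^{-\gamma}$; 12. $x_1(x_2x_3)^{-\gamma+1}x_2^{-1}(x_2x_3)^{\gamma-1}x_1^{-1}(x_1x_2x_3)^{-\gamma}$,\; $(x_2x_3)^{\gamma-1}x_1^{-1}(x_1x_2x_3)^{-\gamma}$,\; $(x_2x_3)^{\gamma-1}(x_1x_2x_3)^{-\gamma}$; 13. $(x_2x_3)^{-\gamma+1}x_2^{-1}(x_2x_3)^{\gamma}$,\; $x_2^{-\gamma-1}(x_2x_3)^{\gamma}$,\; $x_3(x_2x_3)^{\gamma-1}x_1x_2x_3$; 14. $x_1^{\gamma}x_2x_1x_2x_3$,\; $x_2^{-\gamma}(x_1x_2)(x_1x_2)x_3$,\;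 $x_3^{-1}x_1x_2x_3$; 15. $x_1(x_2x_3)^{\gamma}x_2(x_2x_3)^{-\gamma}x_3^{-1}x_2^{-1}x_1^{-1}$,\; $x_2^{\gamma-1}(x_2x_3)^{-\gamma}x_1(x_2x_3)^{\gamma}x_2(x_2x_3)^{-\gamma}x_3^{-1}x_2^{-1}x_1^{-1}$,\; $x_3(x_2x_3)^{-\gamma}x_3^{-1}x_2^{-1}x_1^{-1}$; 16. $x_1^{-\gamma+1}x_2x_3^{-1}x_2^{-1}x_1^{-1}$,\; $x_2^{\gamma-1}x_1x_2x_3^{-1}x_2^{-1}x_1^{-1}$,\; $x_2^{-1}x_1^{-1}$; 17. $x_1^{\gamma}(x_2x_3)^{\gamma}x_2(x_2x_3)^{-\gamma}x_1x_2x_3$,\; $(x_2x_3)^{-\gamma}x_1(x_2x_3)^{\gamma}x_2(x_2x_3)^{-\gamma}x_1x_2x_3$,\; $x_3^{-1}(x_2x_3)^{-\gamma}x_1x_2x_3$; 18. $x_1^{-\gamma}(x_2x_3)^{-\gamma+1}x_2^{-1}(x_2x_3)^{\gamma}$,\; $x_2^{-1}(x_2x_3)^{\gamma}$,\; $x_3(x_2x_3)^{\gamma-1}x_1x_2x_3$;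 19. $(x_1x_3^{-1}x_2x_3)^{-\gamma}(x_1x_2x_3)^{\gamma-1}$,\; $x_3(x_1x_3^{-1}x_2x_3)^{-\gamma}(x_1x_2x_3)^{\gamma-1}$,\; $x_3x_2x_3(x_1x_2x_3)^{\gamma-1}$; 20. $x_1^2x_2(x_1x_2x_3)^{\gamma-1}$,\; $x_2^{-1}x_1x_2(x_1x_2x_3)^{\gamma-1}$,\; $x_3^{-\gamma}(x_1x_2x_3)^{\gamma-1}$. \textbf{Table IV} (for every $\gamma\in\mathbb Z$; coming from the filling $(1,-1,\gamma,-2,-1,0)$): 1. $(x_2x_3)^{\gamma}x_2(x_2x_3)^{-\gamma}x_1(x_2x_3)^{\gamma}x_2(x_2x_3)^{-\gamma}$,\; $(x_2(x_2x_3)^{-\gamma}x_1(x_2x_3)^{\gamma})^2x_2(x_2x_3)^{-\gamma}$,\; $x_3(x_2x_3)^{-\gamma}$; 2. $x_1^{-\gamma+1}x_2x_3x_2x_3^{-1}x_2^{-1}$,\; $x_2x_3^{-1}x_2^{-1}x_1x_2x_3x_2x_3^{-1}x_2^{-1}$,\; $x_3x_2^{-1}$; 3. $x_2x_3x_1x_2x_3$,\;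 $x_2^{-\gamma+1}(x_3x_1x_2)(x_3x_1x_2)x_3$,\; $x_3(x_2x_3x_1)(x_2x_3x_1)x_2x_3$; 4. $x_1^2x_2x_3x_2x_3^{-1}x_2^{-1}(x_1x_2x_3)(x_1x_2x_3)$,\; $x_2^{-\gamma}x_3^{-1}x_2^{-1}x_1x_2x_3x_2x_3^{-1}x_2^{-1}(x_1x_2x_3)(x_1x_2x_3)$,\; $x_3^{-1}x_2^{-1}(x_1x_2x_3)(x_1x_2x_3)$; 5. $x_1^{-\gamma+1}x_2x_3$,\; $x_3x_1x_2x_3$,\; $x_3^2x_2x_3x_1x_2x_3$; 6. $x_1^2((x_2x_3)^{\gamma}x_2(x_2x_3)^{-\gamma}x_1)((x_2x_3)^{\gamma}x_2(x_2x_3)^{-\gamma}x_1)x_2x_3$,\; $x_2^{-1}((x_2x_3)^{-\gamma}x_1(x_2x_3)^{\gamma}x_2)((x_2x_3)^{-\gamma}x_1(x_2x_3)^{\gamma}x_2)(x_2x_3)^{-\gamma}x_1x_2x_3$,\; $(x_2x_3)^{-\gamma}x_1x_2x_3$; 7. $x_1^2x_3^{-1}x_2^{-1}x_3x_1^{-1}$,\;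 $x_2x_3x_1^{-1}$,\; $x_3^{-\gamma}x_2x_3$; 8. $x_1(x_1x_3^{-1}x_2^{-1}x_3^{-1}x_2x_3x_2x_3)^{-\gamma}$,\; $x_2^2x_3x_2x_3(x_1x_3^{-1}x_2^{-1}x_3^{-1}x_2x_3x_2x_3)^{-\gamma}$,\; $x_3^{-1}x_2x_3x_2x_3$; 9. $x_1^2(x_1x_2x_3)^{-1}$,\; $x_2x_1^{-1}$,\; $x_3^{-\gamma}x_1^{-1}$; 10. $x_1(x_1(x_3x_2x_3)^{-1}(x_2x_3)^2)^{-\gamma}(x_1x_2x_3)^{-1}$,\; $x_2^2x_3x_2x_3(x_1(x_3x_2x_3)^{-1}(x_2x_3)^2)^{-\gamma}(x_1x_2x_3)^{-1}$,\; $x_2x_3x_1^{-1}$; 11. $x_1(x_1x_2x_3)^{-\gamma}$,\; $x_2^3x_3(x_1x_2x_3)^{-\gamma}$,\; $x_3^{-1}x_2x_3(x_1x_2x_3)^{-\gamma}$; 12. $x_1x_3^{-1}x_2^{-1}x_3x_1^{-1}(x_1x_2x_3)^{-\gamma}$,\; $x_2^2x_3x_1^{-1}(x_1x_2x_3)^{-\gamma}$,\;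 $x_2x_3(x_1x_2x_3)^{-\gamma}$; 13. $x_3^{-1}x_2^{-1}x_3x_2x_3x_1x_2x_3$,\; $x_2^{-\gamma}x_3x_2x_3x_1x_2x_3$,\; $x_3(x_2x_3x_1)(x_2x_3x_1)x_2x_3$; 14. $x_1^2x_2(x_1x_2x_3)(x_1x_2x_3)$,\; $x_2^{-\gamma}(x_1x_2)(x_1x_2)x_3x_1x_2x_3$,\; $x_3^{-1}x_1x_2x_3x_1x_2x_3$; 15. $(x_1(x_2x_3)^{\gamma}x_2(x_2x_3)^{-\gamma})(x_1(x_2x_3)^{\gamma}x_2(x_2x_3)^{-\gamma})(x_1x_2x_3)^{-1}$,\; $(x_2(x_2x_3)^{-\gamma}x_1(x_2x_3)^{\gamma})(x_2(x_2x_3)^{-\gamma}x_1(x_2x_3)^{\gamma})x_2(x_2x_3)^{-\gamma}(x_1x_2x_3)^{-1}$,\; $x_3(x_2x_3)^{-\gamma}(x_1x_2x_3)^{-1}$; 16. $x_1^{-\gamma+1}x_2(x_1x_2x_3)^{-1}$,\; $x_2x_1x_2(x_1x_2x_3)^{-1}$,\; $x_3x_2^{-1}x_1^{-1}$; 17. $x_1^2((x_2x_3)^{\gamma}x_2(x_2x_3)^{-\gamma}x_1)((x_2x_3)^{\gamma}x_2(x_2x_3)^{-\gamma}x_1)x_2x_3$,\;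 $((x_2x_3)^{-\gamma}x_1(x_2x_3)^{\gamma}x_2)((x_2x_3)^{-\gamma}x_1(x_2x_3)^{\gamma}x_2)(x_2x_3)^{-\gamma}x_1x_2x_3$,\; $x_3^{-1}(x_2x_3)^{-\gamma}x_1x_2x_3$; 18. $x_1^{-\gamma}x_3^{-1}x_2^{-1}x_3x_2x_3$,\; $x_3x_2x_3$,\; $x_3^2x_2x_3x_1x_2x_3$; 19. $(x_1x_3^{-1}x_2^{-1}x_3^{-1}x_2x_3x_2x_3)^{-\gamma}x_1x_2x_3$,\; $x_3x_2x_3(x_1x_3^{-1}x_2^{-1}x_3^{-1}x_2x_3x_2x_3)^{-\gamma}x_1x_2x_3$,\; $(x_3x_2)(x_3x_2)x_3x_1x_2x_3$; 20. $x_1^3x_2x_1x_2x_3$,\; $x_2^{-1}(x_1x_2)(x_1x_2)x_3$,\; $x_3^{-\gamma}x_1x_2x_3$. \textbf{Table V} (for every $\beta\in\mathbb Z$; coming from the filling $(1,\beta,-2,-1,2,1)$): 1. $x_3^{-1}x_2^{-1}x_3^{-1}x_2x_3x_1^{-1}$,\; $x_2^{-\beta+1}x_3x_2x_3x_1x_3^{-1}x_2^{-1}x_3^{-1}x_2x_3x_1^{-1}$,\;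 $x_3^{-2}x_2x_3x_1^{-1}$; 2. $x_1^2x_2x_3x_2^{-1}x_3^{-1}x_2^{-1}x_1^{-1}x_2x_3x_2^{-1}(x_3^{-1}x_2^{-1}x_1^{-1})(x_3^{-1}x_2^{-1}x_1^{-1})$,\; $x_2^{-\beta-1}x_3^{-1}x_2^{-1}x_1^{-1}x_2x_3x_2^{-1}(x_3^{-1}x_2^{-1}x_1^{-1})(x_3^{-1}x_2^{-1}x_1^{-1})$,\; $x_2^{-1}x_3^{-1}x_2^{-1}x_1^{-1}$; 3. $x_1^{-1}(x_2x_3)^{\beta}x_2^{-1}(x_2x_3)^{-\beta+1}$,\; $x_2(x_2x_3)^{-\beta+1}$,\; $x_3^{-2}(x_2x_3)^{-\beta}x_1x_2x_3$; 4. $x_1^{-\beta}x_2x_3x_2^{-1}x_3^{-1}x_2^{-1}x_1^{-1}x_2x_3x_2^{-1}$,\; $x_2x_3^{-1}x_2^{-1}x_1^{-1}x_2x_3x_2^{-1}$,\; $x_3^{-2}x_2^{-1}x_1x_2x_3$; 5. $x_1^2(x_2x_3)^{\beta}x_2^{-1}(x_2x_3)^{-\beta}(x_1^{-1}x_3^{-1}x_2^{-1})(x_1^{-1}x_3^{-1}x_2^{-1})x_1^{-1}$,\;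 $x_2^{-2}(x_2x_3)^{-\beta}(x_1^{-1}x_3^{-1}x_2^{-1})(x_1^{-1}x_3^{-1}x_2^{-1})x_1^{-1}$,\; $x_3(x_2x_3)^{-\beta}(x_3^{-1}x_2^{-1}x_1^{-1})(x_3^{-1}x_2^{-1}x_1^{-1})$; 6. $x_1^{-\beta+1}x_3^{-1}x_2^{-1}x_3^{-1}x_2x_3x_1^{-1}x_3^{-1}x_2^{-1}x_1^{-1}$,\; $x_3x_2x_3x_1x_3^{-1}x_2^{-1}x_3^{-1}x_2x_3x_1^{-1}x_3^{-1}x_2^{-1}x_1^{-1}$,\; $x_3^{-1}x_2x_3x_1^{-1}x_3^{-1}x_2^{-1}x_1^{-1}$; 7. $x_1(x_2x_3)^2(x_2^{-1}x_3^{-1})(x_2^{-1}x_3^{-1})x_2^{-1}x_1^{-1}x_3^{-1}x_2^{-1}x_1^{-1}$,\; $x_2^{-\beta-1}(x_3^{-1}x_2^{-1})(x_3^{-1}x_2^{-1})x_1^{-1}x_3^{-1}x_2^{-1}x_1^{-1}$,\; $x_3(x_2^{-1}x_3^{-1})(x_2^{-1}x_3^{-1})x_2^{-1}x_1^{-1}$;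 8. $x_1^{-1}x_3^{-1}x_2x_3x_1x_3^{-1}x_1^{-1}$,\; $x_2^{-\beta+1}x_3x_1x_3^{-1}x_2x_3x_1x_3^{-1}x_1^{-1}$,\; $x_3^{-1}x_1^{-1}$; 9. $x_1(x_2x_3)^{\beta}x_2^{-1}(x_2x_3)^{-\beta}x_1^{-1}x_3^{-1}x_2^{-1}x_1^{-1}$,\; $x_2^{-3}(x_2x_3)^{-\beta}x_1^{-1}x_3^{-1}x_2^{-1}x_1^{-1}$,\; $x_3^2(x_2x_3)^{-\beta}x_3^{-1}x_2^{-1}x_1^{-1}$; 10. $x_1^{-\beta+1}x_3^{-1}x_2x_3x_1x_3^{-1}x_1^{-1}$,\; $x_2^{-1}x_3x_1x_3^{-1}x_2x_3x_1x_3^{-1}x_1^{-1}$,\; $x_3^{-1}x_1^{-1}$; 11. $x_1^{-2}(x_2x_3)^{\beta}x_2^{-1}(x_2x_3)^{-\beta+1}x_1x_2x_3$,\; $(x_2x_3)^{-\beta+1}x_1x_2x_3$,\; $x_3^{-1}(x_2x_3)^{-\beta}(x_1x_2x_3)(x_1x_2x_3)$; 12. $x_1^{-\beta}(x_2x_3)^2x_2^{-1}x_3^{-1}x_2^{-1}x_1x_2x_3$,\;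 $x_3^{-1}x_2^{-1}x_1x_2x_3$,\; $x_3^{-2}x_2^{-1}x_3^{-1}x_2^{-1}(x_1x_2x_3)(x_1x_2x_3)$; 13. $x_1^{-1}(x_2x_3)^2x_2^{-1}x_3^{-1}x_2^{-1}$,\; $x_2x_3^{-1}x_2^{-1}$,\; $x_3^{-\beta-1}x_2^{-1}x_3^{-1}x_2^{-1}x_1x_2x_3$; 14. $x_1^{-2}(x_1x_2x_3x_2x_3^{-1}x_2^{-1})^{-\beta}x_1x_2x_3$,\; $x_2^2x_3^{-1}x_2^{-1}(x_1x_2x_3x_2x_3^{-1}x_2^{-1})^{-\beta}x_1x_2x_3$,\; $x_3^{-2}x_2^{-1}x_1x_2x_3$; 15. $x_3^{-1}x_2^{-1}x_3^{-1}x_2x_3x_1^{-1}$,\; $x_2^{-1}x_3x_2x_3x_1x_3^{-1}x_2^{-1}x_3^{-1}x_2x_3x_1^{-1}$,\; $x_3^{-\beta}x_2x_3x_1^{-1}$; 16. $x_1^2(x_1x_2x_3x_2x_3^{-1}x_2^{-1})^{-\beta}x_3^{-1}x_2^{-1}x_1^{-1}$,\; $x_2^{-2}x_3^{-1}x_2^{-1}(x_1x_2x_3x_2x_3^{-1}x_2^{-1})^{-\beta}x_3^{-1}x_2^{-1}x_1^{-1}$,\;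 $x_2^{-1}x_3^{-1}x_2^{-1}x_1^{-1}$; 17. $x_1^{-1}x_3^{-1}x_2^{-1}x_3^{-1}(x_2x_3)^2(x_1x_2x_3)^{-\beta}$,\; $x_3x_2x_3x_1x_3^{-1}x_2^{-1}x_3^{-1}(x_2x_3)^2(x_1x_2x_3)^{-\beta}$,\; $x_3^{-1}(x_2x_3)^2(x_1x_2x_3)^{-\beta}$; 18. $x_1^2(x_2x_3)^2(x_2^{-1}x_3^{-1})(x_2^{-1}x_3^{-1})x_2^{-1}x_1^{-1}(x_1x_2x_3)^{-\beta}$,\; $x_2^{-2}(x_3^{-1}x_2^{-1})(x_3^{-1}x_2^{-1})x_1^{-1}(x_1x_2x_3)^{-\beta}$,\; $x_2^{-1}x_3^{-1}x_2^{-1}(x_1x_2x_3)^{-\beta}$; 19. $x_3^{-1}x_2x_3x_1x_3^{-1}x_1^{-1}x_3^{-1}x_2^{-1}x_1^{-1}$,\; $x_3x_1x_3^{-1}x_2x_3x_1x_3^{-1}x_1^{-1}x_3^{-1}x_2^{-1}x_1^{-1}$,\; $x_3^{-\beta}x_1^{-1}x_3^{-1}x_2^{-1}x_1^{-1}$; 20.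 $x_1(x_1x_2x_3x_2x_3^{-1}x_2^{-1})^{-\beta}(x_3^{-1}x_2^{-1}x_1^{-1})(x_3^{-1}x_2^{-1}x_1^{-1})$,\; $x_2^{-1}x_3^{-1}x_2^{-1}(x_1x_2x_3x_2x_3^{-1}x_2^{-1})^{-\beta}(x_3^{-1}x_2^{-1}x_1^{-1})(x_3^{-1}x_2^{-1}x_1^{-1})$,\; $x_3x_2^{-1}(x_3^{-1}x_2^{-1}x_1^{-1})(x_3^{-1}x_2^{-1}x_1^{-1})$. \textbf{Table VI} (for every $\epsilon\in\mathbb Z$; coming from the filling $(-1,2,-2,-1,\epsilon,1)$): 1. $x_1^2x_3^{-1}x_2^{-1}x_3^{-1}x_2x_3x_1^{-1}$,\; $x_2^{-1}x_3x_2x_3x_1x_3^{-1}x_2^{-1}x_3^{-1}x_2x_3x_1^{-1}$,\; $x_3^{-\epsilon}x_2x_3x_1^{-1}$; 2. $x_1^2(x_1x_3^{-1}x_2x_3)^{-\epsilon}x_3^{-1}x_2^{-1}x_1^{-1}$,\; $x_2^{-1}x_3(x_1x_3^{-1}x_2x_3)^{-\epsilon}x_3^{-1}x_2^{-1}x_1^{-1}$,\;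 $x_3x_1^{-1}$; 3. $x_1(x_2x_3)^2x_2^{-1}x_3^{-1}x_2^{-1}$,\; $x_2x_3^{-1}x_2^{-1}$,\; $x_3^{-\epsilon-1}x_2^{-1}x_3^{-1}x_2^{-1}x_1x_2x_3$; 4. $x_1^{-2}(x_1x_3^{-1}x_2x_3)^{-\epsilon}x_1x_2x_3$,\; $x_2^3x_3(x_1x_3^{-1}x_2x_3)^{-\epsilon}x_1x_2x_3$,\; $x_3^{-1}x_2x_3x_1x_2x_3$; 5. $x_1^2(x_2x_3)^2(x_2^{-1}x_3^{-1})(x_2^{-1}x_3^{-1})x_2^{-1}x_1^{-1}(x_1x_2x_3)^{-\epsilon}$,\; $(x_3^{-1}x_2^{-1})(x_3^{-1}x_2^{-1})x_1^{-1}(x_1x_2x_3)^{-\epsilon}$,\; $x_2^{-1}x_3^{-1}x_2^{-1}(x_1x_2x_3)^{-\epsilon}$; 6. $x_1^{-1}x_3^{-1}x_2^{-1}x_3^{-1}(x_2x_3)^2(x_1x_2x_3)^{-\epsilon}$,\; $x_2^2x_3x_2x_3x_1x_3^{-1}x_2^{-1}x_3^{-1}(x_2x_3)^2(x_1x_2x_3)^{-\epsilon}$,\;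 $x_3^{-1}(x_2x_3)^2(x_1x_2x_3)^{-\epsilon}$; 7. $x_1^2(x_2x_3)^{\epsilon}x_2(x_2x_3)^{-\epsilon}x_3^{-1}x_2^{-1}x_1^{-1}$,\; $x_2^{-2}(x_2x_3)^{-\epsilon}x_1(x_2x_3)^{\epsilon}x_2(x_2x_3)^{-\epsilon}x_3^{-1}x_2^{-1}x_1^{-1}$,\; $x_3^2(x_2x_3)^{-\epsilon}x_3^{-1}x_2^{-1}x_1^{-1}$; 8. $x_1^{-\epsilon+1}x_3^{-1}x_2x_3x_1x_3^{-1}x_1^{-1}$,\; $x_2^{-1}x_3x_1x_3^{-1}x_2x_3x_1x_3^{-1}x_1^{-1}$,\; $x_3x_1^{-1}$; 9. $x_1(x_2x_3)^2x_2^{-1}x_3^{-1}x_2^{-1}$,\; $x_2^{-\epsilon-1}x_3^{-1}x_2^{-1}$,\; $x_3x_2^{-1}x_3^{-1}x_2^{-1}x_1x_2x_3$; 10. $x_1^{-1}(x_3^{-1}x_2x_3x_1)(x_3^{-1}x_2x_3x_1)x_2x_3$,\; $x_2^{-\epsilon+1}(x_3x_1x_3^{-1}x_2)(x_3x_1x_3^{-1}x_2)x_3x_1x_2x_3$,\;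 $x_3^{-1}x_2x_3x_1x_2x_3$; 11. $x_1^{-\epsilon}(x_2x_3)^2x_2^{-1}x_3^{-1}x_2^{-1}x_1x_2x_3$,\; $x_3^{-1}x_2^{-1}x_1x_2x_3$,\; $x_2^{-1}x_3^{-1}x_2^{-1}(x_1x_2x_3)^2$; 12. $x_1^{-1}(x_2x_3)^{\epsilon}x_2(x_2x_3)^{-\epsilon}(x_1x_2x_3)^2$,\; $x_2(x_2x_3)^{-\epsilon}x_1(x_2x_3)^{\epsilon}x_2(x_2x_3)^{-\epsilon}(x_1x_2x_3)^2$,\; $x_3^{-1}(x_2x_3)^{-\epsilon}(x_1x_2x_3)^2$; 13. $(x_2x_3)^{\epsilon}x_2(x_2x_3)^{-\epsilon}x_1x_2x_3$,\; $x_2^2(x_2x_3)^{-\epsilon}x_1(x_2x_3)^{\epsilon}x_2(x_2x_3)^{-\epsilon}x_1x_2x_3$,\; $x_3^{-2}(x_2x_3)^{-\epsilon}x_1x_2x_3$; 14. $x_1^{-\epsilon}x_2x_3x_2^{-1}x_3^{-1}x_2^{-1}x_1^{-1}x_2x_3x_2^{-1}$,\; $x_2x_3^{-1}x_2^{-1}x_1^{-1}x_2x_3x_2^{-1}$,\;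 $x_2^{-1}x_1x_2x_3$; 15. $x_3^{-1}x_2^{-1}x_3^{-1}(x_2x_3)^2x_1x_2x_3$,\; $x_2^{-\epsilon+1}x_3x_2x_3x_1x_3^{-1}x_2^{-1}x_3^{-1}(x_2x_3)^2x_1x_2x_3$,\; $x_3^{-2}(x_2x_3)^2x_1x_2x_3$; 16. $x_1^2x_2x_3x_2^{-1}x_3^{-1}x_2^{-1}x_1^{-1}x_2x_3x_2^{-1}$,\; $x_2^{-\epsilon-1}x_3^{-1}x_2^{-1}x_1^{-1}x_2x_3x_2^{-1}$,\; $x_2^{-1}x_1x_2x_3$; 17. $x_1^{-\epsilon+1}x_3^{-1}x_2^{-1}x_3^{-1}x_2x_3x_1^{-1}x_3^{-1}x_2^{-1}x_1^{-1}$,\; $x_3x_2x_3x_1x_3^{-1}x_2^{-1}x_3^{-1}x_2x_3x_1^{-1}x_3^{-1}x_2^{-1}x_1^{-1}$,\; $x_3x_2x_3x_1^{-1}x_3^{-1}x_2^{-1}x_1^{-1}$; 18. $x_1^3(x_2x_3)^{\epsilon}x_2(x_2x_3)^{-\epsilon}(x_3^{-1}x_2^{-1}x_1^{-1})(x_3^{-1}x_2^{-1}x_1^{-1})$,\;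 $x_2^{-1}(x_2x_3)^{-\epsilon}x_1(x_2x_3)^{\epsilon}x_2(x_2x_3)^{-\epsilon}(x_3^{-1}x_2^{-1}x_1^{-1})(x_3^{-1}x_2^{-1}x_1^{-1})$,\; $x_3(x_2x_3)^{-\epsilon}(x_3^{-1}x_2^{-1}x_1^{-1})(x_3^{-1}x_2^{-1}x_1^{-1})$; 19. $x_3^{-1}x_2x_3x_1x_3^{-1}x_2x_3(x_1x_2x_3)^{-\epsilon}$,\; $x_2^2(x_3x_1x_3^{-1}x_2)(x_3x_1x_3^{-1}x_2)x_3(x_1x_2x_3)^{-\epsilon}$,\; $x_3^{-2}x_2x_3(x_1x_2x_3)^{-\epsilon}$; 20. $x_1(x_2x_3x_2^{-1}x_3^{-1}x_2^{-1}x_1^{-1})(x_2x_3x_2^{-1}x_3^{-1}x_2^{-1}x_1^{-1})(x_1x_2x_3)^{-\epsilon}$,\; $x_3^{-1}x_2^{-1}x_1^{-1}x_2x_3x_2^{-1}x_3^{-1}x_2^{-1}x_1^{-1}(x_1x_2x_3)^{-\epsilon}$,\; $x_3x_2^{-1}(x_1x_2x_3)^{-\epsilon}$. -/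

import Mathlib

/-! ## Artinian presentations -/

/-- The `n` words `r₁, …, rₙ` in the free group `F(x₁, …, xₙ)` form a W-Artinian `n`-presentation:
`∏ rᵢ⁻¹ xᵢ rᵢ = ∏ xᵢ` in `F(x₁, …, xₙ)`, both products taken in the order of the indices. -/
def IsWArtinian {n : ℕ} (r : Fin n → FreeGroup (Fin n)) : Prop :=
  (List.ofFn fun i => (r i)⁻¹ * FreeGroup.of i * r i).prod =
    (List.ofFn fun i : Fin n => FreeGroup.of i).prod

/-- The group `⟨x₁, …, xₙ : r₁, …, rₙ⟩` is trivial. -/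
def PresentsTrivialGroup {n : ℕ} (r : Fin n → FreeGroup (Fin n)) : Prop :=
  Subsingleton (PresentedGroup (Set.range r))

/-! ## Link diagrams

A (generic, unoriented) link diagram is read from bottom to top as a sequence of slices, each of
which contains one elementary piece, placed to the right of a given number of vertical strands. -/

/-- Elementary pieces: a local minimum, a local maximum, and the two crossings.  In
`cross true` the strand that runs from bottom left to top right is the over-strand, in
`cross false` it is the under-strand. -/
inductive Piece
  | cup
  | cap
  | cross (positive : Bool)

/-- The number of strands that enter a piece from below. -/
def Piece.inputs : Piece → ℕ
  | cup => 0
  | cap => 2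
  | cross _ => 2

/-- The number of strands that leave a piece at its top. -/
def Piece.outputs : Piece → ℕ
  | cup => 2
  | cap => 0
  | cross _ => 2

/-- A piece together with the number of strands to the left of it. -/
abbrev Slice := Piece × ℕ

/-- `Runs n w m`: starting from `n` strands, all the slices of `w` can be performed one after the
other, and `m` strands remain. -/
inductive Runs : ℕ → List Slice → ℕ → Prop
  | nil (n : ℕ) : Runs n [] n
  | cons (p : Piece) (i k m : ℕ) (w : List Slice) :
      Runs (i + p.outputs + k) w m → Runs (i + p.inputs + k) ((p, i) :: w) m

/-- A sequence of slices is a link diagram if it starts and ends with no strands. -/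
def IsLinkDiagram (w : List Slice) : Prop := Runs 0 w 0

/-- The elementary moves: planar isotopies and Reidemeister moves. -/
inductive Move : List Slice → List Slice → Prop
  /-- Pieces at different places are independent: the left one may pass below or above the
  right one. -/
  | far (p q : Piece) (i k : ℕ) :
      Move [(p, i), (q, i + p.outputs + k)] [(q, i + p.inputs + k), (p, i)]
  /-- A zigzag is straightened. -/
  | zigzagRight (i : ℕ) : Move [(.cup, i), (.cap, i + 1)] []
  /-- A zigzag is straightened. -/
  | zigzagLeft (i : ℕ) : Move [(.cup, i + 1), (.cap, i)] []
  /-- A crossing slides over a local minimum. -/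
  | slideCup (b : Bool) (i : ℕ) :
      Move [(.cup, i), (.cross b, i + 1)] [(.cup, i + 1), (.cross !b, i)]
  /-- A crossing slides over a local maximum. -/
  | slideCap (b : Bool) (i : ℕ) :
      Move [(.cross b, i + 1), (.cap, i)] [(.cross !b, i), (.cap, i + 1)]
  /-- First Reidemeister move at a local minimum. -/
  | reidemeisterOneCup (b : Bool) (i : ℕ) : Move [(.cup, i), (.cross b, i)] [(.cup, i)]
  /-- First Reidemeister move at a local maximum. -/
  | reidemeisterOneCap (b : Bool) (i : ℕ) : Move [(.cross b, i), (.cap, i)] [(.cap, i)]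
  /-- Second Reidemeister move. -/
  | reidemeisterTwo (b : Bool) (i : ℕ) : Move [(.cross b, i), (.cross !b, i)] []
  /-- Third Reidemeister move. -/
  | reidemeisterThree (b : Bool) (i : ℕ) :
      Move [(.cross b, i), (.cross b, i + 1), (.cross b, i)]
        [(.cross b, i + 1), (.cross b, i), (.cross b, i + 1)]

/-- One link diagram is obtained from another by one elementary move, carried out somewhere in the
diagram. -/
def DiagramStep (w w' : List Slice) : Prop :=
  IsLinkDiagram w ∧ IsLinkDiagram w' ∧
    ∃ u a b v : List Slice, Move a b ∧ w = u ++ a ++ v ∧ w' = u ++ b ++ v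

/-- The diagram `w` is a diagram of the trivial knot: it is related to the crossingless round
circle by finitely many elementary moves and their inverses. -/
def IsTrivialKnot (w : List Slice) : Prop :=
  Relation.EqvGen DiagramStep w [(.cup, 0), (.cap, 0)]

/-! ## The hexatangle -/

/-- An integral filling `(α, β, γ, δ, ε, η)` of the six boxes of the hexatangle. -/
@[ext] structure Filling where
  α : ℤ
  β : ℤ
  γ : ℤ
  δ : ℤ
  ε : ℤ
  η : ℤ

/-- The integral tangle `n`: a row of `|n|` crossings, whose type is given by the sign of `n`,
between the strands number `i` and `i + 1` (counted from `0`). -/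
def twists (n : ℤ) (i : ℕ) : List Slice :=
  List.replicate n.natAbs (.cross (decide (0 ≤ n)), i)

/-- The link diagram `H(α, β, γ, δ, ε, η)` obtained by filling the hexatangle.  The six boxes
correspond to the edges of a tetrahedron with vertices `0, 1, 2, 3`:
`α = 01`, `β = 12`, `γ = 13`, `δ = 02`, `ε = 23`, `η = 03` (so `α, ε` and `β, η` and `γ, δ` are the
pairs of opposite boxes).  Each vertex is drawn as a vertical band bounded by two strands (closed at
the bottom by a local minimum and at the top by a local maximum), and the box of an edge is a row
of crossings between the two bands that the edge joins.  Reading upwards: bands `0, 1, 3` start and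
`1, 3` are joined; band `2` starts between `1` and `3` and the neighbours are joined; band `1`
ends and `0, 2` are joined; band `2` ends and `0, 3` are joined; bands `0, 3` end. -/
def hexatangle (f : Filling) : List Slice :=
  [(.cup, 0), (.cup, 2), (.cup, 4)] ++ twists f.γ 3 ++
  [(.cup, 4)] ++ twists f.α 1 ++ twists f.β 3 ++ twists f.ε 5 ++
  [(.cap, 2)] ++ twists f.δ 1 ++
  [(.cap, 2)] ++ twists f.η 1 ++
  [(.cap, 0), (.cap, 0)]

/-- The parameter of the box on the edge `ij` of the tetrahedron (`0` if `i = j`). -/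
def Filling.edge (f : Filling) : Matrix (Fin 4) (Fin 4) ℤ :=
  !![0,   f.α, f.δ, f.η;
     f.α, 0,   f.β, f.γ;
     f.δ, f.β, 0,   f.ε;
     f.η, f.γ, f.ε, 0]

/-- `g` is obtained from `f` by one of the `24` symmetries of the tetrahedron. -/
def Filling.IsSymmetricTo (f g : Filling) : Prop :=
  ∃ s : Equiv.Perm (Fin 4), ∀ i j, g.edge (s i) (s j) = f.edge i j

namespace Hexatangle

/-- The first generator `x₁` of `F(x₁, x₂, x₃)`. -/
abbrev x : FreeGroup (Fin 3) := FreeGroup.of 0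

/-- The second generator `x₂` of `F(x₁, x₂, x₃)`. -/
abbrev y : FreeGroup (Fin 3) := FreeGroup.of 1

/-- The third generator `x₃` of `F(x₁, x₂, x₃)`. -/
abbrev z : FreeGroup (Fin 3) := FreeGroup.of 2

/-- The relators of the Artin `3`-presentation associated to (the double branched cover of) the
filled hexatangle `H(α, β, γ, δ, ε, η)`. -/
def relators (f : Filling) : Fin 3 → FreeGroup (Fin 3) :=
  ![x ^ (-f.α) * (x * (y * z) ^ f.γ * y * (y * z) ^ (-f.γ)) ^ (-f.δ) *
      (x * y * z) ^ (-f.η),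
    y ^ (-f.β) * (y * z) ^ (-f.γ) *
      (x * (y * z) ^ f.γ * y * (y * z) ^ (-f.γ)) ^ (-f.δ) * (x * y * z) ^ (-f.η),
    z ^ (-f.ε) * (y * z) ^ (-f.γ) * (x * y * z) ^ (-f.η)]

/-- The triple `r` is a W-Artinian `3`-presentation of the trivial group, and it is the one
associated to a filling of the hexatangle that yields the trivial knot and that agrees, up to a
symmetry of the tetrahedron, with one of the fillings in `B`. -/
def IsExampleFrom (B : Set Filling) (r : Fin 3 → FreeGroup (Fin 3)) : Prop :=
  IsWArtinian r ∧ PresentsTrivialGroup r ∧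
    ∃ f : Filling, r = relators f ∧ IsTrivialKnot (hexatangle f) ∧ ∃ b ∈ B, b.IsSymmetricTo f

/-! ## The tables of triples `(r₁, r₂, r₃)`, in terms of `x = x₁`, `y = x₂`, `z = x₃` -/

/-- Examples from the fillings `H(±1, ±1, ±1, 0, 0, 0)` and `H(±1, 0, ±1, 0, ±1, 0)`. -/
def firstTable : List (Fin 3 → FreeGroup (Fin 3)) :=
  [ ![x⁻¹,
     y⁻¹*z⁻¹*y⁻¹,
     z⁻¹*y⁻¹],
    ![y⁻¹*x⁻¹,
     y^(-2 : ℤ)*x⁻¹,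
     z⁻¹],
    ![z⁻¹*y⁻¹*x⁻¹,
     z⁻¹*y⁻¹*z⁻¹*y⁻¹*x⁻¹,
     z^(-2 : ℤ)*y⁻¹*z⁻¹*y⁻¹*x⁻¹],
    ![x⁻¹*y⁻¹*x⁻¹*z⁻¹*y⁻¹*x⁻¹,
     y⁻¹*x⁻¹*z⁻¹*y⁻¹*x⁻¹,
     z⁻¹*y⁻¹*x⁻¹],
    ![x⁻¹,
     z,
     y*z],
    ![x⁻¹,
     y*z⁻¹*y⁻¹,
     z⁻¹*y⁻¹],
    ![z⁻¹*y⁻¹*x⁻¹,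
     z⁻¹*y⁻¹*z⁻¹*y⁻¹*x⁻¹,
     y⁻¹*z⁻¹*y⁻¹*x⁻¹],
    ![y*z⁻¹*y⁻¹*x⁻¹,
     x*y*z⁻¹*y⁻¹*x⁻¹,
     z⁻¹*y⁻¹*x⁻¹],
    ![x*y*z,
     z⁻¹*y⁻¹*x*y*z,
     z^(-2 : ℤ)*y⁻¹*x*y*z],
    ![x⁻¹*z,
     z,
     x*y*z],
    ![z⁻¹*y⁻¹*x⁻¹,
     x⁻¹,
     z⁻¹*x⁻¹],
    ![x*y⁻¹*x⁻¹*z⁻¹*y⁻¹*x⁻¹,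
     y⁻¹*x⁻¹*z⁻¹*y⁻¹*x⁻¹,
     z⁻¹*y⁻¹*x⁻¹],
    ![x⁻¹*y*z*y⁻¹*z⁻¹*y⁻¹*x⁻¹,
     y⁻¹*z⁻¹*y⁻¹*x⁻¹,
     z⁻¹*y⁻¹],
    ![x⁻¹,
     y⁻¹,
     z⁻¹],
    ![y*z*y⁻¹*z⁻¹*y⁻¹*x⁻¹,
     y^(-2 : ℤ)*z⁻¹*y⁻¹*x⁻¹,
     z⁻¹*y⁻¹],
    ![x⁻¹*z⁻¹*y⁻¹*x⁻¹,
     y⁻¹*z⁻¹*y⁻¹*x⁻¹,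
     z⁻¹*y⁻¹*x⁻¹],
    ![z⁻¹*y⁻¹*x⁻¹,
     (y⁻¹*z⁻¹)*(y⁻¹*z⁻¹)*y⁻¹*x⁻¹,
     z⁻¹*y⁻¹*z⁻¹*y⁻¹*x⁻¹],
    ![y*z*y⁻¹*z⁻¹*y⁻¹*x⁻¹,
     y⁻¹*z⁻¹*y⁻¹*x⁻¹,
     z^(-2 : ℤ)*y⁻¹],
    ![z⁻¹*y⁻¹*x⁻¹,
     y⁻¹*z⁻¹*y⁻¹*x⁻¹,
     z^(-2 : ℤ)*y⁻¹*x⁻¹],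
    ![y⁻¹*x⁻¹*z⁻¹*y⁻¹*x⁻¹,
     y^(-2 : ℤ)*x⁻¹*z⁻¹*y⁻¹*x⁻¹,
     z⁻¹*y⁻¹*x⁻¹] ]

/-- Examples from the filling `H(-1, 0, 2, -1, 1, 0)`. -/
def secondTable : List (Fin 3 → FreeGroup (Fin 3)) :=
  [ ![x^2*(y*z)^2*y*(y*z)^(-2 : ℤ),
     (y*z)^(-2 : ℤ)*x*(y*z)^2*y*(y*z)^(-2 : ℤ),
     z^(-2 : ℤ)*y⁻¹*z⁻¹*y⁻¹],
    ![x^(-2 : ℤ)*z⁻¹*y⁻¹*z*x⁻¹,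
     z*x⁻¹,
     z*y*z],
    ![x^2*y*z,
     y^(-2 : ℤ)*x*y*z,
     z⁻¹*x*y*z],
    ![z⁻¹*y⁻¹*z*y*z,
     y^(-2 : ℤ)*z*y*z,
     y*z*x*y*z],
    ![x^(-2 : ℤ)*z⁻¹*y⁻¹*x⁻¹,
     y*z⁻¹*y⁻¹*x⁻¹,
     y⁻¹*x⁻¹],
    ![x*(y*z)^2*y*(y*z)^(-3 : ℤ)*x⁻¹,
     y*(y*z)^(-2 : ℤ)*x*(y*z)^2*y*(y*z)^(-3 : ℤ)*x⁻¹,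
     (y*z)⁻¹*(y*z)^(-2 : ℤ)*x⁻¹],
    ![x^2*y*z*y*z⁻¹*y⁻¹,
     z⁻¹*y⁻¹*x*y*z*y*z⁻¹*y⁻¹,
     z^(-3 : ℤ)*y⁻¹],
    ![x⁻¹*z⁻¹*y⁻¹*z*x⁻¹*z⁻¹*y⁻¹*z*x⁻¹,
     z*x⁻¹*z⁻¹*y⁻¹*z*x⁻¹,
     z*y*z],
    ![x^2*y*z,
     y⁻¹*x*y*z,
     z^(-2 : ℤ)*x*y*z],
    ![z⁻¹*y⁻¹*z*x⁻¹*z⁻¹*y⁻¹*z*y*z,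
     y⁻¹*z*x⁻¹*z⁻¹*y⁻¹*z*y*z,
     y*z*x*y*z],
    ![x⁻¹*z⁻¹*y⁻¹*x⁻¹*z⁻¹*y⁻¹*x⁻¹,
     y*z⁻¹*y⁻¹*x⁻¹*z⁻¹*y⁻¹*x⁻¹,
     y⁻¹*x⁻¹*z⁻¹*y⁻¹*x⁻¹],
    ![x*y*z*y*(y*z)^(-2 : ℤ)*(x*y*z*x)⁻¹,
     y*(y*z)⁻¹*x*y*z*y*(y*z)^(-2 : ℤ)*(x*y*z*x)⁻¹,
     (y*z)^(-2 : ℤ)*x⁻¹*z⁻¹*y⁻¹*x⁻¹],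
    ![x*y*z*y*z⁻¹*y⁻¹*x*y*z,
     y^(-2 : ℤ)*z⁻¹*y⁻¹*x*y*z*y*z⁻¹*y⁻¹*x*y*z,
     z⁻¹*y⁻¹*x*y*z],
    ![y*z,
     y^(-2 : ℤ)*x*y*z,
     z*x*y*z],
    ![x*(y*z)^2*y*(y*z)^(-2 : ℤ)*x*y*z,
     (z*y)^(-2 : ℤ)*y⁻¹*x*(y*z)^2*y*(y*z)^(-2 : ℤ)*x*y*z,
     (y*z)^(-2 : ℤ)*x*y*z],
    ![x⁻¹*y*z,
     y⁻¹*x*y*z,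
     z*x*y*z],
    ![(y*z)^2*y*(y*z)^(-2 : ℤ),
     (y*z)^(-2 : ℤ)*x*(y*z)^2*y*(y*z)^(-2 : ℤ),
     y⁻¹*z⁻¹*y⁻¹],
    ![x⁻¹*y*z*y*z⁻¹*y⁻¹,
     z⁻¹*y⁻¹*x*y*z*y*z⁻¹*y⁻¹,
     y⁻¹],
    ![(z⁻¹*y⁻¹*z*x⁻¹)*(z⁻¹*y⁻¹*z*x⁻¹)*z⁻¹*y⁻¹*x⁻¹,
     y*(z*x⁻¹*z⁻¹*y⁻¹)*(z*x⁻¹*z⁻¹*y⁻¹)*x⁻¹,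
     x⁻¹],
    ![x*z⁻¹*y⁻¹*x⁻¹,
     y*z⁻¹*y⁻¹*x⁻¹,
     z^(-3 : ℤ)*y⁻¹*x⁻¹] ]

/-- Examples from the fillings `H(1, -1, γ, -1, 1 - γ, 0)`. -/
def thirdTable (γ : ℤ) : List (Fin 3 → FreeGroup (Fin 3)) :=
  [ ![(y*z)^γ*y*(y*z)^(-γ),
     y*(y*z)^(-γ)*x*(y*z)^γ*y*(y*z)^(-γ),
     z^(γ - 1)*(y*z)^(-γ)],
    ![x^(-γ)*(x*y*z*y*z⁻¹*y⁻¹)^(γ - 1),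
     y*z⁻¹*y⁻¹*(x*y*z*y*z⁻¹*y⁻¹)^(γ - 1),
     y⁻¹],
    ![y*z,
     y^(-γ + 1)*z*x*y*z,
     z^(γ - 1)*y*z*x*y*z],
    ![x*(x*y*z*y*z⁻¹*y⁻¹)^(γ - 1)*x*y*z,
     y^(-γ)*z⁻¹*y⁻¹*(x*y*z*y*z⁻¹*y⁻¹)^(γ - 1)*x*y*z,
     z⁻¹*y⁻¹*x*y*z],
    ![x^(-γ)*(x*y*z)^(γ - 1),
     z*(x*y*z)^(γ - 1),
     z*y*z*(x*y*z)^(γ - 1)],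
    ![x^2*(y*z)^γ*y*(y*z)^(-γ)*(x*y*z)^(γ - 1),
     y⁻¹*(y*z)^(-γ)*x*(y*z)^γ*y*(y*z)^(-γ)*(x*y*z)^(γ - 1),
     (y*z)^(-γ)*(x*y*z)^(γ - 1)],
    ![x*(y*z)^(-γ + 1)*y⁻¹*(y*z)^(γ - 1)*x⁻¹,
     (y*z)^(γ - 1)*x⁻¹,
     z^(-γ)*(y*z)^(γ - 1)],
    ![x^(γ - 1)*(x*z⁻¹*y*z)^(-γ),
     y^2*z*(x*z⁻¹*y*z)^(-γ),
     z⁻¹*y*z],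
    ![x*z⁻¹*y⁻¹*x⁻¹,
     y^(γ - 1)*x⁻¹,
     z^(-γ)*x⁻¹],
    ![x*(x*z⁻¹*y*z)^(-γ)*z⁻¹*y⁻¹*x⁻¹,
     y^γ*z*(x*z⁻¹*y*z)^(-γ)*z⁻¹*y⁻¹*x⁻¹,
     x⁻¹],
    ![x^(γ - 1)*(x*y*z)^(-γ),
     y^2*z*(x*y*z)^(-γ),
     z⁻¹*y*z*(x*y*z)^(-γ)],
    ![x*(y*z)^(-γ + 1)*y⁻¹*(y*z)^(γ - 1)*x⁻¹*(x*y*z)^(-γ),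
     (y*z)^(γ - 1)*x⁻¹*(x*y*z)^(-γ),
     (y*z)^(γ - 1)*(x*y*z)^(-γ)],
    ![(y*z)^(-γ + 1)*y⁻¹*(y*z)^γ,
     y^(-γ - 1)*(y*z)^γ,
     z*(y*z)^(γ - 1)*x*y*z],
    ![x^γ*y*x*y*z,
     y^(-γ)*(x*y)*(x*y)*z,
     z⁻¹*x*y*z],
    ![x*(y*z)^γ*y*(y*z)^(-γ)*z⁻¹*y⁻¹*x⁻¹,
     y^(γ - 1)*(y*z)^(-γ)*x*(y*z)^γ*y*(y*z)^(-γ)*z⁻¹*y⁻¹*x⁻¹,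
     z*(y*z)^(-γ)*z⁻¹*y⁻¹*x⁻¹],
    ![x^(-γ + 1)*y*z⁻¹*y⁻¹*x⁻¹,
     y^(γ - 1)*x*y*z⁻¹*y⁻¹*x⁻¹,
     y⁻¹*x⁻¹],
    ![x^γ*(y*z)^γ*y*(y*z)^(-γ)*x*y*z,
     (y*z)^(-γ)*x*(y*z)^γ*y*(y*z)^(-γ)*x*y*z,
     z⁻¹*(y*z)^(-γ)*x*y*z],
    ![x^(-γ)*(y*z)^(-γ + 1)*y⁻¹*(y*z)^γ,
     y⁻¹*(y*z)^γ,
     z*(y*z)^(γ - 1)*x*y*z],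
    ![(x*z⁻¹*y*z)^(-γ)*(x*y*z)^(γ - 1),
     z*(x*z⁻¹*y*z)^(-γ)*(x*y*z)^(γ - 1),
     z*y*z*(x*y*z)^(γ - 1)],
    ![x^2*y*(x*y*z)^(γ - 1),
     y⁻¹*x*y*(x*y*z)^(γ - 1),
     z^(-γ)*(x*y*z)^(γ - 1)] ]

/-- Examples from the fillings `H(1, -1, γ, -2, -1, 0)`. -/
def fourthTable (γ : ℤ) : List (Fin 3 → FreeGroup (Fin 3)) :=
  [ ![(y*z)^γ*y*(y*z)^(-γ)*x*(y*z)^γ*y*(y*z)^(-γ),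
     (y*(y*z)^(-γ)*x*(y*z)^γ)^2*y*(y*z)^(-γ),
     z*(y*z)^(-γ)],
    ![x^(-γ + 1)*y*z*y*z⁻¹*y⁻¹,
     y*z⁻¹*y⁻¹*x*y*z*y*z⁻¹*y⁻¹,
     z*y⁻¹],
    ![y*z*x*y*z,
     y^(-γ + 1)*(z*x*y)*(z*x*y)*z,
     z*(y*z*x)*(y*z*x)*y*z],
    ![x^2*y*z*y*z⁻¹*y⁻¹*(x*y*z)*(x*y*z),
     y^(-γ)*z⁻¹*y⁻¹*x*y*z*y*z⁻¹*y⁻¹*(x*y*z)*(x*y*z),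
     z⁻¹*y⁻¹*(x*y*z)*(x*y*z)],
    ![x^(-γ + 1)*y*z,
     z*x*y*z,
     z^2*y*z*x*y*z],
    ![x^2*((y*z)^γ*y*(y*z)^(-γ)*x)*((y*z)^γ*y*(y*z)^(-γ)*x)*y*z,
     y⁻¹*((y*z)^(-γ)*x*(y*z)^γ*y)*((y*z)^(-γ)*x*(y*z)^γ*y)*(y*z)^(-γ)*x*y*z,
     (y*z)^(-γ)*x*y*z],
    ![x^2*z⁻¹*y⁻¹*z*x⁻¹,
     y*z*x⁻¹,
     z^(-γ)*y*z],
    ![x*(x*z⁻¹*y⁻¹*z⁻¹*y*z*y*z)^(-γ),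
     y^2*z*y*z*(x*z⁻¹*y⁻¹*z⁻¹*y*z*y*z)^(-γ),
     z⁻¹*y*z*y*z],
    ![x^2*(x*y*z)⁻¹,
     y*x⁻¹,
     z^(-γ)*x⁻¹],
    ![x*(x*(z*y*z)⁻¹*(y*z)^2)^(-γ)*(x*y*z)⁻¹,
     y^2*z*y*z*(x*(z*y*z)⁻¹*(y*z)^2)^(-γ)*(x*y*z)⁻¹,
     y*z*x⁻¹],
    ![x*(x*y*z)^(-γ),
     y^3*z*(x*y*z)^(-γ),
     z⁻¹*y*z*(x*y*z)^(-γ)],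
    ![x*z⁻¹*y⁻¹*z*x⁻¹*(x*y*z)^(-γ),
     y^2*z*x⁻¹*(x*y*z)^(-γ),
     y*z*(x*y*z)^(-γ)],
    ![z⁻¹*y⁻¹*z*y*z*x*y*z,
     y^(-γ)*z*y*z*x*y*z,
     z*(y*z*x)*(y*z*x)*y*z],
    ![x^2*y*(x*y*z)*(x*y*z),
     y^(-γ)*(x*y)*(x*y)*z*x*y*z,
     z⁻¹*x*y*z*x*y*z],
    ![(x*(y*z)^γ*y*(y*z)^(-γ))*(x*(y*z)^γ*y*(y*z)^(-γ))*(x*y*z)⁻¹,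
     (y*(y*z)^(-γ)*x*(y*z)^γ)*(y*(y*z)^(-γ)*x*(y*z)^γ)*y*(y*z)^(-γ)*(x*y*z)⁻¹,
     z*(y*z)^(-γ)*(x*y*z)⁻¹],
    ![x^(-γ + 1)*y*(x*y*z)⁻¹,
     y*x*y*(x*y*z)⁻¹,
     z*y⁻¹*x⁻¹],
    ![x^2*((y*z)^γ*y*(y*z)^(-γ)*x)*((y*z)^γ*y*(y*z)^(-γ)*x)*y*z,
     ((y*z)^(-γ)*x*(y*z)^γ*y)*((y*z)^(-γ)*x*(y*z)^γ*y)*(y*z)^(-γ)*x*y*z,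
     z⁻¹*(y*z)^(-γ)*x*y*z],
    ![x^(-γ)*z⁻¹*y⁻¹*z*y*z,
     z*y*z,
     z^2*y*z*x*y*z],
    ![(x*z⁻¹*y⁻¹*z⁻¹*y*z*y*z)^(-γ)*x*y*z,
     z*y*z*(x*z⁻¹*y⁻¹*z⁻¹*y*z*y*z)^(-γ)*x*y*z,
     (z*y)*(z*y)*z*x*y*z],
    ![x^3*y*x*y*z,
     y⁻¹*(x*y)*(x*y)*z,
     z^(-γ)*x*y*z] ]

/-- Examples from the fillings `H(1, β, -2, -1, 2, 1)`. -/
def fifthTable (β : ℤ) : List (Fin 3 → FreeGroup (Fin 3)) :=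
  [ ![z⁻¹*y⁻¹*z⁻¹*y*z*x⁻¹,
     y^(-β + 1)*z*y*z*x*z⁻¹*y⁻¹*z⁻¹*y*z*x⁻¹,
     z^(-2 : ℤ)*y*z*x⁻¹],
    ![x^2*y*z*y⁻¹*z⁻¹*y⁻¹*x⁻¹*y*z*y⁻¹*(z⁻¹*y⁻¹*x⁻¹)*(z⁻¹*y⁻¹*x⁻¹),
     y^(-β - 1)*z⁻¹*y⁻¹*x⁻¹*y*z*y⁻¹*(z⁻¹*y⁻¹*x⁻¹)*(z⁻¹*y⁻¹*x⁻¹),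
     y⁻¹*z⁻¹*y⁻¹*x⁻¹],
    ![x⁻¹*(y*z)^β*y⁻¹*(y*z)^(-β + 1),
     y*(y*z)^(-β + 1),
     z^(-2 : ℤ)*(y*z)^(-β)*x*y*z],
    ![x^(-β)*y*z*y⁻¹*z⁻¹*y⁻¹*x⁻¹*y*z*y⁻¹,
     y*z⁻¹*y⁻¹*x⁻¹*y*z*y⁻¹,
     z^(-2 : ℤ)*y⁻¹*x*y*z],
    ![x^2*(y*z)^β*y⁻¹*(y*z)^(-β)*(x⁻¹*z⁻¹*y⁻¹)*(x⁻¹*z⁻¹*y⁻¹)*x⁻¹,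
     y^(-2 : ℤ)*(y*z)^(-β)*(x⁻¹*z⁻¹*y⁻¹)*(x⁻¹*z⁻¹*y⁻¹)*x⁻¹,
     z*(y*z)^(-β)*(z⁻¹*y⁻¹*x⁻¹)*(z⁻¹*y⁻¹*x⁻¹)],
    ![x^(-β + 1)*z⁻¹*y⁻¹*z⁻¹*y*z*x⁻¹*z⁻¹*y⁻¹*x⁻¹,
     z*y*z*x*z⁻¹*y⁻¹*z⁻¹*y*z*x⁻¹*z⁻¹*y⁻¹*x⁻¹,
     z⁻¹*y*z*x⁻¹*z⁻¹*y⁻¹*x⁻¹],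
    ![x*(y*z)^2*(y⁻¹*z⁻¹)*(y⁻¹*z⁻¹)*y⁻¹*x⁻¹*z⁻¹*y⁻¹*x⁻¹,
     y^(-β - 1)*(z⁻¹*y⁻¹)*(z⁻¹*y⁻¹)*x⁻¹*z⁻¹*y⁻¹*x⁻¹,
     z*(y⁻¹*z⁻¹)*(y⁻¹*z⁻¹)*y⁻¹*x⁻¹],
    ![x⁻¹*z⁻¹*y*z*x*z⁻¹*x⁻¹,
     y^(-β + 1)*z*x*z⁻¹*y*z*x*z⁻¹*x⁻¹,
     z⁻¹*x⁻¹],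
    ![x*(y*z)^β*y⁻¹*(y*z)^(-β)*x⁻¹*z⁻¹*y⁻¹*x⁻¹,
     y^(-3 : ℤ)*(y*z)^(-β)*x⁻¹*z⁻¹*y⁻¹*x⁻¹,
     z^2*(y*z)^(-β)*z⁻¹*y⁻¹*x⁻¹],
    ![x^(-β + 1)*z⁻¹*y*z*x*z⁻¹*x⁻¹,
     y⁻¹*z*x*z⁻¹*y*z*x*z⁻¹*x⁻¹,
     z⁻¹*x⁻¹],
    ![x^(-2 : ℤ)*(y*z)^β*y⁻¹*(y*z)^(-β + 1)*x*y*z,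
     (y*z)^(-β + 1)*x*y*z,
     z⁻¹*(y*z)^(-β)*(x*y*z)*(x*y*z)],
    ![x^(-β)*(y*z)^2*y⁻¹*z⁻¹*y⁻¹*x*y*z,
     z⁻¹*y⁻¹*x*y*z,
     z^(-2 : ℤ)*y⁻¹*z⁻¹*y⁻¹*(x*y*z)*(x*y*z)],
    ![x⁻¹*(y*z)^2*y⁻¹*z⁻¹*y⁻¹,
     y*z⁻¹*y⁻¹,
     z^(-β - 1)*y⁻¹*z⁻¹*y⁻¹*x*y*z],
    ![x^(-2 : ℤ)*(x*y*z*y*z⁻¹*y⁻¹)^(-β)*x*y*z,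
     y^2*z⁻¹*y⁻¹*(x*y*z*y*z⁻¹*y⁻¹)^(-β)*x*y*z,
     z^(-2 : ℤ)*y⁻¹*x*y*z],
    ![z⁻¹*y⁻¹*z⁻¹*y*z*x⁻¹,
     y⁻¹*z*y*z*x*z⁻¹*y⁻¹*z⁻¹*y*z*x⁻¹,
     z^(-β)*y*z*x⁻¹],
    ![x^2*(x*y*z*y*z⁻¹*y⁻¹)^(-β)*z⁻¹*y⁻¹*x⁻¹,
     y^(-2 : ℤ)*z⁻¹*y⁻¹*(x*y*z*y*z⁻¹*y⁻¹)^(-β)*z⁻¹*y⁻¹*x⁻¹,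
     y⁻¹*z⁻¹*y⁻¹*x⁻¹],
    ![x⁻¹*z⁻¹*y⁻¹*z⁻¹*(y*z)^2*(x*y*z)^(-β),
     z*y*z*x*z⁻¹*y⁻¹*z⁻¹*(y*z)^2*(x*y*z)^(-β),
     z⁻¹*(y*z)^2*(x*y*z)^(-β)],
    ![x^2*(y*z)^2*(y⁻¹*z⁻¹)*(y⁻¹*z⁻¹)*y⁻¹*x⁻¹*(x*y*z)^(-β),
     y^(-2 : ℤ)*(z⁻¹*y⁻¹)*(z⁻¹*y⁻¹)*x⁻¹*(x*y*z)^(-β),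
     y⁻¹*z⁻¹*y⁻¹*(x*y*z)^(-β)],
    ![z⁻¹*y*z*x*z⁻¹*x⁻¹*z⁻¹*y⁻¹*x⁻¹,
     z*x*z⁻¹*y*z*x*z⁻¹*x⁻¹*z⁻¹*y⁻¹*x⁻¹,
     z^(-β)*x⁻¹*z⁻¹*y⁻¹*x⁻¹],
    ![x*(x*y*z*y*z⁻¹*y⁻¹)^(-β)*(z⁻¹*y⁻¹*x⁻¹)*(z⁻¹*y⁻¹*x⁻¹),
     y⁻¹*z⁻¹*y⁻¹*(x*y*z*y*z⁻¹*y⁻¹)^(-β)*(z⁻¹*y⁻¹*x⁻¹)*(z⁻¹*y⁻¹*x⁻¹),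
     z*y⁻¹*(z⁻¹*y⁻¹*x⁻¹)*(z⁻¹*y⁻¹*x⁻¹)] ]

/-- Examples from the fillings `H(-1, 2, -2, -1, ε, 1)`. -/
def sixthTable (ε : ℤ) : List (Fin 3 → FreeGroup (Fin 3)) :=
  [ ![x^2*z⁻¹*y⁻¹*z⁻¹*y*z*x⁻¹,
     y⁻¹*z*y*z*x*z⁻¹*y⁻¹*z⁻¹*y*z*x⁻¹,
     z^(-ε)*y*z*x⁻¹],
    ![x^2*(x*z⁻¹*y*z)^(-ε)*z⁻¹*y⁻¹*x⁻¹,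
     y⁻¹*z*(x*z⁻¹*y*z)^(-ε)*z⁻¹*y⁻¹*x⁻¹,
     z*x⁻¹],
    ![x*(y*z)^2*y⁻¹*z⁻¹*y⁻¹,
     y*z⁻¹*y⁻¹,
     z^(-ε - 1)*y⁻¹*z⁻¹*y⁻¹*x*y*z],
    ![x^(-2 : ℤ)*(x*z⁻¹*y*z)^(-ε)*x*y*z,
     y^3*z*(x*z⁻¹*y*z)^(-ε)*x*y*z,
     z⁻¹*y*z*x*y*z],
    ![x^2*(y*z)^2*(y⁻¹*z⁻¹)*(y⁻¹*z⁻¹)*y⁻¹*x⁻¹*(x*y*z)^(-ε),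
     (z⁻¹*y⁻¹)*(z⁻¹*y⁻¹)*x⁻¹*(x*y*z)^(-ε),
     y⁻¹*z⁻¹*y⁻¹*(x*y*z)^(-ε)],
    ![x⁻¹*z⁻¹*y⁻¹*z⁻¹*(y*z)^2*(x*y*z)^(-ε),
     y^2*z*y*z*x*z⁻¹*y⁻¹*z⁻¹*(y*z)^2*(x*y*z)^(-ε),
     z⁻¹*(y*z)^2*(x*y*z)^(-ε)],
    ![x^2*(y*z)^ε*y*(y*z)^(-ε)*z⁻¹*y⁻¹*x⁻¹,
     y^(-2 : ℤ)*(y*z)^(-ε)*x*(y*z)^ε*y*(y*z)^(-ε)*z⁻¹*y⁻¹*x⁻¹,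
     z^2*(y*z)^(-ε)*z⁻¹*y⁻¹*x⁻¹],
    ![x^(-ε + 1)*z⁻¹*y*z*x*z⁻¹*x⁻¹,
     y⁻¹*z*x*z⁻¹*y*z*x*z⁻¹*x⁻¹,
     z*x⁻¹],
    ![x*(y*z)^2*y⁻¹*z⁻¹*y⁻¹,
     y^(-ε - 1)*z⁻¹*y⁻¹,
     z*y⁻¹*z⁻¹*y⁻¹*x*y*z],
    ![x⁻¹*(z⁻¹*y*z*x)*(z⁻¹*y*z*x)*y*z,
     y^(-ε + 1)*(z*x*z⁻¹*y)*(z*x*z⁻¹*y)*z*x*y*z,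
     z⁻¹*y*z*x*y*z],
    ![x^(-ε)*(y*z)^2*y⁻¹*z⁻¹*y⁻¹*x*y*z,
     z⁻¹*y⁻¹*x*y*z,
     y⁻¹*z⁻¹*y⁻¹*(x*y*z)^2],
    ![x⁻¹*(y*z)^ε*y*(y*z)^(-ε)*(x*y*z)^2,
     y*(y*z)^(-ε)*x*(y*z)^ε*y*(y*z)^(-ε)*(x*y*z)^2,
     z⁻¹*(y*z)^(-ε)*(x*y*z)^2],
    ![(y*z)^ε*y*(y*z)^(-ε)*x*y*z,
     y^2*(y*z)^(-ε)*x*(y*z)^ε*y*(y*z)^(-ε)*x*y*z,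
     z^(-2 : ℤ)*(y*z)^(-ε)*x*y*z],
    ![x^(-ε)*y*z*y⁻¹*z⁻¹*y⁻¹*x⁻¹*y*z*y⁻¹,
     y*z⁻¹*y⁻¹*x⁻¹*y*z*y⁻¹,
     y⁻¹*x*y*z],
    ![z⁻¹*y⁻¹*z⁻¹*(y*z)^2*x*y*z,
     y^(-ε + 1)*z*y*z*x*z⁻¹*y⁻¹*z⁻¹*(y*z)^2*x*y*z,
     z^(-2 : ℤ)*(y*z)^2*x*y*z],
    ![x^2*y*z*y⁻¹*z⁻¹*y⁻¹*x⁻¹*y*z*y⁻¹,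
     y^(-ε - 1)*z⁻¹*y⁻¹*x⁻¹*y*z*y⁻¹,
     y⁻¹*x*y*z],
    ![x^(-ε + 1)*z⁻¹*y⁻¹*z⁻¹*y*z*x⁻¹*z⁻¹*y⁻¹*x⁻¹,
     z*y*z*x*z⁻¹*y⁻¹*z⁻¹*y*z*x⁻¹*z⁻¹*y⁻¹*x⁻¹,
     z*y*z*x⁻¹*z⁻¹*y⁻¹*x⁻¹],
    ![x^3*(y*z)^ε*y*(y*z)^(-ε)*(z⁻¹*y⁻¹*x⁻¹)*(z⁻¹*y⁻¹*x⁻¹),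
     y⁻¹*(y*z)^(-ε)*x*(y*z)^ε*y*(y*z)^(-ε)*(z⁻¹*y⁻¹*x⁻¹)*(z⁻¹*y⁻¹*x⁻¹),
     z*(y*z)^(-ε)*(z⁻¹*y⁻¹*x⁻¹)*(z⁻¹*y⁻¹*x⁻¹)],
    ![z⁻¹*y*z*x*z⁻¹*y*z*(x*y*z)^(-ε),
     y^2*(z*x*z⁻¹*y)*(z*x*z⁻¹*y)*z*(x*y*z)^(-ε),
     z^(-2 : ℤ)*y*z*(x*y*z)^(-ε)],
    ![x*(y*z*y⁻¹*z⁻¹*y⁻¹*x⁻¹)*(y*z*y⁻¹*z⁻¹*y⁻¹*x⁻¹)*(x*y*z)^(-ε),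
     z⁻¹*y⁻¹*x⁻¹*y*z*y⁻¹*z⁻¹*y⁻¹*x⁻¹*(x*y*z)^(-ε),
     z*y⁻¹*(x*y*z)^(-ε)] ]

end Hexatangle

/-!
The relators of a filled hexatangle satisfy the identity of a W-Artinian presentation for every
filling: in `rᵢ⁻¹ * xᵢ * rᵢ` most factors cancel, and the product of the three conjugates telescopes
(`isWArtinian_relators`).  So each row of the tables asks for three things: that it consists of the
relators of a filling in the orbit of the given one, that this filling yields the trivial knot, and
that the presented group is trivial.

The first is an identity in the free group for each row (`secondTable_eq` and its analogues); the
same twenty symmetries of the tetrahedron occur in each table but the first.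

For the second, whether the filled hexatangle is trivial depends on the filling only up to the
symmetries of the tetrahedron (`isTrivialKnot_permute`).  The transposition of
the vertices `0` and `3` is a half turn of the plane of projection, and those of `0, 1` and of
`1, 2` combine a half turn with planar isotopies; in the last case, a row of crossings is carried
along an arc from the bottom of the diagram to its top, for which the arc is first moved over the
rest of the diagram (`closure_twists`).  Since these transpositions generate the symmetric group,
it is enough to treat one convenient filling of each orbit.  There are four families:
`isTrivialKnot_tree`, where leaves are removed; `isTrivialKnot_contract`, where a vertex between
edges with the parameters `1` and `-1` is removed and its neighbours are merged;
`isTrivialKnot_series`, which replaces a vertex between edges with the parameters `1` and `-2` by an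
edge; and `isTrivialKnot_star`, which uses the star-triangle transformation.  The computations use
the relation `a ⇝ b`, that the tangle `a` may be replaced by `b` wherever it occurs.

The third follows from the second.  Color the strands of a diagram by elements of a group in such
a way that a strand of color `c` gets the color `a * c⁻¹ * a` when it passes under a strand of color
`a` (in the mirror image of the diagram, which fits the signs in the relators).  The elementary moves
carry colorings to colorings and constant ones to constant ones (`Move.colored`), so a diagram of
the trivial knot has only constant colorings. A row of `n` crossings multiplies the two colors `a,
c` of its strands by `(a⁻¹ * c) ^ n`, and so the filled hexatangle has a coloring by elements of
the presented group in which the generators are quotients of neighbouring colors: the conditions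
at the maxima are the three relators. As this coloring is constant, the generators are trivial
(`eq_one_of_isTrivialKnot_hexatangle`). This is the relation between a link and its double
branched cover in an elementary form.
-/

open Piece

/-! ### Diagrams and reductions -/

theorem Piece.inputs_cross (b : Bool) : (Piece.cross b).inputs = 2 := rfl

theorem Piece.outputs_cross (b : Bool) : (Piece.cross b).outputs = 2 := rfl

theorem runs_nil {n m : ℕ} : Runs n [] m ↔ n = m :=
  ⟨fun h => by cases h; rfl, fun h => h ▸ .nil n⟩

theorem runs_cons {n m i : ℕ} {p : Piece} {w : List Slice} :
    Runs n ((p, i) :: w) m ↔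
      i + p.inputs ≤ n ∧ Runs (n - p.inputs + p.outputs) w m := by
  constructor
  · intro h
    cases h with
    | cons p i k m w h =>
      refine ⟨by omega, ?_⟩
      convert h using 1
      omega
  · rintro ⟨h, h'⟩
    obtain ⟨k, rfl⟩ := Nat.exists_eq_add_of_le h
    refine .cons p i k m w ?_
    convert h' using 1
    omega

theorem runs_append {n m : ℕ} {u v : List Slice} :
    Runs n (u ++ v) m ↔ ∃ l, Runs n u l ∧ Runs l v m := by
  induction u generalizing n with
  | nil => simp [runs_nil]
  | cons s u ih => obtain ⟨p, i⟩ := s; simp [runs_cons, ih, and_assoc]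

/-- A move can be carried out wherever the diagram on its left-hand side fits. -/
theorem Move.runs {a b : List Slice} (h : Move a b) {n m : ℕ} (ha : Runs n a m) :
    Runs n b m := by
  cases h <;>
    simp only [runs_cons, runs_nil, Piece.inputs, Piece.outputs] at ha ⊢ <;> omega

/-- `Reduces a b`: in every link diagram that contains the tangle `a`, this tangle can be replaced
by `b`, and the result is an isotopic link diagram.  No condition on the number of strands around
`a` is needed: that they suffice is part of what it means that the diagram contains `a`.  The
relation is not symmetric, since for instance a zigzag may be inserted only next to a strand. -/
def Reduces (a b : List Slice) : Prop :=
  ∀ u v, IsLinkDiagram (u ++ (a ++ v)) →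
    IsLinkDiagram (u ++ (b ++ v)) ∧ Relation.EqvGen DiagramStep (u ++ (a ++ v)) (u ++ (b ++ v))

infix:50 " ⇝ " => Reduces

namespace Reduces

@[refl] theorem refl (a : List Slice) : a ⇝ a := fun _ _ h => ⟨h, .refl _⟩

@[trans] theorem trans {a b c : List Slice} (h : a ⇝ b) (h' : b ⇝ c) : a ⇝ c := fun u v hu =>
  ⟨(h' u v (h u v hu).1).1, .trans _ _ _ (h u v hu).2 (h' u v (h u v hu).1).2⟩

instance : Trans Reduces Reduces Reduces := ⟨trans⟩

@[gcongr] theorem append_left (u : List Slice) {a b : List Slice} (h : a ⇝ b) :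
    u ++ a ⇝ u ++ b := fun u' v hu => by
  simpa using h (u' ++ u) v (by simpa using hu)

theorem append_right {a b : List Slice} (h : a ⇝ b) (v : List Slice) : a ++ v ⇝ b ++ v :=
  fun u v' hu => by simpa using h u (v ++ v') (by simpa using hu)

@[gcongr] theorem cons (s : Slice) {a b : List Slice} (h : a ⇝ b) : s :: a ⇝ s :: b :=
  h.append_left [s]

/-- This allows one to rewrite both sides of a reduction with `grw`. -/
@[gcongr] theorem imp {a a' b b' : List Slice} (h : a ⇝ a') (h' : b' ⇝ b) :
    a' ⇝ b' → a ⇝ b := fun h'' => (h.trans h'').trans h'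

/-- A reduction can be reversed if the original tangle fits wherever the new one does. -/
theorem symm {a b : List Slice} (h : a ⇝ b) (hr : ∀ n m, Runs n b m → Runs n a m) : b ⇝ a := by
  intro u v hu
  have hu' : IsLinkDiagram (u ++ (a ++ v)) := by
    simp only [IsLinkDiagram, runs_append] at hu ⊢
    obtain ⟨l, h1, k, h2, h3⟩ := hu
    exact ⟨l, h1, k, hr _ _ h2, h3⟩
  exact ⟨hu', .symm _ _ (h u v hu').2⟩

theorem isTrivialKnot {a b : List Slice} (h : a ⇝ b) (ha : IsLinkDiagram a)
    (hb : IsTrivialKnot b) : IsTrivialKnot a :=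
  .trans _ _ _ (by simpa using (h [] [] (by simpa using ha)).2) hb

theorem isTrivialKnot' {a b : List Slice} (h : a ⇝ b) (ha : IsLinkDiagram a)
    (hb : IsTrivialKnot a) : IsTrivialKnot b :=
  .trans _ _ _ (.symm _ _ <| by simpa using (h [] [] (by simpa using ha)).2) hb

end Reduces

theorem Move.reduces {a b : List Slice} (h : Move a b) : a ⇝ b := by
  intro u v hu
  have hu' : IsLinkDiagram (u ++ (b ++ v)) := by
    simp only [IsLinkDiagram, runs_append] at hu ⊢
    obtain ⟨l, h1, k, h2, h3⟩ := hu
    exact ⟨l, h1, k, h.runs h2, h3⟩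
  exact ⟨hu', .rel _ _ ⟨hu, hu', u, a, b, v, h, by simp, by simp⟩⟩

/-- Distant pieces are interchanged; the second one may be on either side of the first one. -/
theorem swap_far (p : Piece) (i : ℕ) (q : Piece) (j i' j' : ℕ)
    (h : i + p.outputs ≤ j ∧ i' = i ∧ j' + p.outputs = j + p.inputs ∨
      j + q.inputs ≤ i ∧ j' = j ∧ i' + q.inputs = i + q.outputs) (v : List Slice) :
    (p, i) :: (q, j) :: v ⇝ (q, j') :: (p, i') :: v := by
  rcases h with ⟨h, rfl, h'⟩ | ⟨h, rfl, h'⟩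
  · obtain ⟨k, rfl⟩ := Nat.exists_eq_add_of_le h
    obtain rfl : j' = i' + p.inputs + k := by omega
    exact (Move.far p q i' k).reduces.append_right v
  · obtain ⟨k, rfl⟩ := Nat.exists_eq_add_of_le h
    obtain rfl : i' = j' + q.outputs + k := by omega
    refine ((Move.far q p j' k).reduces.symm ?_).append_right v
    intro n m
    simp only [runs_cons, runs_nil]
    omega

theorem swap_replicate (p : Piece) (i : ℕ) (k : ℕ) (b : Bool) (j i' j' : ℕ)
    (h : i + p.outputs ≤ j ∧ i' = i ∧ j' + p.outputs = j + p.inputs ∨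
      j + 2 ≤ i ∧ j' = j ∧ i' = i) (v : List Slice) :
    (p, i) :: (List.replicate k (.cross b, j) ++ v) ⇝
      List.replicate k (.cross b, j') ++ ((p, i') :: v) := by
  obtain rfl : i' = i := by omega
  induction k with
  | zero => rfl
  | succ k ih =>
    refine (swap_far p i' (.cross b) j i' j' ?_ _).trans (ih.cons _)
    rw [Piece.inputs_cross, Piece.outputs_cross]
    omega

theorem swap_twists (p : Piece) (i : ℕ) (n : ℤ) (j i' j' : ℕ)
    (h : i + p.outputs ≤ j ∧ i' = i ∧ j' + p.outputs = j + p.inputs ∨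
      j + 2 ≤ i ∧ j' = j ∧ i' = i) (v : List Slice) :
    (p, i) :: (twists n j ++ v) ⇝ twists n j' ++ ((p, i') :: v) :=
  swap_replicate p i _ _ j i' j' h v

theorem twists_swap (n : ℤ) (j : ℕ) (p : Piece) (i j' i' : ℕ)
    (h : j + 2 ≤ i ∧ i' = i ∧ j' = j ∨
      i + p.inputs ≤ j ∧ i' = i ∧ j' + p.inputs = j + p.outputs) (v : List Slice) :
    twists n j ++ ((p, i) :: v) ⇝ (p, i') :: (twists n j' ++ v) := by
  obtain rfl : i' = i := by omega
  unfold twists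
  induction n.natAbs with
  | zero => rfl
  | succ k ih =>
    refine (ih.cons _).trans (swap_far (.cross _) j p i' j' i' ?_ _)
    rw [Piece.inputs_cross, Piece.outputs_cross]
    omega

theorem twists_comm (n : ℤ) (i : ℕ) (m : ℤ) (j : ℕ) (h : i + 2 ≤ j ∨ j + 2 ≤ i) (v : List Slice) :
    twists n i ++ (twists m j ++ v) ⇝ twists m j ++ (twists n i ++ v) := by
  rw [show twists n i = List.replicate n.natAbs (.cross (decide (0 ≤ n)), i) from rfl]
  induction n.natAbs with
  | zero => rfl
  | succ k ih =>
    refine (ih.cons _).trans (swap_twists _ i m j i j ?_ _)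
    rw [Piece.inputs_cross, Piece.outputs_cross]
    omega

/-! ### The elementary moves as reductions -/

theorem zigzag_right (i j : ℕ) (v : List Slice) (h : j = i + 1 := by rfl) :
    (cup, i) :: (cap, j) :: v ⇝ v := by
  subst h
  exact (Move.zigzagRight i).reduces.append_right v

theorem zigzag_left (j i : ℕ) (v : List Slice) (h : j = i + 1 := by rfl) :
    (cup, j) :: (cap, i) :: v ⇝ v := by
  subst h
  exact (Move.zigzagLeft i).reduces.append_right v

theorem slide_cup (b : Bool) (i j : ℕ) (v : List Slice) (h : j = i + 1 := by rfl) :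
    (cup, i) :: (cross b, j) :: v ⇝ (cup, j) :: (cross !b, i) :: v := by
  subst h
  exact (Move.slideCup b i).reduces.append_right v

theorem slide_cup_left (b : Bool) (j i : ℕ) (v : List Slice) (h : j = i + 1 := by rfl) :
    (cup, j) :: (cross b, i) :: v ⇝ (cup, i) :: (cross !b, j) :: v := by
  subst h
  have := (Move.slideCup (!b) i).reduces.symm fun n m => by
    simp only [runs_cons, runs_nil, inputs, outputs]; omega
  simpa using this.append_right v

theorem slide_cap (b : Bool) (j i : ℕ) (v : List Slice) (h : j = i + 1 := by rfl) :
    (cross b, j) :: (cap, i) :: v ⇝ (cross !b, i) :: (cap, j) :: v := by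
  subst h
  exact (Move.slideCap b i).reduces.append_right v

theorem slide_cap_right (b : Bool) (i j : ℕ) (v : List Slice) (h : j = i + 1 := by rfl) :
    (cross b, i) :: (cap, j) :: v ⇝ (cross !b, j) :: (cap, i) :: v := by
  subst h
  have := (Move.slideCap (!b) i).reduces.symm fun n m => by
    simp only [runs_cons, runs_nil, inputs, outputs]; omega
  simpa using this.append_right v

theorem cup_kink (b : Bool) (i : ℕ) (v : List Slice) :
    (cup, i) :: (cross b, i) :: v ⇝ (cup, i) :: v :=
  (Move.reidemeisterOneCup b i).reduces.append_right v

theorem kink_cap (b : Bool) (i : ℕ) (v : List Slice) :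
    (cross b, i) :: (cap, i) :: v ⇝ (cap, i) :: v :=
  (Move.reidemeisterOneCap b i).reduces.append_right v

theorem cancel (b : Bool) (i : ℕ) (v : List Slice) :
    (cross b, i) :: (cross !b, i) :: v ⇝ v :=
  (Move.reidemeisterTwo b i).reduces.append_right v

theorem cancel' (b : Bool) (i : ℕ) (v : List Slice) :
    (cross !b, i) :: (cross b, i) :: v ⇝ v := by
  simpa using cancel (!b) i v

theorem braid (b : Bool) (i j : ℕ) (v : List Slice) (h : j = i + 1 := by rfl) :
    (cross b, i) :: (cross b, j) :: (cross b, i) :: v ⇝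
      (cross b, j) :: (cross b, i) :: (cross b, j) :: v := by
  subst h
  exact (Move.reidemeisterThree b i).reduces.append_right v

theorem braid' (b : Bool) (j i : ℕ) (v : List Slice) (h : j = i + 1 := by rfl) :
    (cross b, j) :: (cross b, i) :: (cross b, j) :: v ⇝
      (cross b, i) :: (cross b, j) :: (cross b, i) :: v := by
  subst h
  refine ((Move.reidemeisterThree b i).reduces.symm fun n m => ?_).append_right v
  simp only [runs_cons, runs_nil, inputs, outputs]
  omega

/-- The third Reidemeister move for crossings of different signs. -/
theorem braid_mixed (b : Bool) (i j : ℕ) (v : List Slice)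
    (h : j = i + 1 ∨ i = j + 1 := by decide) :
    (cross b, i) :: (cross b, j) :: (cross !b, i) :: v ⇝
      (cross !b, j) :: (cross b, i) :: (cross b, j) :: v := by
  have h₁ : [(cross !b, j), (cross b, j), (cross b, i), (cross b, j), (cross !b, i)] ⇝
      [(cross b, i), (cross b, j), (cross !b, i)] := cancel' _ _ _
  have h₂ : [(cross !b, j), (cross b, j), (cross b, i), (cross b, j), (cross !b, i)] ⇝
      [(cross !b, j), (cross b, i), (cross b, j)] := by
    rcases h with h | h
    · grw [braid' b j i _ h, cancel]
    · grw [braid b j i _ h, cancel]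
  refine ((h₁.symm fun n m => ?_).trans h₂).append_right v
  simp only [runs_cons, runs_nil, inputs, outputs]
  omega

theorem braid_mixed' (b : Bool) (i j : ℕ) (v : List Slice)
    (h : j = i + 1 ∨ i = j + 1 := by decide) :
    (cross !b, j) :: (cross b, i) :: (cross b, j) :: v ⇝
      (cross b, i) :: (cross b, j) :: (cross !b, i) :: v := by
  refine ((braid_mixed b i j [] h).symm fun n m => ?_).append_right v
  simp only [runs_cons, runs_nil, inputs, outputs]
  omega

/-! ### Rows of crossings -/

theorem twists_zero (i : ℕ) : twists 0 i = [] := rfl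

theorem runs_twists {n m i : ℕ} {k : ℤ} {w : List Slice} (h : i + 2 ≤ n) :
    Runs n (twists k i ++ w) m ↔ Runs n w m := by
  unfold twists
  induction k.natAbs with
  | zero => rfl
  | succ l ih =>
    rw [List.replicate_succ, List.cons_append, runs_cons, inputs_cross, outputs_cross,
      Nat.sub_add_cancel (by omega), ih]
    exact and_iff_right h

theorem runs_of_runs_twists {n m i : ℕ} {k : ℤ} {w : List Slice} (h : Runs n (twists k i ++ w) m) :
    Runs n w m := by
  rw [twists] at h
  generalize k.natAbs = l at h
  induction l with
  | zero => exact h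
  | succ l ih =>
    rw [List.replicate_succ, List.cons_append, runs_cons, inputs_cross, outputs_cross] at h
    rw [Nat.sub_add_cancel (by omega)] at h
    exact ih h.2

theorem twists_kink_cap (n : ℤ) (i : ℕ) (v : List Slice) :
    twists n i ++ (cap, i) :: v ⇝ (cap, i) :: v := by
  unfold twists
  induction n.natAbs with
  | zero => rfl
  | succ k ih => exact (ih.cons _).trans (kink_cap _ _ _)

theorem cup_kink_twists (n : ℤ) (i : ℕ) (v : List Slice) :
    (cup, i) :: (twists n i ++ v) ⇝ (cup, i) :: v := by
  unfold twists
  induction n.natAbs with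
  | zero => rfl
  | succ k ih => exact (cup_kink _ _ _).trans ih

theorem twists_succ (n : ℤ) (i : ℕ) (v : List Slice) :
    (cross true, i) :: (twists n i ++ v) ⇝ twists (n + 1) i ++ v := by
  rcases n with k | k
  · rfl
  · have : Int.negSucc k + 1 = -k := by omega
    rw [this]
    rcases k with _ | k
    · exact cancel true i v
    · exact cancel true i (List.replicate (k + 1) (cross false, i) ++ v)

theorem twists_pred (n : ℤ) (i : ℕ) (v : List Slice) :
    (cross false, i) :: (twists n i ++ v) ⇝ twists (n - 1) i ++ v := by
  rcases n with (_ | k) | k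
  · rfl
  · have : Int.ofNat (k + 1) - 1 = k := by simp
    rw [this]
    exact cancel false i (List.replicate k (cross true, i) ++ v)
  · rfl

theorem twists_add (n m : ℤ) (i : ℕ) (v : List Slice) :
    twists n i ++ (twists m i ++ v) ⇝ twists (n + m) i ++ v := by
  rcases n with k | k
  · change List.replicate k (cross true, i) ++ _ ⇝ twists (k + m) i ++ v
    induction k with
    | zero => rw [Nat.cast_zero, zero_add]; rfl
    | succ k ih =>
      refine (ih.cons _).trans ?_
      rw [show ((k + 1 : ℕ) + m : ℤ) = k + m + 1 by push_cast; ring]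
      exact twists_succ _ i v
  · change List.replicate (k + 1) (cross false, i) ++ _ ⇝ _
    rw [Int.negSucc_eq]
    induction k with
    | zero => rw [show -((0 : ℕ) + 1 : ℤ) + m = m - 1 by ring]; exact twists_pred m i v
    | succ k ih =>
      refine (ih.cons _).trans ?_
      rw [show -((k + 1 : ℕ) + 1 : ℤ) + m = -(k + 1 : ℤ) + m - 1 by push_cast; ring]
      exact twists_pred _ i v

/-! ### Rotation of a row of crossings -/

theorem nested_cups (b : Bool) (i : ℕ) (v : List Slice) :
    (cup, i) :: (cup, i + 1) :: (cross b, i) :: v ⇝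
      (cup, i) :: (cup, i + 1) :: (cross b, i + 2) :: v := by
  grw [slide_cup_left b (i + 1) i, swap_far cup i cup i (i + 2) i (by simp [inputs, outputs]),
    slide_cup_left (!b) (i + 2) (i + 1), Bool.not_not]

theorem nested_caps (b : Bool) (i : ℕ) (v : List Slice) :
    (cross b, i) :: (cap, i + 1) :: (cap, i) :: v ⇝
      (cross b, i + 2) :: (cap, i + 1) :: (cap, i) :: v := by
  grw [slide_cap_right b i (i + 1), swap_far cap i cap i i (i + 2) (by simp [inputs, outputs]),
    slide_cap_right (!b) (i + 1) (i + 2), Bool.not_not]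

/-- A row of crossings between the outer and inner strands of two nested minima can be moved
around them. -/
theorem nested_cups_twists (n : ℤ) (i : ℕ) (v : List Slice) :
    (cup, i) :: (cup, i + 1) :: (twists n i ++ v) ⇝
      (cup, i) :: (cup, i + 1) :: (twists n (i + 2) ++ v) := by
  unfold twists
  induction n.natAbs generalizing v with
  | zero => rfl
  | succ k ih =>
    rw [List.replicate_succ, List.cons_append]
    grw [nested_cups]
    grw [swap_replicate (cross _) (i + 2) k _ i (i + 2) i (by simp)]
    refine (ih _).trans ?_
    rw [List.replicate_succ', List.append_assoc, List.singleton_append]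

theorem nested_caps_twists (n : ℤ) (i : ℕ) (v : List Slice) :
    twists n i ++ (cap, i + 1) :: (cap, i) :: v ⇝
      twists n (i + 2) ++ (cap, i + 1) :: (cap, i) :: v := by
  unfold twists
  induction n.natAbs with
  | zero => rfl
  | succ k ih =>
    rw [List.replicate_succ, List.cons_append]
    grw [ih, swap_replicate (cross _) i k _ (i + 2) i (i + 2) (by simp [outputs, inputs]),
      nested_caps]
    rw [List.replicate_succ', List.append_assoc, List.singleton_append]

theorem rotate_twists_aux (n : ℤ) (i : ℕ) (v : List Slice) :
    ((cup, i) :: (cup, i + 3) :: (cup, i + 4) :: (twists n (i + 3) ++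
      (cap, i + 2) :: (cap, i + 1) :: (cap, i + 2) :: v) ⇝
      (cup, i + 2) :: (twists n (i + 1) ++ (cap, i) :: v)) ∧
    ((cup, i) :: (cup, i + 3) :: (cup, i + 4) :: (twists n (i + 3) ++
      (cap, i + 2) :: (cap, i + 1) :: (cap, i + 2) :: v) ⇝
      (cup, i) :: (twists n (i + 1) ++ (cap, i + 2) :: v)) := by
  constructor
  · grw [swap_far cap (i + 1) cap (i + 2) (i + 1) (i + 4) (by simp [inputs, outputs]),
      swap_far cap (i + 2) cap (i + 4) (i + 2) (i + 6) (by simp [inputs, outputs]),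
      twists_swap n (i + 3) cap (i + 6) (i + 3) (i + 6) (by simp),
      swap_far cup (i + 4) cap (i + 6) (i + 4) (i + 4) (by simp [inputs, outputs]),
      zigzag_right (i + 3) (i + 4),
      swap_far cup i cup (i + 4) i (i + 2) (by simp [inputs, outputs]),
      swap_twists cup i n (i + 3) i (i + 1) (by simp [inputs, outputs]),
      swap_far cup i cap (i + 2) i i (by simp [inputs, outputs]),
      zigzag_right i (i + 1)]
  · grw [nested_cups_twists n (i + 3),
      twists_swap n (i + 5) cap (i + 2) (i + 3) (i + 2) (by simp [inputs, outputs]),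
      twists_swap n (i + 3) cap (i + 1) (i + 1) (i + 1) (by simp [inputs, outputs]),
      swap_far cup (i + 4) cap (i + 2) (i + 2) (i + 2) (by simp [inputs, outputs]),
      zigzag_left (i + 3) (i + 2), zigzag_left (i + 2) (i + 1)]

/-- A row of crossings on a horizontal band may be rotated by a half turn about the axis of the
band: both sides are obtained from the row by a quarter turn, in opposite directions. -/
theorem rotate_twists (n : ℤ) (i : ℕ) (v : List Slice) :
      (cup, i) :: (twists n (i + 1) ++ (cap, i + 2) :: v) ⇝
      (cup, i + 2) :: (twists n (i + 1) ++ (cap, i) :: v) := by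
  have h := rotate_twists_aux n i []
  have := (h.2.symm fun l m => ?_).trans h.1
  · simpa using this.append_right v
  · intro h'
    rw [runs_cons] at h' ⊢
    have := runs_of_runs_twists h'.2
    simp only [runs_cons, inputs, outputs] at h' this ⊢
    rw [runs_twists (by omega), runs_cons, runs_cons, runs_cons]
    simp only [inputs, outputs]
    grind

/-! ### Half turns of the plane of projection -/

/-- The piece turned upside down (a half turn about the horizontal axis). -/
def Piece.flip : Piece → Piece
  | cup => cap
  | cap => cup
  | cross b => cross b

theorem Piece.inputs_flip (p : Piece) : p.flip.inputs = p.outputs := by cases p <;> rfl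

theorem Piece.outputs_flip (p : Piece) : p.flip.outputs = p.inputs := by cases p <;> rfl

/-- The diagram turned upside down by a half turn about the horizontal axis; a half turn of space
keeps the type of each crossing. -/
def flipVertical (w : List Slice) : List Slice :=
  (w.map fun s => (s.1.flip, s.2)).reverse

theorem Runs.flipVertical {n m : ℕ} {w : List Slice} (h : Runs n w m) :
    Runs m (flipVertical w) n := by
  induction h with
  | nil n => exact .nil n
  | cons p i k m w h ih =>
    rw [_root_.flipVertical, List.map_cons, List.reverse_cons, runs_append]
    refine ⟨_, ih, ?_⟩
    simp only [runs_cons, runs_nil, inputs_flip, outputs_flip]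
    omega

theorem Move.flipVertical {a b : List Slice} (h : Move a b) :
    Move (flipVertical a) (flipVertical b) ∨ Move (flipVertical b) (flipVertical a) := by
  cases h with
  | far p q i k =>
    right
    simpa [_root_.flipVertical, inputs_flip, outputs_flip] using Move.far p.flip q.flip i k
  | zigzagRight i => exact .inl (.zigzagLeft i)
  | zigzagLeft i => exact .inl (.zigzagRight i)
  | slideCup b i => exact .inl (.slideCap b i)
  | slideCap b i => exact .inl (.slideCup b i)
  | reidemeisterOneCup b i => exact .inl (.reidemeisterOneCap b i)
  | reidemeisterOneCap b i => exact .inl (.reidemeisterOneCup b i)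
  | reidemeisterTwo b i =>
    left
    simpa [_root_.flipVertical, Piece.flip] using Move.reidemeisterTwo (!b) i
  | reidemeisterThree b i => exact .inl (.reidemeisterThree b i)

theorem flipVertical_append (u v : List Slice) :
    flipVertical (u ++ v) = flipVertical v ++ flipVertical u := by
  simp [flipVertical]

theorem flipVertical_twists (n : ℤ) (i : ℕ) : flipVertical (twists n i) = twists n i := by
  simp [flipVertical, twists, Piece.flip]

theorem IsTrivialKnot.flipVertical {w : List Slice} (h : IsTrivialKnot w) :
    IsTrivialKnot (flipVertical w) := by
  have key : ∀ {a b}, Relation.EqvGen DiagramStep a b →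
      Relation.EqvGen DiagramStep (_root_.flipVertical a) (_root_.flipVertical b) := by
    intro a b h
    induction h with
    | rel a b h =>
      obtain ⟨ha, hb, u, c, d, v, hm, rfl, rfl⟩ := h
      have ha := ha.flipVertical
      have hb := hb.flipVertical
      simp only [flipVertical_append, ← List.append_assoc] at ha hb ⊢
      rcases hm.flipVertical with hm | hm
      · exact .rel _ _ ⟨ha, hb, _, _, _, _, hm, rfl, rfl⟩
      · exact .symm _ _ (.rel _ _ ⟨hb, ha, _, _, _, _, hm, rfl, rfl⟩)
    | refl a => exact .refl _
    | symm _ _ _ ih => exact .symm _ _ ih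
    | trans _ _ _ _ _ ih ih' => exact .trans _ _ _ ih ih'
  exact key h

/-- The diagram turned by a half turn about a vertical axis, starting from `n` strands; a half turn
of space keeps the type of each crossing. -/
def flipHorizontal : ℕ → List Slice → List Slice
  | _, [] => []
  | n, (p, i) :: w => (p, n - p.inputs - i) :: flipHorizontal (n - p.inputs + p.outputs) w

theorem Runs.flipHorizontal {n m : ℕ} {w : List Slice} (h : Runs n w m) :
    Runs n (flipHorizontal n w) m := by
  induction h with
  | nil n => exact .nil n
  | cons p i k m w h ih =>
    rw [_root_.flipHorizontal, runs_cons]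
    rw [show i + p.inputs + k - p.inputs + p.outputs = i + p.outputs + k by omega]
    exact ⟨by omega, ih⟩

theorem flipHorizontal_append {n m : ℕ} {u : List Slice} (h : Runs n u m) (v : List Slice) :
    flipHorizontal n (u ++ v) = flipHorizontal n u ++ flipHorizontal m v := by
  induction h with
  | nil n => rfl
  | cons p i k m w h ih =>
    rw [List.cons_append, flipHorizontal, flipHorizontal, List.cons_append,
      show i + p.inputs + k - p.inputs + p.outputs = i + p.outputs + k by omega, ih]

theorem Move.flipHorizontal {a b : List Slice} (h : Move a b) {n m : ℕ} (hr : Runs n a m) :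
    Move (flipHorizontal n a) (flipHorizontal n b) ∨
      Move (flipHorizontal n b) (flipHorizontal n a) := by
  cases h with
  | far p q i k =>
    simp only [runs_cons, runs_nil] at hr
    obtain ⟨l, rfl⟩ : ∃ l, n = i + p.inputs + k + q.inputs + l :=
      Nat.exists_eq_add_of_le (by omega)
    right
    convert Move.far q p l k using 1 <;>
    simp only [_root_.flipHorizontal, List.cons.injEq, Prod.mk.injEq, true_and, and_true] <;> omega
  | zigzagRight i =>
    simp only [runs_cons, runs_nil, inputs, outputs] at hr
    left
    convert Move.zigzagLeft (n - i - 1) using 1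
    simp only [_root_.flipHorizontal, inputs, outputs, List.cons.injEq, Prod.mk.injEq,
      true_and, and_true]; omega
    rfl
  | zigzagLeft i =>
    simp only [runs_cons, runs_nil, inputs, outputs] at hr
    left
    convert Move.zigzagRight (n - i - 1) using 1
    simp only [_root_.flipHorizontal, inputs, outputs, List.cons.injEq, Prod.mk.injEq,
      true_and, and_true]; omega
    rfl
  | slideCup b i =>
    simp only [runs_cons, runs_nil, inputs, outputs] at hr
    right
    convert Move.slideCup (!b) (n - i - 1) using 1 <;>
    simp only [_root_.flipHorizontal, inputs, outputs, Bool.not_not, List.cons.injEq,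
      Prod.mk.injEq, true_and, and_true] <;> omega
  | slideCap b i =>
    simp only [runs_cons, runs_nil, inputs, outputs] at hr
    right
    convert Move.slideCap (!b) (n - i - 3) using 1 <;>
    simp only [_root_.flipHorizontal, inputs, outputs, Bool.not_not, List.cons.injEq,
      Prod.mk.injEq, true_and, and_true] <;> omega
  | reidemeisterOneCup b i =>
    left
    exact .reidemeisterOneCup b _
  | reidemeisterOneCap b i =>
    simp only [runs_cons, runs_nil, inputs, outputs] at hr
    left
    convert Move.reidemeisterOneCap b (n - 2 - i) using 1 <;>
    simp only [_root_.flipHorizontal, inputs, outputs, List.cons.injEq, Prod.mk.injEq,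
      true_and, and_true]; omega
  | reidemeisterTwo b i =>
    simp only [runs_cons, runs_nil, inputs, outputs] at hr
    left
    convert Move.reidemeisterTwo b (n - 2 - i) using 1
    simp only [_root_.flipHorizontal, inputs, outputs, List.cons.injEq, Prod.mk.injEq,
      true_and, and_true]; omega
    rfl
  | reidemeisterThree b i =>
    simp only [runs_cons, runs_nil, inputs, outputs] at hr
    right
    convert Move.reidemeisterThree b (n - 3 - i) using 1 <;>
    simp only [_root_.flipHorizontal, inputs, outputs, List.cons.injEq, Prod.mk.injEq,
      true_and, and_true] <;> omega

theorem IsTrivialKnot.flipHorizontal {w : List Slice} (h : IsTrivialKnot w) :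
    IsTrivialKnot (flipHorizontal 0 w) := by
  have key : ∀ {a b}, Relation.EqvGen DiagramStep a b →
      Relation.EqvGen DiagramStep (_root_.flipHorizontal 0 a) (_root_.flipHorizontal 0 b) := by
    intro a b h
    induction h with
    | rel a b h =>
      obtain ⟨ha, hb, u, c, d, v, hm, rfl, rfl⟩ := h
      have ha' := ha.flipHorizontal
      have hb' := hb.flipHorizontal
      simp only [IsLinkDiagram, runs_append, List.append_assoc] at ha
      obtain ⟨k, hu, l, hc, hv⟩ := ha
      have hd := hm.runs hc
      simp only [List.append_assoc, flipHorizontal_append hu, flipHorizontal_append hc,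
        flipHorizontal_append hd] at ha' hb' ⊢
      simp only [← List.append_assoc] at ha' hb' ⊢
      rcases hm.flipHorizontal hc with hm | hm
      · exact .rel _ _ ⟨ha', hb', _, _, _, _, hm, rfl, rfl⟩
      · exact .symm _ _ (.rel _ _ ⟨hb', ha', _, _, _, _, hm, rfl, rfl⟩)
    | refl a => exact .refl _
    | symm _ _ _ ih => exact .symm _ _ ih
    | trans _ _ _ _ _ ih ih' => exact .trans _ _ _ ih ih'
  exact key h

/-! ### Sliding a strand over a tangle -/

/-- The tangle `w` with `k` more strands to the left of it. -/
def shift (k : ℕ) (w : List Slice) : List Slice := w.map fun s => (s.1, s.2 + k)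

theorem shift_shift (k l : ℕ) (w : List Slice) : shift k (shift l w) = shift (l + k) w := by
  simp [shift, add_assoc]

theorem shift_append (k : ℕ) (u v : List Slice) : shift k (u ++ v) = shift k u ++ shift k v := by
  simp [shift]

theorem shift_twists (k : ℕ) (n : ℤ) (i : ℕ) : shift k (twists n i) = twists n (i + k) := by
  simp [shift, twists]

theorem Runs.shift {n m : ℕ} {w : List Slice} (h : Runs n w m) (k : ℕ) :
    Runs (n + k) (shift k w) (m + k) := by
  induction h with
  | nil n => exact .nil _
  | cons p i l m w h ih =>
    rw [_root_.shift, List.map_cons, runs_cons]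
    dsimp only
    refine ⟨by omega, ?_⟩
    rw [show i + p.inputs + l + k - p.inputs + p.outputs = i + p.outputs + l + k by omega]
    exact ih

/-- The strand number `i` passes to the right across `n` strands, in front of all of them or behind
all of them, according to `b`. -/
def passRight (b : Bool) (i : ℕ) : ℕ → List Slice
  | 0 => []
  | n + 1 => (cross b, i) :: passRight b (i + 1) n

theorem pass_add (b : Bool) (i n m : ℕ) :
    passRight b i (n + m) = passRight b i n ++ passRight b (i + n) m := by
  induction n generalizing i with
  | zero => simp [passRight]
  | succ n ih =>
    rw [Nat.succ_add, passRight, ih, passRight, List.cons_append, Nat.succ_add_eq_add_succ]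

theorem swap_pass_right (p : Piece) (i : ℕ) (b : Bool) (j n : ℕ) (h : i + p.outputs ≤ j)
    (v : List Slice) :
    (p, i) :: (passRight b j n ++ v) ⇝ passRight b (j + p.inputs - p.outputs) n ++ (p, i) :: v := by
  induction n generalizing j with
  | zero => rfl
  | succ n ih =>
    refine (swap_far p i (cross b) j i (j + p.inputs - p.outputs) (by omega) _).trans (.cons _ ?_)
    rw [show j + p.inputs - p.outputs + 1 = j + 1 + p.inputs - p.outputs by omega]
    exact ih (j + 1) (by omega)

theorem swap_pass_left (p : Piece) (i : ℕ) (b : Bool) (j n : ℕ) (h : j + n + 1 ≤ i)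
    (v : List Slice) :
    (p, i) :: (passRight b j n ++ v) ⇝ passRight b j n ++ (p, i) :: v := by
  induction n generalizing j with
  | zero => rfl
  | succ n ih =>
    refine (swap_far p i (cross b) j i j ?_ _).trans ((ih _ (by omega)).cons _)
    rw [inputs_cross, outputs_cross]
    omega

theorem swap_pass (b : Bool) (p : Piece) (i : ℕ) (v : List Slice) :
    (p, i + 1) :: (passRight b i p.outputs ++ v) ⇝ passRight b i p.inputs ++ (p, i) :: v := by
  cases p with
  | cup =>
    change (cup, i + 1) :: (cross b, i) :: (cross b, i + 1) :: v ⇝ (cup, i) :: v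
    grw [slide_cup_left b (i + 1) i, cancel']
  | cap =>
    change (cap, i + 1) :: v ⇝ (cross b, i) :: (cross b, i + 1) :: (cap, i) :: v
    have : [(cross b, i), (cross b, i + 1), (cap, i)] ⇝ [(cap, i + 1)] := by
      grw [slide_cap b (i + 1) i, cancel]
    refine (this.symm fun n m => ?_).append_right v
    simp only [runs_cons, runs_nil, inputs, outputs]
    omega
  | cross c =>
    change (cross c, i + 1) :: (cross b, i) :: (cross b, i + 1) :: v ⇝
      (cross b, i) :: (cross b, i + 1) :: (cross c, i) :: v
    obtain rfl | rfl : c = b ∨ c = !b := by cases b <;> cases c <;> simp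
    · exact braid' c (i + 1) i v
    · exact braid_mixed' b i (i + 1) v (.inl rfl)

/-- A strand can be moved over any tangle. -/
theorem shift_pass (b : Bool) {n m : ℕ} {w : List Slice} (h : Runs n w m) (v : List Slice) :
    shift 1 w ++ (passRight b 0 m ++ v) ⇝ passRight b 0 n ++ (w ++ v) := by
  induction h with
  | nil n => rfl
  | cons p i k m w h ih =>
    refine (ih.cons _).trans ?_
    rw [pass_add, pass_add, pass_add, pass_add]
    simp only [List.append_assoc, zero_add]
    grw [swap_pass_left p (i + 1) b 0 i (by omega), swap_pass b p i,
      swap_pass_right p i b (i + p.outputs) k le_rfl]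
    rw [show i + p.outputs + p.inputs - p.outputs = i + p.inputs by omega]
    rfl

/-- The closure of a tangle `w` with two ends at the bottom and two at the top by two arcs on its
left is isotopic to the closure by an arc on either side: the outer arc is moved over `w`. -/
theorem closure_left {w : List Slice} (h : Runs 2 w 2) :
    (cup, 0) :: (cup, 1) :: (shift 2 w ++ [(cap, 1), (cap, 0)]) ⇝
      (cup, 0) :: (cup, 2) :: (shift 1 w ++ [(cap, 0), (cap, 0)]) := by
  have h₁ : [(cap, 1), (cap, 0)] ⇝ passRight true 0 3 ++ [(cap, 0), (cap, 0)] := by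
    have : passRight true 0 3 ++ [(cap, 0), (cap, 0)] ⇝ [(cap, 1), (cap, 0)] := by
      change (cross true, 0) :: (cross true, 1) :: (cross true, 2) :: (cap, 0) :: [(cap, 0)] ⇝ _
      grw [swap_far (cross true) 2 cap 0 0 0 (by decide), slide_cap true 1 0, cancel, kink_cap]
    refine this.symm fun n m h => ?_
    change Runs n [(cross true, 0), (cross true, 1), (cross true, 2), (cap, 0), (cap, 0)] m
    simp only [runs_cons, runs_nil, inputs, outputs] at h ⊢
    omega
  have h₂ : (cup, 0) :: (cup, 1) :: (passRight true 0 3 ++ (shift 1 w ++ [(cap, 0), (cap, 0)])) ⇝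
      (cup, 0) :: (cup, 2) :: (shift 1 w ++ [(cap, 0), (cap, 0)]) := by
    change (cup, 0) :: (cup, 1) :: (cross true, 0) :: (cross true, 1) :: (cross true, 2) ::
      (shift 1 w ++ [(cap, 0), (cap, 0)]) ⇝ _
    grw [slide_cup_left true 1 0, cancel' true, swap_far cup 0 (cross true) 2 0 0 (by decide),
      cup_kink, swap_far cup 0 cup 0 2 0 (by decide)]
  grw [h₁]
  rw [← shift_shift 1 1]
  grw [shift_pass true (h.shift 1)]
  exact h₂

theorem twists_shift (n : ℤ) (w v : List Slice) :
    twists n 0 ++ (shift 2 w ++ v) ⇝ shift 2 w ++ (twists n 0 ++ v) := by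
  induction w with
  | nil => rfl
  | cons s w ih => exact (twists_swap n 0 s.1 (s.2 + 2) 0 (s.2 + 2) (by omega) _).trans (ih.cons _)

/-- In the closure of a tangle by an arc on either side, a row of crossings at the bottom can be
moved to the top: if both arcs are on the left, then the row travels along them. -/
theorem closure_twists {n : ℤ} {w : List Slice} (h : Runs 2 w 2)
    (ht : IsTrivialKnot ((cup, 0) :: (cup, 2) ::
      (twists n 1 ++ (shift 1 w ++ [(cap, 0), (cap, 0)])))) :
    IsTrivialKnot ((cup, 0) :: (cup, 2) ::
      (shift 1 w ++ (twists n 1 ++ [(cap, 0), (cap, 0)]))) := by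
  have h₁ : (cup, 0) :: (cup, 1) :: (twists n 2 ++ (shift 2 w ++ [(cap, 1), (cap, 0)])) ⇝
      (cup, 0) :: (cup, 2) :: (twists n 1 ++ (shift 1 w ++ [(cap, 0), (cap, 0)])) := by
    have := closure_left (w := twists n 0 ++ w) ((runs_twists (by omega)).2 h)
    rwa [shift_append, shift_append, shift_twists, shift_twists, List.append_assoc,
      List.append_assoc] at this
  have h₂ : (cup, 0) :: (cup, 1) :: (shift 2 w ++ (twists n 2 ++ [(cap, 1), (cap, 0)])) ⇝
      (cup, 0) :: (cup, 2) :: (shift 1 w ++ (twists n 1 ++ [(cap, 0), (cap, 0)])) := by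
    have := closure_left (w := w ++ twists n 0)
      (runs_append.2 ⟨2, h, by simpa using (runs_twists (w := []) (k := n) le_rfl).2 (.nil 2)⟩)
    rwa [shift_append, shift_append, shift_twists, shift_twists, List.append_assoc,
      List.append_assoc] at this
  have h₃ : (cup, 0) :: (cup, 1) :: (twists n 0 ++ (shift 2 w ++ [(cap, 1), (cap, 0)])) ⇝
      (cup, 0) :: (cup, 1) :: (twists n 2 ++ (shift 2 w ++ [(cap, 1), (cap, 0)])) :=
    nested_cups_twists n 0 _
  have h₄ : (cup, 0) :: (cup, 1) :: (twists n 0 ++ (shift 2 w ++ [(cap, 1), (cap, 0)])) ⇝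
      (cup, 0) :: (cup, 1) :: (shift 2 w ++ (twists n 2 ++ [(cap, 1), (cap, 0)])) := by
    grw [twists_shift, nested_caps_twists n 0]
  have hl : IsLinkDiagram
      ((cup, 0) :: (cup, 1) :: (twists n 0 ++ (shift 2 w ++ [(cap, 1), (cap, 0)]))) := by
    rw [IsLinkDiagram, runs_cons, runs_cons, runs_twists (by decide), runs_append]
    refine ⟨by decide, by decide, 4, h.shift 2, ?_⟩
    simp [runs_cons, runs_nil, inputs, outputs]
  exact ((h₄.trans h₂).isTrivialKnot' hl) ((h₃.trans h₁).isTrivialKnot hl ht)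

/-! ### Symmetries of the filled hexatangle -/

theorem isLinkDiagram_hexatangle (f : Filling) : IsLinkDiagram (hexatangle f) := by
  simp only [IsLinkDiagram, hexatangle, List.append_assoc, List.cons_append, List.nil_append,
    runs_cons, inputs, outputs]
  simp [runs_twists, runs_cons, runs_nil, inputs, outputs]

/-- The filled hexatangle, drawn with the band `1` below the band `2`; both are between the bands
`0` and `3`. -/
def stacked (f : Filling) : List Slice :=
  (cup, 0) :: (cup, 2) :: (cup, 2) :: (twists f.α 1 ++ (twists f.γ 3 ++ (cup, 4) ::
    (twists f.β 3 ++ (cap, 2) :: (twists f.δ 1 ++ (twists f.ε 3 ++ (cap, 2) ::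
      (twists f.η 1 ++ [(cap, 0), (cap, 0)]))))))

theorem isLinkDiagram_stacked (f : Filling) : IsLinkDiagram (stacked f) := by
  simp only [IsLinkDiagram, stacked, runs_cons, inputs, outputs]
  simp [runs_twists, runs_cons, runs_nil, inputs, outputs]

theorem hexatangle_reduces (f : Filling) : hexatangle f ⇝ stacked f := by
  simp only [hexatangle, List.append_assoc, List.cons_append, List.nil_append, stacked]
  grw [swap_far cup 2 cup 4 2 2 (by decide), swap_twists cup 4 f.α 1 4 1 (by decide),
    twists_comm f.γ 3 f.α 1 (by decide), twists_swap f.ε 5 cap 2 3 2 (by decide),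
    twists_comm f.ε 3 f.δ 1 (by decide)]

theorem isTrivialKnot_hexatangle_iff (f : Filling) :
    IsTrivialKnot (hexatangle f) ↔ IsTrivialKnot (stacked f) :=
  ⟨(hexatangle_reduces f).isTrivialKnot' (isLinkDiagram_hexatangle f),
    (hexatangle_reduces f).isTrivialKnot (isLinkDiagram_hexatangle f)⟩

/-- The diagram `stacked f` turned upside down. -/
theorem flipVertical_stacked (f : Filling) : flipVertical (stacked f) =
    (cup, 0) :: (cup, 0) :: (twists f.η 1 ++ (cup, 2) :: (twists f.ε 3 ++ (twists f.δ 1 ++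
      (cup, 2) :: (twists f.β 3 ++ (cap, 4) :: (twists f.γ 3 ++ (twists f.α 1 ++
        [(cap, 2), (cap, 2), (cap, 0)])))))) := by
  have h (s : Slice) (w : List Slice) :
      flipVertical (s :: w) = flipVertical w ++ [(s.1.flip, s.2)] :=
    flipVertical_append [s] w
  simp only [stacked, h, flipVertical_append, flipVertical_twists, Piece.flip]
  simp [flipVertical]

/-- The diagram `stacked f` turned by a half turn about a vertical axis. -/
theorem flipHorizontal_stacked (f : Filling) : flipHorizontal 0 (stacked f) =
    (cup, 0) :: (cup, 0) :: (cup, 2) :: (twists f.α 3 ++ (twists f.γ 1 ++ (cup, 2) ::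
    (twists f.β 3 ++ (cap, 4) :: (twists f.δ 3 ++ (twists f.ε 1 ++ (cap, 2) ::
      (twists f.η 1 ++ [(cap, 2), (cap, 0)])))))) := by
  have h (n i m : ℕ) (k : ℤ) (w : List Slice) (hn : i + 2 + m = n) :
      flipHorizontal n (twists k i ++ w) = twists k m ++ flipHorizontal n w := by
    subst hn
    unfold twists
    induction k.natAbs with
    | zero => rfl
    | succ l ih =>
      rw [List.replicate_succ, List.cons_append, flipHorizontal, inputs_cross, outputs_cross,
        Nat.sub_add_cancel (by omega), ih, show i + 2 + m - 2 - i = m by omega]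
      rfl
  simp only [stacked, flipHorizontal, inputs, outputs, Nat.reduceAdd, Nat.reduceSub]
  rw [h 6 1 3 _ _ rfl, h 6 3 1 _ _ rfl]
  simp only [flipHorizontal, inputs, outputs, Nat.reduceAdd, Nat.reduceSub]
  rw [h 8 3 3 _ _ rfl]
  simp only [flipHorizontal, inputs, outputs, Nat.reduceAdd, Nat.reduceSub]
  rw [h 6 1 3 _ _ rfl, h 6 3 1 _ _ rfl]
  simp only [flipHorizontal, inputs, outputs, Nat.reduceAdd, Nat.reduceSub]
  rw [h 4 1 1 _ _ rfl]
  simp only [flipHorizontal, inputs, outputs, Nat.reduceAdd, Nat.reduceSub]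

theorem IsLinkDiagram.flipVertical {w : List Slice} (h : IsLinkDiagram w) :
    IsLinkDiagram (flipVertical w) := Runs.flipVertical h

theorem IsLinkDiagram.flipHorizontal {w : List Slice} (h : IsLinkDiagram w) :
    IsLinkDiagram (flipHorizontal 0 w) := Runs.flipHorizontal h

/-- The transposition of the vertices `0` and `3` is induced by a half turn about a vertical
axis. -/
theorem stacked_swap_zero_three {α β γ δ ε η : ℤ} (h : IsTrivialKnot (stacked ⟨α, β, γ, δ, ε, η⟩)) :
    IsTrivialKnot (stacked ⟨γ, β, α, ε, δ, η⟩) := by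
  refine Reduces.isTrivialKnot' ?_ (isLinkDiagram_stacked _).flipHorizontal h.flipHorizontal
  rw [flipHorizontal_stacked, stacked]
  dsimp only
  grw [swap_far cup 0 cup 0 2 0 (by decide), rotate_twists β 2,
    swap_far cap 2 cap 0 0 0 (by decide), twists_comm α 3 γ 1 (by decide),
    twists_comm δ 3 ε 1 (by decide)]

/-- The transposition of the vertices `0` and `1` is induced by a half turn about the horizontal
axis, after which the end of the band `0` is brought below the start of the band `1`. -/
theorem stacked_swap_zero_one {α β γ δ ε η : ℤ} (h : IsTrivialKnot (stacked ⟨α, β, γ, δ, ε, η⟩)) :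
    IsTrivialKnot (stacked ⟨α, δ, η, β, ε, γ⟩) := by
  refine Reduces.isTrivialKnot ?_ (isLinkDiagram_stacked _) h.flipVertical
  rw [flipVertical_stacked, stacked]
  dsimp only
  -- the start of the leftmost band is moved up to the crossings on the edge `01`
  grw [swap_far cup 0 cup 2 0 0 (by decide), swap_far cup 0 cup 2 0 0 (by decide),
    twists_comm α 1 η 3 (by decide), twists_swap α 1 cup 4 1 4 (by decide),
    twists_comm α 1 δ 3 (by decide), swap_twists cup 0 η 3 0 1 (by decide),
    swap_far cup 0 cup 4 0 2 (by decide), swap_twists cup 0 δ 3 0 1 (by decide), rotate_twists α 0,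
    twists_comm β 1 ε 3 (by decide), swap_twists cap 0 ε 3 0 5 (by decide),
    twists_comm α 1 ε 5 (by decide), swap_twists cup 2 ε 5 2 3 (by decide),
    twists_comm δ 1 ε 3 (by decide)]
  -- the end of the leftmost band is moved up to the top
  grw [swap_twists cap 0 β 1 0 3 (by decide), swap_far cap 0 cap 2 0 4 (by decide),
    swap_twists cap 0 γ 1 0 3 (by decide), twists_comm α 1 β 3 (by decide),
    twists_swap α 1 cap 4 1 4 (by decide), twists_comm α 1 γ 3 (by decide),
    swap_far cap 0 cap 0 0 2 (by decide), swap_far cap 0 cap 0 0 2 (by decide)]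

/-- The transposition of the vertices `1` and `2` is induced by a half turn about the horizontal
axis, after which the crossings on the edge `03` are moved from the bottom to the top. -/
theorem stacked_swap_one_two {α β γ δ ε η : ℤ} (h : IsTrivialKnot (stacked ⟨α, β, γ, δ, ε, η⟩)) :
    IsTrivialKnot (stacked ⟨δ, β, ε, α, γ, η⟩) := by
  set w : List Slice := (cup, 1) :: (twists ε 2 ++ (twists δ 0 ++ (cup, 1) :: (twists β 2 ++
    (cap, 3) :: (twists γ 2 ++ (twists α 0 ++ [(cap, 1)]))))) with hw
  have hs : shift 1 w = (cup, 2) :: (twists ε 3 ++ (twists δ 1 ++ (cup, 2) :: (twists β 3 ++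
      (cap, 4) :: (twists γ 3 ++ (twists α 1 ++ [(cap, 2)]))))) := by
    have h (s : Slice) (u : List Slice) : shift 1 (s :: u) = (s.1, s.2 + 1) :: shift 1 u := rfl
    simp only [hw, h, shift_append, shift_twists]
    rfl
  have hr : Runs 2 w 2 := by
    simp only [hw, runs_cons, inputs, outputs]
    simp [runs_twists, runs_cons, runs_nil, inputs, outputs]
  have h₁ : flipVertical (stacked ⟨α, β, γ, δ, ε, η⟩) ⇝
      (cup, 0) :: (cup, 2) :: (twists η 1 ++ (shift 1 w ++ [(cap, 0), (cap, 0)])) := by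
    rw [flipVertical_stacked, hs]
    simp only [List.cons_append, List.append_assoc, List.nil_append]
    grw [swap_far cup 0 cup 0 2 0 (by decide), swap_far cap 2 cap 0 0 0 (by decide)]
  have h₂ : (cup, 0) :: (cup, 2) :: (shift 1 w ++ (twists η 1 ++ [(cap, 0), (cap, 0)])) ⇝
      stacked ⟨δ, β, ε, α, γ, η⟩ := by
    rw [stacked, hs]
    simp only [List.cons_append, List.append_assoc, List.nil_append]
    grw [twists_comm ε 3 δ 1 (by decide), rotate_twists β 2, twists_comm γ 3 α 1 (by decide)]
  refine h₂.isTrivialKnot' ?_ (closure_twists hr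
    (h₁.isTrivialKnot' (isLinkDiagram_stacked _).flipVertical h.flipVertical))
  rw [hs]
  simp only [IsLinkDiagram, runs_cons, inputs, outputs, List.cons_append]
  simp [runs_twists, runs_cons, runs_nil, inputs, outputs]

/-- The filling `f` with the vertices of the tetrahedron renamed by `s`. -/
def Filling.permute (f : Filling) (s : Equiv.Perm (Fin 4)) : Filling where
  α := f.edge (s 0) (s 1)
  β := f.edge (s 1) (s 2)
  γ := f.edge (s 1) (s 3)
  δ := f.edge (s 0) (s 2)
  ε := f.edge (s 2) (s 3)
  η := f.edge (s 0) (s 3)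

theorem Filling.edge_comm (f : Filling) (i j : Fin 4) : f.edge i j = f.edge j i := by
  fin_cases i <;> fin_cases j <;> rfl

theorem Filling.edge_self (f : Filling) (i : Fin 4) : f.edge i i = 0 := by
  fin_cases i <;> rfl

theorem Filling.edge_permute (f : Filling) (s : Equiv.Perm (Fin 4)) (i j : Fin 4) :
    (f.permute s).edge i j = f.edge (s i) (s j) := by
  fin_cases i <;> fin_cases j <;>
    first | rfl | exact f.edge_comm _ _ | exact (f.edge_self _).symm

theorem Filling.ext_edge {f g : Filling} (h : ∀ i j, f.edge i j = g.edge i j) : f = g :=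
  Filling.ext (h 0 1) (h 1 2) (h 1 3) (h 0 2) (h 2 3) (h 0 3)

theorem Filling.permute_mul (f : Filling) (s t : Equiv.Perm (Fin 4)) :
    f.permute (s * t) = (f.permute s).permute t :=
  ext_edge fun i j => by simp only [edge_permute, Equiv.Perm.mul_apply]

theorem Filling.isSymmetricTo_permute (f : Filling) (s : Equiv.Perm (Fin 4)) :
    f.IsSymmetricTo (f.permute s) :=
  ⟨s⁻¹, fun i j => by simp [edge_permute]⟩

/-- The symmetries of the tetrahedron do not change whether the filled hexatangle is trivial. -/
theorem isTrivialKnot_permute {f : Filling} (h : IsTrivialKnot (hexatangle f))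
    (s : Equiv.Perm (Fin 4)) : IsTrivialKnot (hexatangle (f.permute s)) := by
  let S : Submonoid (Equiv.Perm (Fin 4)) :=
    { carrier := {s | ∀ f : Filling, IsTrivialKnot (hexatangle f) →
        IsTrivialKnot (hexatangle (f.permute s))}
      one_mem' := fun f h => h
      mul_mem' := fun {s t} hs ht f h => by
        rw [Filling.permute_mul]
        exact ht _ (hs _ h) }
  have h₀₁ : Equiv.swap 0 1 ∈ S := fun f h => by
    rw [isTrivialKnot_hexatangle_iff] at h ⊢
    exact stacked_swap_zero_one h
  have h₁₂ : Equiv.swap 1 2 ∈ S := fun f h => by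
    rw [isTrivialKnot_hexatangle_iff] at h ⊢
    exact stacked_swap_one_two h
  have h₀₃ : Equiv.swap 0 3 ∈ S := fun f h => by
    rw [isTrivialKnot_hexatangle_iff] at h ⊢
    exact stacked_swap_zero_three h
  have h₀₂ : Equiv.swap 0 2 ∈ S := by
    rw [show (Equiv.swap 0 2 : Equiv.Perm (Fin 4)) =
      Equiv.swap 0 1 * Equiv.swap 1 2 * Equiv.swap 0 1 by decide]
    exact mul_mem (mul_mem h₀₁ h₁₂) h₀₁
  have h₂₃ : Equiv.swap 2 3 ∈ S := by
    rw [show (Equiv.swap 2 3 : Equiv.Perm (Fin 4)) =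
      Equiv.swap 0 2 * Equiv.swap 0 3 * Equiv.swap 0 2 by decide]
    exact mul_mem (mul_mem h₀₂ h₀₃) h₀₂
  have : S = ⊤ := by
    rw [eq_top_iff, ← Equiv.Perm.mclosure_swap_castSucc_succ, Submonoid.closure_le]
    rintro _ ⟨i, rfl⟩
    fin_cases i
    exacts [h₀₁, h₁₂, h₂₃]
  exact (this ▸ Submonoid.mem_top s : s ∈ S) f h

/-! ### Trivial fillings -/

/-- A vertex whose only edges have the parameters `1` and `-1` can be removed; its two neighbours
are then merged into one vertex. -/
theorem contract (b : Bool) (v : List Slice) :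
    (cup, 2) :: (cross b, 1) :: (cross !b, 3) :: (cap, 2) :: v ⇝ (cap, 1) :: (cup, 1) :: v := by
  grw [swap_far (cross b) 1 (cross !b) 3 1 3 (by simp [inputs, outputs]), slide_cup (!b) 2 3,
    Bool.not_not, slide_cap_right b 1 2, cancel, swap_far cup 3 cap 1 1 1 (by decide)]

/-- A vertex that is joined to only one other vertex, by an edge with the parameter `±1`, can be
removed. -/
theorem edge_contract (n : ℤ) (hn : n = 1 ∨ n = -1) (v : List Slice) :
    (cup, 2) :: (twists n 1 ++ (cap, 2) :: v) ⇝ v := by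
  have (b : Bool) : (cup, 2) :: (cross b, 1) :: (cap, 2) :: v ⇝ v := by
    grw [slide_cap_right b 1 2, cup_kink, zigzag_left 2 1]
  rcases hn with rfl | rfl
  exacts [this true, this false]

theorem edge_contract_right (n : ℤ) (hn : n = 1 ∨ n = -1) (v : List Slice) :
    (cup, 2) :: (twists n 3 ++ (cap, 2) :: v) ⇝ v := by
  have (b : Bool) : (cup, 2) :: (cross b, 3) :: (cap, 2) :: v ⇝ v := by
    grw [slide_cup b 2 3, kink_cap, zigzag_left 3 2]
  rcases hn with rfl | rfl
  exacts [this true, this false]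

/-- The square tangle of a vertex that is joined to its neighbours by edges with the parameters `1`
and `-2` equals a row of two crossings between the neighbours. -/
theorem series_one_neg_two (v : List Slice) :
    (cup, 2) :: (cross true, 1) :: (cross false, 3) :: (cross false, 3) :: (cap, 2) :: v ⇝
      (cross true, 1) :: (cross true, 1) :: v := by
  have h (v : List Slice) : (cross true, 2) :: (cross false, 3) :: (cross false, 2) :: v ⇝
      (cross false, 3) :: (cross false, 2) :: (cross true, 3) :: v := braid_mixed' false 3 2 v
  grw [swap_far (cross true) 1 (cross false) 3 1 3 (by decide), slide_cup false 2 3,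
    swap_far (cross true) 1 (cross false) 3 1 3 (by decide), slide_cap_right true 1 2]
  simp only [Bool.not_true, Bool.not_false]
  grw [h, cup_kink, slide_cup_left false 3 2]
  simp only [Bool.not_false]
  grw [swap_far (cross true) 3 cap 1 1 1 (by decide), swap_far (cross true) 3 cap 1 1 1 (by decide),
    zigzag_left 2 1]

/-- The star-triangle transformation: a vertex joined to its three neighbours by edges with the
parameters `1`, `-1` and `±1` is replaced by a triangle; the edge opposite to a neighbour gets minus
the parameter of the edge to that neighbour. -/
theorem star_triangle (b : Bool) (v : List Slice) :
    (cup, 2) :: (cross true, 1) :: (cross false, 3) :: (cup, 4) :: (cross b, 3) :: (cap, 2) :: v ⇝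
      (cross !b, 1) :: (cup, 2) :: (cross false, 3) :: (cross true, 1) :: v := by
  grw [slide_cup_left b 4 3, swap_far (cross !b) 4 cap 2 2 2 (by simp [inputs, outputs]),
    zigzag_left 3 2, swap_far (cross true) 1 (cross false) 3 1 3 (by decide), slide_cup false 2 3]
  simp only [Bool.not_false]
  have h (v : List Slice) : (cross true, 2) :: (cross true, 1) :: (cross !b, 2) :: v ⇝
      (cross !b, 1) :: (cross true, 2) :: (cross true, 1) :: v := by
    cases b
    · exact braid' true 2 1 v
    · exact braid_mixed true 2 1 v
  grw [h, swap_far cup 3 (cross !b) 1 3 1 (by simp [inputs, outputs]), slide_cup_left true 3 2]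
  rfl

theorem isTrivialKnot_of_reduces {f : Filling} (h : stacked f ⇝ [(cup, 0), (cap, 0)]) :
    IsTrivialKnot (hexatangle f) := by
  rw [isTrivialKnot_hexatangle_iff]
  exact h.isTrivialKnot (isLinkDiagram_stacked f) (.refl _)

/-- Fillings for which the edges with a nonzero parameter form a tree: the leaves `1` and `2` are
removed, and one crossing remains. -/
theorem isTrivialKnot_tree {α δ ε η : ℤ} (hα : α = 1 ∨ α = -1)
    (h : (δ = 1 ∨ δ = -1) ∧ ε = 0 ∨ (ε = 1 ∨ ε = -1) ∧ δ = 0) (hη : η = 1 ∨ η = -1) :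
    IsTrivialKnot (hexatangle ⟨α, 0, 0, δ, ε, η⟩) := by
  apply isTrivialKnot_of_reduces
  have h' (v : List Slice) : (cup, 2) :: (twists δ 1 ++ (twists ε 3 ++ (cap, 2) :: v)) ⇝ v := by
    rcases h with ⟨h, rfl⟩ | ⟨h, rfl⟩
    exacts [edge_contract δ h v, edge_contract_right ε h v]
  have h'' (b : Bool) : [(cup, 0), (cup, 2), (cross b, 1), (cap, 0), (cap, 0)] ⇝
      [(cup, 0), (cap, 0)] := by
    grw [slide_cap b 1 0, swap_far cup 2 (cross !b) 0 2 0 (by simp [inputs, outputs]), cup_kink,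
      zigzag_left 2 1]
  simp only [stacked, twists_zero, List.nil_append]
  grw [swap_far cup 4 cap 2 2 2 (by decide), edge_contract α hα, h']
  rcases hη with rfl | rfl
  exacts [h'' true, h'' false]

/-- The vertex `1` is joined to the vertices `0` and `3` by edges with opposite parameters, so that
it can be removed and `0` and `3` merged.  This turns the edge `03` into a loop and makes the edges
`02` and `23` parallel, so that their parameters add up. -/
theorem isTrivialKnot_contract {α γ δ ε : ℤ} (hα : α = 1 ∧ γ = -1 ∨ α = -1 ∧ γ = 1)
    (h : δ + ε = 1 ∨ δ + ε = -1) (η : ℤ) :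
    IsTrivialKnot (hexatangle ⟨α, 0, γ, δ, ε, η⟩) := by
  apply isTrivialKnot_of_reduces
  have h' (v : List Slice) : (cup, 2) :: (twists α 1 ++ (twists γ 3 ++ (cap, 2) :: v)) ⇝
      (cap, 1) :: (cup, 1) :: v := by
    rcases hα with ⟨rfl, rfl⟩ | ⟨rfl, rfl⟩
    exacts [contract true v, contract false v]
  simp only [stacked, twists_zero, List.nil_append]
  grw [swap_far cup 4 cap 2 2 2 (by decide), h', zigzag_left 2 1, nested_cups_twists δ 1,
    twists_add, edge_contract_right _ h, cup_kink_twists, zigzag_left 1 0]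

/-- The vertex `2` in series between the edges with the parameters `1` and `-2` is replaced by an
edge `03` with the parameter `2`; then the vertex `3` can be removed. -/
theorem isTrivialKnot_series (α : ℤ) : IsTrivialKnot (hexatangle ⟨α, 0, -1, 1, -2, -1⟩) := by
  apply isTrivialKnot_of_reduces
  have h₁ (v : List Slice) : (cross true, 1) :: (cross false, 1) :: v ⇝ v := cancel true 1 v
  have h₂ (v : List Slice) : (cross true, 4) :: (cross false, 4) :: v ⇝ v := cancel true 4 v
  change (cup, 0) :: (cup, 2) :: (cup, 2) :: (twists α 1 ++ (cross false, 3) :: (cup, 4) ::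
    (cap, 2) :: (cross true, 1) :: (cross false, 3) :: (cross false, 3) :: (cap, 2) ::
      (cross false, 1) :: (cap, 0) :: [(cap, 0)]) ⇝ _
  grw [swap_far cup 4 cap 2 2 2 (by decide), series_one_neg_two, h₁,
    swap_far cap 0 cap 0 0 2 (by decide), slide_cap_right true 1 2, Bool.not_true,
    swap_far cap 2 (cross false) 2 2 4 (by decide),
    swap_far cup 2 cup 2 4 2 (by decide), swap_twists cup 4 α 1 4 1 (by decide),
    slide_cup_left false 4 3, Bool.not_false, h₂,
    zigzag_left 3 2, twists_kink_cap, zigzag_left 2 1]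

/-- The star-triangle transformation at the vertex `1` changes the parameters of `02` and `23` to
`-1` and `1`; then the vertex `2` can be removed, and only loops remain. -/
theorem isTrivialKnot_star {β : ℤ} (hβ : β = 1 ∨ β = -1) (η : ℤ) :
    IsTrivialKnot (hexatangle ⟨1, β, -1, -2, 2, η⟩) := by
  apply isTrivialKnot_of_reduces
  have h₁ (v : List Slice) : (cross true, 1) :: (cross false, 1) :: v ⇝ v := cancel true 1 v
  have h₂ (v : List Slice) : (cross false, 3) :: (cross true, 3) :: v ⇝ v := cancel false 3 v
  have h₃ (v : List Slice) : (cup, 2) :: (cross false, 1) :: (cross true, 3) :: (cap, 2) :: v ⇝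
      (cap, 1) :: (cup, 1) :: v := contract false v
  have key (b : Bool) : (cup, 0) :: (cup, 2) :: (cup, 2) :: (cross true, 1) :: (cross false, 3) ::
      (cup, 4) :: (cross b, 3) :: (cap, 2) :: (cross false, 1) :: (cross false, 1) ::
      (cross true, 3) :: (cross true, 3) :: (cap, 2) :: (twists η 1 ++ [(cap, 0), (cap, 0)]) ⇝
      [(cup, 0), (cap, 0)] := by
    grw [star_triangle, h₁, swap_far (cross false) 3 (cross false) 1 3 1 (by decide), h₂, h₃,
      kink_cap, zigzag_left 2 1, cup_kink_twists, zigzag_left 1 0]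
  rcases hβ with rfl | rfl
  exacts [key true, key false]

/-! ### Colorings of link diagrams by the elements of a group -/

/-- The row of colors `s` with two strands of color `a` inserted at the place `i`. -/
def insertPair {G : Type*} (i : ℕ) (a : G) (s : ℕ → G) : ℕ → G :=
  fun j => if j < i then s j else if j < i + 2 then a else s (j - 2)

theorem insertPair_comm {G : Type*} {i j : ℕ} (h : i ≤ j) (a c : G) (s : ℕ → G) :
    insertPair (j + 2) c (insertPair i a s) = insertPair i a (insertPair j c s) := by
  ext k
  simp only [insertPair]
  grind

theorem exists_of_insertPair_eq {G : Type*} {i j : ℕ} (h : i ≤ j) {a c : G} {s t : ℕ → G}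
    (hst : insertPair i a s = insertPair (j + 2) c t) :
    ∃ m, s = insertPair j c m ∧ t = insertPair i a m := by
  refine ⟨fun k => if k < j then s k else s (k + 2), ?_, ?_⟩ <;> ext k
  · have := congrFun hst (k + 2)
    simp only [insertPair] at this ⊢
    grind
  · have h₁ := congrFun hst (k + 2)
    have h₂ := congrFun hst k
    have h₃ := congrFun hst (k + 4)
    simp only [insertPair] at h₁ h₂ h₃ ⊢
    grind

theorem eq_of_insertPair_eq {G : Type*} {i : ℕ} {a c : G} {s t : ℕ → G}
    (h : insertPair i a s = insertPair (i + 1) c t) : s = t ∧ a = s i ∧ c = t i := by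
  have h₀ := congrFun h i
  have h₁ := congrFun h (i + 1)
  have h₂ := congrFun h (i + 2)
  simp [insertPair] at h₀ h₁ h₂
  refine ⟨?_, by grind, by grind⟩
  ext k
  rcases lt_trichotomy k i with hk | rfl | hk
  · have := congrFun h k
    simp only [insertPair] at this
    grind
  · grind
  · have := congrFun h (k + 2)
    simp only [insertPair] at this
    grind

theorem insertPair_succ {G : Type*} (i : ℕ) (s : ℕ → G) :
    insertPair (i + 1) (s i) s = insertPair i (s i) s := by
  ext k
  simp only [insertPair]
  rcases eq_or_ne k (i + 2) with rfl | h
  · simp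
  · grind

/-- The set of all `c` such that the first `n` colors in the row `s` are `c`. -/
def constColors {G : Type*} (n : ℕ) (s : ℕ → G) : Set G := {c | ∀ j < n, s j = c}

theorem constColors_insertPair {G : Type*} {i n : ℕ} (h : i ≤ n) (a : G) (s : ℕ → G) :
    constColors (n + 2) (insertPair i a s) = {a} ∩ constColors n s := by
  ext c
  simp only [constColors, insertPair, Set.mem_ofPred_eq, Set.mem_inter_iff, Set.mem_singleton_iff]
  constructor
  · intro hc
    refine ⟨?_, fun j hj => ?_⟩
    · have := hc i (by omega)
      grind
    · have h₁ := hc j (by omega)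
      have h₂ := hc (j + 2) (by omega)
      grind
  · rintro ⟨rfl, hc⟩ j hj
    have h₁ := hc j
    have h₂ := hc (j - 2)
    grind

section Colorings

variable {G : Type*} [Group G]

/-- The row of colors above a crossing, if the row of colors below it is `s`. -/
def crossColors (b : Bool) (i : ℕ) (s : ℕ → G) : ℕ → G := fun j =>
  if j = i then cond b (s (i + 1)) (s i * (s (i + 1))⁻¹ * s i)
  else if j = i + 1 then cond b (s (i + 1) * (s i)⁻¹ * s (i + 1)) (s i)
  else s j

theorem crossColors_comm (b c : Bool) {i j : ℕ} (h : i + 2 ≤ j) (s : ℕ → G) :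
    crossColors c j (crossColors b i s) = crossColors b i (crossColors c j s) := by
  ext k
  simp only [crossColors]
  grind

theorem crossColors_insertPair_right (b : Bool) {i j : ℕ} (h : i ≤ j) (a : G) (s : ℕ → G) :
    crossColors b (j + 2) (insertPair i a s) = insertPair i a (crossColors b j s) := by
  ext k
  simp only [crossColors, insertPair]
  grind

theorem crossColors_insertPair_left (b : Bool) {i j : ℕ} (h : i + 2 ≤ j) (a : G) (s : ℕ → G) :
    crossColors b i (insertPair j a s) = insertPair j a (crossColors b i s) := by
  ext k
  simp only [crossColors, insertPair]
  grind

theorem crossColors_insertPair (b : Bool) (i : ℕ) (a : G) (s : ℕ → G) :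
    crossColors b i (insertPair i a s) = insertPair i a s := by
  ext k
  simp only [crossColors, insertPair]
  cases b <;> simp <;> grind

theorem crossColors_not (b : Bool) (i : ℕ) (s : ℕ → G) :
    crossColors (!b) i (crossColors b i s) = s := by
  ext k
  simp only [crossColors]
  cases b <;> simp <;> grind

theorem eq_crossColors_iff {b : Bool} {i : ℕ} {s t : ℕ → G} :
    t = crossColors b i s ↔ s = crossColors (!b) i t := by
  constructor <;> rintro rfl
  · rw [crossColors_not]
  · simpa using (crossColors_not (!b) i t).symm

theorem crossColors_braid (b : Bool) (i : ℕ) (s : ℕ → G) :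
    crossColors b i (crossColors b (i + 1) (crossColors b i s)) =
      crossColors b (i + 1) (crossColors b i (crossColors b (i + 1) s)) := by
  ext k
  simp only [crossColors]
  cases b <;> simp <;> split_ifs <;> (try omega) <;> group

theorem crossColors_insertPair_succ (b : Bool) (i : ℕ) (a : G) (s : ℕ → G) :
    crossColors b (i + 1) (insertPair i a s) =
      crossColors (!b) i (insertPair (i + 1)
        (cond b (s i * a⁻¹ * s i) a) s) := by
  ext k
  simp only [crossColors, insertPair]
  cases b <;> simp <;> split_ifs <;> (try omega) <;> group

/-- The rows of colors below and above a piece at the place `i` which can occur in a coloring.  A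
strand keeps its color except where it passes under a strand of color `a`: there, its color `c`
changes to `a * c⁻¹ * a`.  The colorings are those of the mirror image of the diagram: in
`cross true`, the strand that runs from bottom left to top right changes its color. -/
def Piece.Admits : Piece → ℕ → (ℕ → G) → (ℕ → G) → Prop
  | cup, i, s, t => ∃ a, t = insertPair i a s
  | cap, i, s, t => ∃ a, s = insertPair i a t
  | cross b, i, s, t => t = crossColors b i s

/-- `Colored n w s t C`: the diagram `w` on `n` strands has a coloring with the colors `s` at the
bottom and `t` at the top, and `C` is the set of all `c` such that all colors in it are `c`.  The
rows of colors are infinite, but only as many of their entries matter as there are strands. -/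
def Colored : ℕ → List Slice → (ℕ → G) → (ℕ → G) → Set G → Prop
  | n, [], s, t, C => s = t ∧ C = constColors n s
  | n, (p, i) :: w, s, t, C => ∃ m C', p.Admits i s m ∧
      Colored (n - p.inputs + p.outputs) w m t C' ∧ C = constColors n s ∩ C'

theorem constColors_crossColors {i n : ℕ} (h : i + 2 ≤ n) (b : Bool) (s : ℕ → G) :
    constColors n (crossColors b i s) = constColors n s := by
  have key (b : Bool) (s : ℕ → G) : constColors n s ⊆ constColors n (crossColors b i s) := by
    intro c hc j hj
    simp only [crossColors]
    have h₁ := hc i (by omega)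
    have h₂ := hc (i + 1) (by omega)
    have h₃ := hc j hj
    rw [h₁, h₂, h₃]
    cases b <;> simp
  refine (key b s).antisymm' ?_
  simpa [crossColors_not] using key (!b) (crossColors b i s)

theorem colored_append {n k : ℕ} {u : List Slice} (h : Runs n u k) (v : List Slice)
    {s t : ℕ → G} {C : Set G} :
    Colored n (u ++ v) s t C ↔
      ∃ m C₁ C₂, Colored n u s m C₁ ∧ Colored k v m t C₂ ∧ C = C₁ ∩ C₂ := by
  induction h generalizing s C with
  | nil n =>
    constructor
    · intro h
      refine ⟨s, _, C, ⟨rfl, rfl⟩, h, (Set.inter_eq_right.2 ?_).symm⟩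
      cases v with
      | nil => exact h.2.le
      | cons _ _ =>
        obtain ⟨_, _, _, _, rfl⟩ := h
        exact Set.inter_subset_left
    · rintro ⟨m, _, C', ⟨rfl, rfl⟩, h, rfl⟩
      rwa [Set.inter_eq_right.2]
      cases v with
      | nil => exact h.2.le
      | cons _ _ =>
        obtain ⟨_, _, _, _, rfl⟩ := h
        exact Set.inter_subset_left
  | cons p i l k w h ih =>
    simp only [List.cons_append, Colored,
      show i + p.inputs + l - p.inputs + p.outputs = i + p.outputs + l by omega, ih]
    constructor
    · rintro ⟨m, _, hp, ⟨m', C₁, C₂, h₁, h₂, rfl⟩, rfl⟩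
      exact ⟨m', _, C₂, ⟨m, C₁, hp, h₁, rfl⟩, h₂, (Set.inter_assoc ..).symm⟩
    · rintro ⟨m', _, C₂, ⟨m, C₁, hp, h₁, rfl⟩, h₂, rfl⟩
      exact ⟨m, _, hp, ⟨m', C₁, C₂, h₁, h₂, rfl⟩, Set.inter_assoc ..⟩

/-- The colorings of two distant pieces correspond to the colorings of these pieces in the opposite
order; the last condition states that constant colorings correspond to constant colorings. -/
theorem admits_far {p q : Piece} {i k : ℕ} {s m t : ℕ → G} (hp : p.Admits i s m)
    (hq : q.Admits (i + p.outputs + k) m t) :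
    ∃ m', q.Admits (i + p.inputs + k) s m' ∧ p.Admits i m' t ∧ ∀ l,
      constColors (i + p.inputs + k + q.inputs + l) s ∩
        (constColors (i + p.outputs + k + q.inputs + l) m ∩
          constColors (i + p.outputs + k + q.outputs + l) t) =
      constColors (i + p.inputs + k + q.inputs + l) s ∩
        (constColors (i + p.inputs + k + q.outputs + l) m' ∩
          constColors (i + p.outputs + k + q.outputs + l) t) := by
  have e₁ (l : ℕ) : i + k + 2 + 2 + l = i + k + l + 2 + 2 := by omega
  have e₂ (l : ℕ) : i + k + 2 + l = i + k + l + 2 := by omega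
  have e₃ : i + 2 + k = i + k + 2 := by omega
  have h₁ (l : ℕ) (a : G) (s : ℕ → G) : constColors (i + k + l + 2) (insertPair i a s) =
    {a} ∩ constColors (i + k + l) s := constColors_insertPair (by omega) a s
  have h₂ (l : ℕ) (a : G) (s : ℕ → G) : constColors (i + k + l + 2 + 2) (insertPair i a s) =
    {a} ∩ constColors (i + k + l + 2) s := constColors_insertPair (by omega) a s
  have h₃ (l : ℕ) (a : G) (s : ℕ → G) : constColors (i + k + l + 2) (insertPair (i + k) a s) =
    {a} ∩ constColors (i + k + l) s := constColors_insertPair (by omega) a s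
  have h₄ (l : ℕ) (a : G) (s : ℕ → G) :
    constColors (i + k + l + 2 + 2) (insertPair (i + k + 2) a s) =
      {a} ∩ constColors (i + k + l + 2) s := constColors_insertPair (by omega) a s
  have h₅ (l : ℕ) (b : Bool) (s : ℕ → G) : constColors (i + k + l + 2) (crossColors b i s) =
    constColors (i + k + l + 2) s := constColors_crossColors (by omega) b s
  have h₆ (l : ℕ) (b : Bool) (s : ℕ → G) : constColors (i + k + l + 2 + 2) (crossColors b i s) =
    constColors (i + k + l + 2 + 2) s := constColors_crossColors (by omega) b s
  have h₇ (l : ℕ) (b : Bool) (s : ℕ → G) : constColors (i + k + l + 2) (crossColors b (i + k) s) =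
    constColors (i + k + l + 2) s := constColors_crossColors (by omega) b s
  have h₈ (l : ℕ) (b : Bool) (s : ℕ → G) :
    constColors (i + k + l + 2 + 2) (crossColors b (i + k + 2) s) =
      constColors (i + k + l + 2 + 2) s := constColors_crossColors (by omega) b s
  have comm (a c : G) (s : ℕ → G) : insertPair (i + k + 2) c (insertPair i a s) =
    insertPair i a (insertPair (i + k) c s) := insertPair_comm (by omega) a c s
  have right (b : Bool) (a : G) (s : ℕ → G) : crossColors b (i + k + 2) (insertPair i a s) =
    insertPair i a (crossColors b (i + k) s) := crossColors_insertPair_right b (by omega) a s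
  have left (b : Bool) (a : G) (s : ℕ → G) : crossColors b i (insertPair (i + k + 2) a s) =
    insertPair (i + k + 2) a (crossColors b i s) := crossColors_insertPair_left b (by omega) a s
  cases p <;> cases q <;> simp only [inputs, outputs, Piece.Admits, add_zero, e₁, e₂, e₃] at hp hq ⊢
  case cup.cup =>
    obtain ⟨a, rfl⟩ := hp
    obtain ⟨c, rfl⟩ := hq
    refine ⟨_, ⟨c, rfl⟩, ⟨a, comm a c s⟩, fun l => ?_⟩
    simp only [comm, h₁, h₂, h₃]
    ext; simp; tauto
  case cup.cap =>
    obtain ⟨a, rfl⟩ := hp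
    obtain ⟨c, h⟩ := hq
    obtain ⟨m, rfl, rfl⟩ := exists_of_insertPair_eq (by omega) h
    refine ⟨m, ⟨c, rfl⟩, ⟨a, rfl⟩, fun l => ?_⟩
    simp only [h₁, h₂, h₃]
    ext; simp; tauto
  case cup.cross b =>
    obtain ⟨a, rfl⟩ := hp
    subst hq
    refine ⟨_, rfl, ⟨a, right b a s⟩, fun l => ?_⟩
    simp only [right, h₂, h₇]
    ext; simp
  case cap.cup =>
    obtain ⟨a, rfl⟩ := hp
    obtain ⟨c, rfl⟩ := hq
    refine ⟨_, ⟨c, rfl⟩, ⟨a, comm a c m⟩, fun l => ?_⟩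
    simp only [comm, h₁, h₂, h₃]
    ext; simp; tauto
  case cap.cap =>
    obtain ⟨a, rfl⟩ := hp
    obtain ⟨c, rfl⟩ := hq
    refine ⟨_, ⟨c, (comm a c t).symm⟩, ⟨a, rfl⟩, fun l => ?_⟩
    simp only [h₁, h₂, h₃]
    ext; simp; tauto
  case cap.cross b =>
    obtain ⟨a, rfl⟩ := hp
    subst hq
    refine ⟨_, rfl, ⟨a, right b a m⟩, fun l => ?_⟩
    simp only [right, h₂, h₇]
    ext; simp
  case cross.cup b =>
    obtain ⟨c, rfl⟩ := hq
    subst hp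
    refine ⟨_, ⟨c, rfl⟩, (left b c s).symm, fun l => ?_⟩
    simp only [h₅, h₄]
    ext; simp
  case cross.cap b =>
    obtain ⟨c, rfl⟩ := hq
    rw [eq_crossColors_iff, left] at hp
    subst hp
    refine ⟨_, ⟨c, rfl⟩, eq_crossColors_iff.2 rfl, fun l => ?_⟩
    simp only [h₅, h₄]
    ext; simp
  case cross.cross b b' =>
    subst hp hq
    refine ⟨_, rfl, crossColors_comm b b' (by omega) s, fun l => ?_⟩
    simp only [h₆, h₈]

/-- The piece read backwards, as far as colorings are concerned. -/
def Piece.reverse : Piece → Piece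
  | cup => cap
  | cap => cup
  | cross b => cross !b

theorem Piece.inputs_reverse (p : Piece) : p.reverse.inputs = p.outputs := by cases p <;> rfl

theorem Piece.outputs_reverse (p : Piece) : p.reverse.outputs = p.inputs := by cases p <;> rfl

theorem Piece.admits_reverse {p : Piece} {i : ℕ} {s t : ℕ → G} :
    p.reverse.Admits i t s ↔ p.Admits i s t := by
  cases p with
  | cup => rfl
  | cap => rfl
  | cross b => exact eq_crossColors_iff.symm

theorem constColors_subset {G : Type*} {i n : ℕ} (h : i < n) (s : ℕ → G) :
    constColors n s ⊆ {s i} := fun _ hc => (hc i h).symm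

theorem colored_one {n i : ℕ} {p : Piece} {s t : ℕ → G} {C : Set G} :
    Colored n [(p, i)] s t C ↔ p.Admits i s t ∧
      C = constColors n s ∩ constColors (n - p.inputs + p.outputs) t := by
  simp only [Colored]
  constructor
  · rintro ⟨_, _, h, ⟨rfl, rfl⟩, rfl⟩
    exact ⟨h, rfl⟩
  · rintro ⟨h, rfl⟩
    exact ⟨_, _, h, ⟨rfl, rfl⟩, rfl⟩

theorem colored_two {n i j : ℕ} {p q : Piece} {s t : ℕ → G} {C : Set G} :
    Colored n [(p, i), (q, j)] s t C ↔ ∃ m, p.Admits i s m ∧ q.Admits j m t ∧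
      C = constColors n s ∩ (constColors (n - p.inputs + p.outputs) m ∩
        constColors (n - p.inputs + p.outputs - q.inputs + q.outputs) t) := by
  rw [Colored]
  simp only [colored_one]
  constructor
  · rintro ⟨m, _, h, ⟨h', rfl⟩, rfl⟩
    exact ⟨m, h, h', rfl⟩
  · rintro ⟨m, h, h', rfl⟩
    exact ⟨m, _, h, ⟨h', rfl⟩, rfl⟩

/-- The colorings of the two sides of an elementary move correspond to each other. -/
theorem Move.colored {a b : List Slice} (h : Move a b) {n l : ℕ} (hr : Runs n a l) {s t : ℕ → G}
    {C : Set G} : Colored n a s t C ↔ Colored n b s t C := by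
  cases h with
  | far p q i k =>
    simp only [runs_cons, runs_nil] at hr
    obtain ⟨l, rfl⟩ : ∃ l, n = i + p.inputs + k + q.inputs + l :=
      Nat.exists_eq_add_of_le (by omega)
    have e₁ : i + p.inputs + k + q.inputs + l - p.inputs + p.outputs =
      i + p.outputs + k + q.inputs + l := by omega
    have e₂ : i + p.outputs + k + q.inputs + l - q.inputs + q.outputs =
      i + p.outputs + k + q.outputs + l := by omega
    have e₃ : i + p.inputs + k + q.inputs + l - q.inputs + q.outputs =
      i + p.inputs + k + q.outputs + l := by omega
    have e₄ : i + p.inputs + k + q.outputs + l - p.inputs + p.outputs =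
      i + p.outputs + k + q.outputs + l := by omega
    rw [colored_two, colored_two, e₁, e₂, e₃, e₄]
    constructor
    · rintro ⟨m, hp, hq, rfl⟩
      obtain ⟨m', hq', hp', h⟩ := admits_far hp hq
      exact ⟨m', hq', hp', h l⟩
    · rintro ⟨m', hq, hp, rfl⟩
      rw [← admits_reverse] at hp hq
      rw [← outputs_reverse p] at hq
      obtain ⟨m, hq', hp', h⟩ := admits_far hp hq
      rw [inputs_reverse, admits_reverse] at hq'
      have h := h l
      simp only [inputs_reverse, outputs_reverse] at h
      refine ⟨m, admits_reverse.1 hp', hq', ?_⟩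
      simp only [Set.ext_iff, Set.mem_inter_iff] at h ⊢
      intro c
      have := h c
      tauto
  | zigzagRight i =>
    simp only [runs_cons, runs_nil, inputs, outputs] at hr
    have hs (s : ℕ → G) : constColors n s = constColors n s ∩
        (constColors (n + 2) (insertPair i (s i) s) ∩ constColors n s) := by
      rw [constColors_insertPair (by omega), Set.inter_eq_left.2]
      simp [constColors_subset (show i < n by omega)]
    constructor
    · intro hw
      rw [colored_two] at hw
      obtain ⟨_, ⟨a, rfl⟩, ⟨c, h⟩, rfl⟩ := hw
      obtain ⟨rfl, rfl, -⟩ := eq_of_insertPair_eq h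
      exact ⟨rfl, (hs s).symm⟩
    · rintro ⟨rfl, rfl⟩
      rw [colored_two]
      exact ⟨_, ⟨s i, rfl⟩, ⟨s i, (insertPair_succ i s).symm⟩, hs s⟩
  | zigzagLeft i =>
    simp only [runs_cons, runs_nil, inputs, outputs] at hr
    have hs (s : ℕ → G) : constColors n s = constColors n s ∩
        (constColors (n + 2) (insertPair (i + 1) (s i) s) ∩ constColors n s) := by
      rw [constColors_insertPair (by omega), Set.inter_eq_left.2]
      simp [constColors_subset (show i < n by omega)]
    constructor
    · intro hw
      rw [colored_two] at hw
      obtain ⟨_, ⟨a, rfl⟩, ⟨c, h⟩, rfl⟩ := hw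
      obtain ⟨rfl, -, rfl⟩ := eq_of_insertPair_eq h.symm
      exact ⟨rfl, (hs _).symm⟩
    · rintro ⟨rfl, rfl⟩
      rw [colored_two]
      exact ⟨_, ⟨s i, rfl⟩, ⟨s i, insertPair_succ i s⟩, hs s⟩
  | slideCup b i =>
    simp only [runs_cons, runs_nil, inputs, outputs] at hr
    simp only [colored_two, Piece.Admits, inputs, outputs, Nat.sub_zero, Nat.add_sub_cancel]
    have q (b : Bool) (j : ℕ) (hj : j ≤ i + 1) (s : ℕ → G) :
        constColors (n + 2) (crossColors b j s) = constColors (n + 2) s :=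
      constColors_crossColors (by omega) b s
    constructor
    · rintro ⟨_, ⟨a, rfl⟩, rfl, rfl⟩
      refine ⟨_, ⟨cond b (s i * a⁻¹ * s i) a, rfl⟩, crossColors_insertPair_succ b i a s, ?_⟩
      have := q (!b) i (by omega) (insertPair (i + 1) (cond b (s i * a⁻¹ * s i) a) s)
      rw [← crossColors_insertPair_succ, q b _ le_rfl] at this
      rw [q b _ le_rfl, this]
    · rintro ⟨_, ⟨a, rfl⟩, rfl, rfl⟩
      have h := crossColors_insertPair_succ b i (cond b (s i * a⁻¹ * s i) a) s
      rw [show cond b (s i * (cond b (s i * a⁻¹ * s i) a)⁻¹ * s i) (cond b (s i * a⁻¹ * s i) a) = a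
        by cases b <;> simp] at h
      refine ⟨_, ⟨cond b (s i * a⁻¹ * s i) a, rfl⟩, h.symm, ?_⟩
      have := q b (i + 1) le_rfl (insertPair i (cond b (s i * a⁻¹ * s i) a) s)
      rw [h, q _ i (by omega)] at this
      rw [q _ i (by omega), this]
  | slideCap b i =>
    simp only [runs_cons, runs_nil, inputs, outputs] at hr
    simp only [colored_two, Piece.Admits, inputs, outputs, Nat.sub_add_cancel (show 2 ≤ n by omega)]
    have h := crossColors_insertPair_succ (G := G) (!b) i
    simp only [Bool.not_not] at h
    constructor
    · rintro ⟨_, rfl, ⟨a, ha⟩, rfl⟩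
      refine ⟨_, rfl, ⟨cond (!b) (t i * a⁻¹ * t i) a, ?_⟩, ?_⟩
      · rw [eq_comm, eq_crossColors_iff] at ha
        rw [ha, h, crossColors_not]
      · rw [constColors_crossColors (by omega), constColors_crossColors (by omega)]
    · rintro ⟨_, rfl, ⟨a, ha⟩, rfl⟩
      have := h (cond (!b) (t i * a⁻¹ * t i) a) t
      rw [show cond (!b) (t i * (cond (!b) (t i * a⁻¹ * t i) a)⁻¹ * t i)
        (cond (!b) (t i * a⁻¹ * t i) a) = a by cases b <;> simp] at this
      refine ⟨_, rfl, ⟨cond (!b) (t i * a⁻¹ * t i) a, ?_⟩, ?_⟩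
      · rw [eq_comm, eq_crossColors_iff, Bool.not_not, ← this] at ha
        rw [ha]
        simpa using crossColors_not (!b) (i + 1)
          (insertPair i (cond (!b) (t i * a⁻¹ * t i) a) t)
      · rw [constColors_crossColors (by omega), constColors_crossColors (by omega)]
  | reidemeisterOneCup b i =>
    simp only [runs_cons, runs_nil, inputs, outputs] at hr
    simp only [colored_two, colored_one, Piece.Admits, inputs, outputs, Nat.add_sub_cancel]
    constructor
    · rintro ⟨_, ⟨a, rfl⟩, rfl, rfl⟩
      rw [crossColors_insertPair, Set.inter_self]
      exact ⟨⟨a, rfl⟩, rfl⟩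
    · rintro ⟨⟨a, rfl⟩, rfl⟩
      refine ⟨_, ⟨a, rfl⟩, (crossColors_insertPair ..).symm, ?_⟩
      rw [Set.inter_self]
  | reidemeisterOneCap b i =>
    simp only [runs_cons, runs_nil, inputs, outputs] at hr
    simp only [colored_two, colored_one, Piece.Admits, inputs, outputs,
      Nat.sub_add_cancel (show 2 ≤ n by omega)]
    constructor
    · rintro ⟨_, rfl, ⟨a, ha⟩, rfl⟩
      rw [constColors_crossColors (by omega), ← Set.inter_assoc, Set.inter_self]
      refine ⟨⟨a, ?_⟩, rfl⟩
      rw [eq_comm, eq_crossColors_iff, crossColors_insertPair] at ha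
      exact ha
    · rintro ⟨⟨a, rfl⟩, rfl⟩
      refine ⟨_, rfl, ⟨a, crossColors_insertPair ..⟩, ?_⟩
      rw [crossColors_insertPair, ← Set.inter_assoc, Set.inter_self]
  | reidemeisterTwo b i =>
    simp only [runs_cons, runs_nil, inputs, outputs] at hr
    constructor
    · intro hw
      rw [colored_two] at hw
      obtain ⟨_, rfl, h, rfl⟩ := hw
      obtain rfl : t = s := h.trans (crossColors_not b i s)
      simp only [inputs, outputs, Nat.sub_add_cancel (show 2 ≤ n by omega)]
      exact ⟨rfl, by rw [constColors_crossColors (by omega), Set.inter_self, Set.inter_self]⟩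
    · rintro ⟨rfl, rfl⟩
      rw [colored_two]
      refine ⟨_, rfl, (crossColors_not b i s).symm, ?_⟩
      simp only [inputs, outputs, Nat.sub_add_cancel (show 2 ≤ n by omega)]
      rw [constColors_crossColors (by omega), Set.inter_self, Set.inter_self]
  | reidemeisterThree b i =>
    simp only [runs_cons, runs_nil, inputs, outputs] at hr
    have h₁ (s : ℕ → G) := constColors_crossColors (n := n) (i := i) (by omega) b s
    have h₂ (s : ℕ → G) := constColors_crossColors (n := n) (i := i + 1) (by omega) b s
    simp [Colored, Piece.Admits, inputs, outputs, Nat.sub_add_cancel (show 2 ≤ n by omega),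
      crossColors_braid, h₁, h₂]

/-- The colorings of isotopic diagrams correspond to each other, and constant colorings correspond
to constant colorings. -/
theorem DiagramStep.colored {w w' : List Slice} (h : DiagramStep w w') {s t : ℕ → G} {C : Set G} :
    Colored 0 w s t C ↔ Colored 0 w' s t C := by
  obtain ⟨hw, hw', u, a, b, v, hm, rfl, rfl⟩ := h
  simp only [IsLinkDiagram, List.append_assoc, runs_append] at hw
  obtain ⟨k, hu, l, ha, hv⟩ := hw
  rw [List.append_assoc, List.append_assoc, colored_append hu, colored_append hu]
  simp only [colored_append ha, colored_append (hm.runs ha), hm.colored ha]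

/-- Every coloring of a diagram of the trivial knot is constant, as the colorings of the round
circle are. -/
theorem IsTrivialKnot.nonempty_of_colored {w : List Slice} (h : IsTrivialKnot w) {s t : ℕ → G}
    {C : Set G} (hw : Colored 0 w s t C) : C.Nonempty := by
  have key : ∀ {w w' : List Slice}, Relation.EqvGen DiagramStep w w' →
      (Colored 0 w s t C ↔ Colored 0 w' s t C) := by
    intro w w' h
    induction h with
    | rel _ _ h => exact h.colored
    | refl _ => rfl
    | symm _ _ _ ih => exact ih.symm
    | trans _ _ _ _ _ ih ih' => exact ih.trans ih'
  rw [key h] at hw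
  obtain ⟨m, ⟨a, rfl⟩, -, rfl⟩ := colored_two.1 hw
  refine ⟨a, ?_, ?_, ?_⟩ <;> intro j hj
  · omega
  · simp [insertPair, show j < 2 from hj]
  · simp [inputs, outputs] at hj

end Colorings

/-! ### Colorings of the filled hexatangle -/

section Colorings

variable {G : Type*} [Group G]

/-- The row of colors that starts with the entries of the list `l`. -/
def row (l : List G) : ℕ → G := fun j => l.getD j 1

/-- The diagram `w` has a coloring with the colors `l` at the bottom, such that `X` contains all
`c` for which all the colors are `c`. -/
def ColorableFrom (w : List Slice) (l : List G) (X : Set G) : Prop :=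
  ∃ t, ∃ C ⊆ X, Colored l.length w (row l) t C

theorem insertPair_row (u v : List G) (a : G) :
    insertPair u.length a (row (u ++ v)) = row (u ++ a :: a :: v) := by
  ext j
  simp only [insertPair, row, List.getD_eq_getElem?_getD, List.getElem?_append, List.getElem?_cons]
  grind

theorem crossColors_row (b : Bool) (u v : List G) (a c : G) :
    crossColors b u.length (row (u ++ a :: c :: v)) =
      row (u ++ a * (a⁻¹ * c) ^ (cond b 1 (-1) : ℤ) ::
        c * (a⁻¹ * c) ^ (cond b 1 (-1) : ℤ) :: v) := by
  ext j
  rcases lt_trichotomy j u.length with h | rfl | h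
  · simp [crossColors, row, h.ne, (Nat.lt_succ_of_lt h).ne, List.getElem?_append_left h]
  · cases b <;> simp [crossColors, row, mul_assoc]
  · obtain ⟨k, rfl⟩ := Nat.exists_eq_add_of_lt h
    cases k <;> cases b <;>
      simp [crossColors, row, mul_assoc, add_assoc, List.getElem?_append_right]

namespace ColorableFrom

variable {w : List Slice} {u v : List G} {X : Set G}

theorem nil : ColorableFrom [] ([] : List G) Set.univ := ⟨_, _, Set.subset_univ _, rfl, rfl⟩

theorem const {l : List G} (h : ColorableFrom w l Set.univ) :
    ColorableFrom w l (constColors l.length (row l)) := by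
  obtain ⟨t, C, -, h⟩ := h
  refine ⟨t, C, ?_, h⟩
  cases w with
  | nil => exact h.2.le
  | cons _ _ =>
    obtain ⟨_, _, _, _, rfl⟩ := h
    exact Set.inter_subset_left

theorem cup {a : G} (h : ColorableFrom w (u ++ a :: a :: v) X) :
    ColorableFrom ((cup, u.length) :: w) (u ++ v) X := by
  obtain ⟨t, C, hC, h⟩ := h
  refine ⟨t, _, Set.inter_subset_right.trans hC, _, C, ⟨a, rfl⟩, ?_, rfl⟩
  rw [insertPair_row]
  simpa [inputs, outputs, add_assoc] using h

theorem cap {a : G} (h : ColorableFrom w (u ++ v) X) :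
    ColorableFrom ((cap, u.length) :: w) (u ++ a :: a :: v) X := by
  obtain ⟨t, C, hC, h⟩ := h
  refine ⟨t, _, Set.inter_subset_right.trans hC, _, C, ⟨a, (insertPair_row u v a).symm⟩, ?_, rfl⟩
  simpa [inputs, outputs, ← add_assoc] using h

theorem replicate {b : Bool} {k : ℕ} {a c : G}
    (h : ColorableFrom w (u ++ a * (a⁻¹ * c) ^ (cond b k (-k) : ℤ) ::
      c * (a⁻¹ * c) ^ (cond b k (-k) : ℤ) :: v) X) :
    ColorableFrom (List.replicate k (cross b, u.length) ++ w) (u ++ a :: c :: v) X := by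
  induction k generalizing a c with
  | zero => cases b <;> simpa using h
  | succ k ih =>
    have hg (m : ℤ) : (a * (a⁻¹ * c) ^ m)⁻¹ * (c * (a⁻¹ * c) ^ m) = a⁻¹ * c := by
      rw [mul_inv_rev, mul_assoc, ← mul_assoc a⁻¹, ← (Commute.zpow_self (a⁻¹ * c) m).eq,
        inv_mul_cancel_left]
    obtain ⟨t, C, hC, h⟩ := ih (a := a * (a⁻¹ * c) ^ (cond b 1 (-1) : ℤ))
      (c := c * (a⁻¹ * c) ^ (cond b 1 (-1) : ℤ)) (by
        rw [hg, mul_assoc a, mul_assoc c, ← zpow_add]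
        convert h using 6 <;> cases b <;> simp <;> ring)
    refine ⟨t, _, Set.inter_subset_right.trans hC, _, C, rfl, ?_, rfl⟩
    rw [crossColors_row]
    simpa [inputs, outputs, ← add_assoc] using h

/-- A row of `n` crossings between strands with the colors `a` and `c` multiplies both colors by
`g ^ n` from the right, where `g = a⁻¹ * c`. -/
theorem twists {n : ℤ} {a c g a' c' : G} (hg : a * g = c) (ha : a * g ^ n = a')
    (hc : c * g ^ n = c') (h : ColorableFrom w (u ++ a' :: c' :: v) X) :
    ColorableFrom (_root_.twists n u.length ++ w) (u ++ a :: c :: v) X := by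
  have hn : (cond (decide (0 ≤ n)) (n.natAbs : ℤ) (-n.natAbs)) = n := by
    by_cases hn : 0 ≤ n
    · simp [hn]
    · simp only [hn, decide_false, cond_false]
      omega
  refine replicate ?_
  rwa [hn, ← eq_inv_mul_iff_mul_eq.2 hg, ha, hc]

end ColorableFrom

/-- If `x, y, z` satisfy the relators of the Artin presentation, then the strands of the filled
hexatangle can be colored in such a way that `x, y, z` are quotients of colors.  For a diagram of
the trivial knot, all the colors agree. -/
theorem eq_one_of_isTrivialKnot_hexatangle {f : Filling} {x y z : G}
    (hf : IsTrivialKnot (hexatangle f))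
    (h₁ : x ^ (-f.α) * (x * (y * z) ^ f.γ * y * (y * z) ^ (-f.γ)) ^ (-f.δ) *
      (x * y * z) ^ (-f.η) = 1)
    (h₂ : y ^ (-f.β) * (y * z) ^ (-f.γ) *
      (x * (y * z) ^ f.γ * y * (y * z) ^ (-f.γ)) ^ (-f.δ) * (x * y * z) ^ (-f.η) = 1)
    (h₃ : z ^ (-f.ε) * (y * z) ^ (-f.γ) * (x * y * z) ^ (-f.η) = 1) :
    x = 1 ∧ y = 1 ∧ z = 1 := by
  -- Names for the subwords; in terms of `q`, the relators state that
  -- `q = A ^ δ * x ^ α = A ^ δ * g ^ γ * y ^ β = g ^ γ * z ^ ε`.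
  obtain ⟨g, hg⟩ : ∃ g, y * z = g := ⟨_, rfl⟩
  rw [hg] at h₁ h₂ h₃
  obtain ⟨A, hA⟩ : ∃ A, x * g ^ f.γ * y * g ^ (-f.γ) = A := ⟨_, rfl⟩
  rw [hA] at h₁ h₂
  obtain ⟨p, hp⟩ : ∃ p, x * y * z = p := ⟨_, rfl⟩
  obtain ⟨q, hq⟩ : ∃ q, p ^ (-f.η) = q := ⟨_, rfl⟩
  have hpq : q * p = p * q := by rw [← hq]; exact ((Commute.refl p).zpow_left _).eq
  rw [hp, hq] at h₁ h₂ h₃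
  have h₁ : A ^ f.δ * x ^ f.α = q := by
    rw [← mul_one (_ * _), ← h₁]; group
  have h₂ : g ^ (-f.γ) * x ^ f.α = y ^ f.β := by
    rw [← h₁] at h₂
    rw [← mul_one (y ^ _), ← h₂]; group
  have h₃ : g ^ (-f.γ) * q = z ^ f.ε := by
    rw [← mul_one (z ^ _), ← h₃]; group
  -- The row of eight colors is the one right after the start of the band `2`.  From there on, the
  -- colors are determined, and the relators ensure that equal colors meet at the maxima.
  obtain ⟨t, C, hC, h⟩ : ColorableFrom (hexatangle f) [] (constColors 8
      (row [g ^ (-f.γ) * x⁻¹, g ^ (-f.γ) * x⁻¹, g ^ (-f.γ), 1, y, y, g, g * g ^ (-f.γ)])) := by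
    simp only [hexatangle, List.append_assoc, List.cons_append, List.nil_append]
    refine ColorableFrom.cup (G := G) (u := []) (v := []) (a := g ^ (-f.γ) * x⁻¹) ?_
    refine ColorableFrom.cup (u := [_, _]) (v := []) (a := g ^ (-f.γ)) ?_
    refine ColorableFrom.cup (u := [_, _, _, _]) (v := []) (a := g * g ^ (-f.γ)) ?_
    refine ColorableFrom.twists (u := [_, _, _]) (g := g) (a' := 1) (c' := g)
      (by group) (by group) (by group) ?_
    refine ColorableFrom.cup (u := [_, _, _, _]) (a := y) ?_
    refine ColorableFrom.const ?_
    refine ColorableFrom.twists (u := [_]) (g := x) (c' := y ^ f.β)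
      (by group) rfl h₂ ?_
    refine ColorableFrom.twists (u := [_, _, _]) (g := y) (a' := y ^ f.β) (c' := y * y ^ f.β)
      (by group) (by group) rfl ?_
    refine ColorableFrom.twists (u := [_, _, _, _, _]) (g := z) hg rfl rfl ?_
    refine ColorableFrom.cap (u := [_, _]) ?_
    have conj (n : ℤ) : (x ^ (-f.α) * A * x ^ f.α) ^ n = x ^ (-f.α) * A ^ n * x ^ f.α := by
      simpa using conj_zpow (a := x ^ (-f.α)) (b := A) (i := n)
    refine ColorableFrom.twists (u := [_]) (g := x ^ (-f.α) * A * x ^ f.α)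
      (a' := g ^ (-f.γ) * x⁻¹ * q) (c' := y * z ^ f.ε) ?_ ?_ ?_ ?_
    · rw [← h₂, ← hA]
      group
    · rw [conj, ← h₁]
      group
    · rw [conj, ← h₃, ← h₁, ← h₂]
      group
    refine ColorableFrom.cap (u := [_, _]) ?_
    refine ColorableFrom.twists (u := [_]) (g := p)
      (a' := g ^ (-f.γ) * x⁻¹) (c' := g * g ^ (-f.γ)) ?_ ?_ ?_ ?_
    · rw [mul_assoc, hpq, ← h₃, ← hp, ← hg]
      simp only [hg, mul_assoc, inv_mul_cancel_left]
      rw [← mul_assoc, ← mul_assoc, ← zpow_add_one, ← zpow_one_add, add_comm]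
    · rw [← hq, mul_assoc, ← zpow_add]
      simp
    · rw [← h₃, ← hq]
      simp [mul_assoc]
    refine ColorableFrom.cap (u := []) ?_
    refine ColorableFrom.cap (u := []) ?_
    exact ColorableFrom.nil
  obtain ⟨c, hc⟩ := hf.nonempty_of_colored h
  have hc := hC hc
  simp only [constColors, row, Set.mem_ofPred_eq] at hc
  have e₁ := hc 1 (by decide)
  have e₂ := hc 2 (by decide)
  have e₃ := hc 3 (by decide)
  have e₄ := hc 4 (by decide)
  have e₅ := hc 6 (by decide)
  simp only [List.getD_cons_succ, List.getD_cons_zero] at e₁ e₂ e₃ e₄ e₅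
  obtain rfl : y = 1 := e₄.trans e₃.symm
  obtain rfl : g = 1 := e₅.trans e₃.symm
  obtain rfl : z = 1 := by simpa using hg
  simpa [← e₃] using e₁

end Colorings

open Hexatangle

/-! ### The Artin presentation of a filled hexatangle -/

theorem hom_eq_one_of_isTrivialKnot_hexatangle {G : Type*} [Group G] {f : Filling}
    (hf : IsTrivialKnot (hexatangle f)) {φ : FreeGroup (Fin 3) →* G}
    (h : ∀ i, φ (relators f i) = 1) : φ = 1 := by
  have h₁ := h 0
  have h₂ := h 1
  have h₃ := h 2
  simp only [relators, Matrix.cons_val, map_mul, map_zpow] at h₁ h₂ h₃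
  obtain ⟨e₁, e₂, e₃⟩ := eq_one_of_isTrivialKnot_hexatangle hf h₁ h₂ h₃
  refine FreeGroup.ext_hom _ _ fun i => ?_
  fin_cases i
  exacts [e₁, e₂, e₃]

theorem presentsTrivialGroup_relators {f : Filling} (hf : IsTrivialKnot (hexatangle f)) :
    PresentsTrivialGroup (relators f) := by
  have h : PresentedGroup.mk (Set.range (relators f)) = 1 :=
    hom_eq_one_of_isTrivialKnot_hexatangle hf fun i =>
      PresentedGroup.one_of_mem (Set.mem_range_self i)
  refine subsingleton_of_forall_eq 1 fun a => ?_
  obtain ⟨w, rfl⟩ := PresentedGroup.mk_surjective _ a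
  exact DFunLike.congr_fun h w

/-- Each of the three conjugates simplifies, and their product telescopes. -/
theorem isWArtinian_relators (f : Filling) : IsWArtinian (relators f) := by
  simp only [IsWArtinian, List.ofFn_succ, List.ofFn_zero, List.prod_cons, List.prod_nil, relators,
    Matrix.cons_val, Fin.succ_zero_eq_one, Fin.succ_one_eq_two, Fin.isValue, mul_one]
  obtain ⟨A, hA⟩ : ∃ A, x * (y * z) ^ f.γ * y * (y * z) ^ (-f.γ) = A := ⟨_, rfl⟩
  obtain ⟨p, hp⟩ : ∃ p, x * y * z = p := ⟨_, rfl⟩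
  rw [hA, hp]
  calc _ = p ^ f.η * (A ^ f.δ * (x * (y * z) ^ f.γ * y * (y * z) ^ (-f.γ)) * A ^ (-f.δ)) *
        (y * z) ^ f.γ * z * (y * z) ^ (-f.γ) * p ^ (-f.η) := by group
    _ = p ^ f.η * A * (y * z) ^ f.γ * z * (y * z) ^ (-f.γ) * p ^ (-f.η) := by rw [hA]; group
    _ = p ^ f.η * (x * (y * z) ^ f.γ * (y * z) * (y * z) ^ (-f.γ)) * p ^ (-f.η) := by
      rw [← hA]; group
    _ = p ^ f.η * (x * y * z) * p ^ (-f.η) := by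
      rw [mul_assoc x, (Commute.zpow_self (y * z) f.γ).eq]; group
    _ = p := by rw [hp]; group
    _ = _ := by rw [← hp, mul_assoc]

/-! ### The tables -/

open Equiv (swap)

theorem isExampleFrom_relators_permute {B : Set Filling} {b : Filling} (hb : b ∈ B)
    (h : IsTrivialKnot (hexatangle b)) (s : Equiv.Perm (Fin 4)) :
    IsExampleFrom B (relators (b.permute s)) :=
  have h := isTrivialKnot_permute h s
  ⟨isWArtinian_relators _, presentsTrivialGroup_relators h, _, rfl, h, b, hb,
    b.isSymmetricTo_permute s⟩

theorem isTrivialKnot_of_permute_eq {f g : Filling} (h : IsTrivialKnot (hexatangle f))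
    (s : Equiv.Perm (Fin 4)) (hg : f.permute s = g) : IsTrivialKnot (hexatangle g) :=
  hg ▸ isTrivialKnot_permute h s

/-- The symmetries of the tetrahedron that lead from the filling at the head of a table to the
fillings of its rows.  They are the same for all the tables but the first. -/
def symmetries : List (Equiv.Perm (Fin 4)) :=
  [1, swap 0 3, swap 2 3, swap 0 2 * swap 2 3, swap 0 3 * swap 3 2, swap 0 2, swap 1 2,
    swap 0 3 * swap 1 2, swap 1 2 * swap 2 3, swap 0 1 * swap 1 2 * swap 2 3,
    swap 0 3 * swap 3 1 * swap 1 2, swap 0 1 * swap 1 2, swap 1 3 * swap 3 2,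
    swap 0 2 * swap 2 1 * swap 1 3, swap 1 3, swap 0 1 * swap 1 3, swap 0 2 * swap 1 3,
    swap 0 1 * swap 1 3 * swap 3 2, swap 0 3 * swap 3 2 * swap 2 1, swap 0 2 * swap 2 1]

/-- The fillings obtained from `(α, β, γ, δ, ε, η)` by these symmetries. -/
theorem map_permute_symmetries (α β γ δ ε η : ℤ) :
    symmetries.map (Filling.permute ⟨α, β, γ, δ, ε, η⟩) =
      [⟨α, β, γ, δ, ε, η⟩, ⟨γ, β, α, ε, δ, η⟩, ⟨α, γ, β, η, ε, δ⟩, ⟨β, γ, α, ε, η, δ⟩,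
       ⟨γ, α, β, η, δ, ε⟩, ⟨β, α, γ, δ, η, ε⟩, ⟨δ, β, ε, α, γ, η⟩, ⟨ε, β, δ, γ, α, η⟩,
       ⟨δ, ε, β, η, γ, α⟩, ⟨β, ε, δ, γ, η, α⟩, ⟨ε, δ, β, η, α, γ⟩, ⟨β, δ, ε, α, η, γ⟩,
       ⟨η, γ, ε, α, β, δ⟩, ⟨ε, γ, η, β, α, δ⟩, ⟨η, ε, γ, δ, β, α⟩, ⟨γ, ε, η, β, δ, α⟩,
       ⟨ε, η, γ, δ, α, β⟩, ⟨γ, η, ε, α, δ, β⟩, ⟨η, α, δ, γ, β, ε⟩, ⟨δ, α, η, β, γ, ε⟩]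
    := rfl

theorem isExampleFrom_of_eq_map {T : List (Fin 3 → FreeGroup (Fin 3))} {b : Filling}
    (hT : T = (symmetries.map b.permute).map relators) (h : IsTrivialKnot (hexatangle b)) :
    ∀ r ∈ T, IsExampleFrom {b} r := by
  subst hT
  simp only [List.forall_mem_map]
  exact fun s _ => isExampleFrom_relators_permute (Set.mem_singleton b) h s

theorem List.cons_congr {α : Type*} {a b : α} {l m : List α} (h : a = b) (h' : l = m) :
    a :: l = b :: m := by
  rw [h, h']

theorem Matrix.vecCons_congr {α : Type*} {n : ℕ} {a b : α} {v w : Fin n → α} (h : a = b)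
    (h' : v = w) : Matrix.vecCons a v = Matrix.vecCons b w := by
  rw [h, h']

set_option maxHeartbeats 1000000 in
theorem secondTable_eq :
    secondTable = (symmetries.map (Filling.permute ⟨-1, 0, 2, -1, 1, 0⟩)).map relators := by
  rw [map_permute_symmetries]
  simp only [secondTable, List.map_cons, List.map_nil, relators]
  repeat' first | rfl | refine List.cons_congr ?_ ?_ | refine Matrix.vecCons_congr ?_ ?_
  all_goals simp [zpow_neg, zpow_ofNat, pow_succ, mul_assoc]

set_option maxHeartbeats 1000000 in
theorem thirdTable_eq (γ : ℤ) :
    thirdTable γ = (symmetries.map (Filling.permute ⟨1, -1, γ, -1, 1 - γ, 0⟩)).map relators := by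
  rw [map_permute_symmetries]
  simp only [thirdTable, List.map_cons, List.map_nil, relators]
  repeat' first | rfl | refine List.cons_congr ?_ ?_ | refine Matrix.vecCons_congr ?_ ?_
  -- powers of `y * z` and the factors `y * z` split off from them commute: where splitting these
  -- off on the right does not lead to equal words, splitting them off on the left does
  all_goals first
    | simp [zpow_add, zpow_sub, pow_succ, zpow_ofNat, mul_assoc]; done
    | simp [neg_add_eq_sub, zpow_sub, mul_assoc]

set_option maxHeartbeats 1000000 in
theorem fourthTable_eq (γ : ℤ) :
    fourthTable γ = (symmetries.map (Filling.permute ⟨1, -1, γ, -2, -1, 0⟩)).map relators := by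
  rw [map_permute_symmetries]
  simp only [fourthTable, List.map_cons, List.map_nil, relators]
  repeat' first | rfl | refine List.cons_congr ?_ ?_ | refine Matrix.vecCons_congr ?_ ?_
  all_goals simp [zpow_add, zpow_ofNat, pow_succ, mul_assoc]

set_option maxHeartbeats 1000000 in
theorem fifthTable_eq (β : ℤ) :
    fifthTable β = (symmetries.map (Filling.permute ⟨1, β, -2, -1, 2, 1⟩)).map relators := by
  rw [map_permute_symmetries]
  simp only [fifthTable, List.map_cons, List.map_nil, relators]
  repeat' first | rfl | refine List.cons_congr ?_ ?_ | refine Matrix.vecCons_congr ?_ ?_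
  all_goals simp [zpow_add, zpow_sub, zpow_ofNat, pow_succ, mul_assoc]

set_option maxHeartbeats 1000000 in
theorem sixthTable_eq (ε : ℤ) :
    sixthTable ε = (symmetries.map (Filling.permute ⟨-1, 2, -2, -1, ε, 1⟩)).map relators := by
  rw [map_permute_symmetries]
  simp only [sixthTable, List.map_cons, List.map_nil, relators]
  repeat' first | rfl | refine List.cons_congr ?_ ?_ | refine Matrix.vecCons_congr ?_ ?_
  all_goals simp [zpow_add, zpow_sub, zpow_ofNat, pow_succ, mul_assoc]

/-- The fillings of the first table are obtained from the stars with the center `1`, in twelve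
cases, and from the path with all parameters `1`, in the remaining ones. -/
theorem isExampleFrom_of_mem_firstTable {B : Set Filling}
    (hB : ∀ s t u : ℤ, (s = 1 ∨ s = -1) → (t = 1 ∨ t = -1) → (u = 1 ∨ u = -1) →
      ⟨s, t, u, 0, 0, 0⟩ ∈ B ∧ ⟨s, 0, u, 0, t, 0⟩ ∈ B) :
    ∀ r ∈ firstTable, IsExampleFrom B r := by
  have p : (1 : ℤ) = 1 ∨ (1 : ℤ) = -1 := .inl rfl
  have m : (-1 : ℤ) = 1 ∨ (-1 : ℤ) = -1 := .inr rfl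
  have star {s t u : ℤ} (hs : s = 1 ∨ s = -1) (ht : t = 1 ∨ t = -1) (hu : u = 1 ∨ u = -1)
      (σ : Equiv.Perm (Fin 4)) {f : Filling} (h : Filling.permute ⟨s, t, u, 0, 0, 0⟩ σ = f) :
      IsExampleFrom B (relators f) := by
    subst h
    refine isExampleFrom_relators_permute (hB s t u hs ht hu).1 ?_ σ
    exact isTrivialKnot_of_permute_eq (isTrivialKnot_tree hs (.inl ⟨ht, rfl⟩) hu) (swap 0 1) rfl
  have path (σ : Equiv.Perm (Fin 4)) {f : Filling}
      (h : Filling.permute ⟨1, 0, 1, 0, 1, 0⟩ σ = f) : IsExampleFrom B (relators f) := by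
    subst h
    refine isExampleFrom_relators_permute (hB 1 1 1 p p p).2 ?_ σ
    exact isTrivialKnot_of_permute_eq (isTrivialKnot_tree p (.inr ⟨p, rfl⟩) p) (swap 0 1) rfl
  have h : firstTable = List.map relators
      [⟨1, 1, 1, 0, 0, 0⟩, ⟨0, 1, 0, 1, 1, 0⟩, ⟨0, 0, 1, 0, 1, 1⟩, ⟨1, 0, 0, 1, 0, 1⟩,
       ⟨1, 1, -1, 0, 0, 0⟩, ⟨1, -1, 1, 0, 0, 0⟩, ⟨0, 0, 1, 0, -1, 1⟩, ⟨1, 0, 0, -1, 0, 1⟩,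
       ⟨0, 0, 1, 0, 1, -1⟩, ⟨1, 0, 0, 1, 0, -1⟩, ⟨0, 0, -1, 0, 1, 1⟩, ⟨-1, 0, 0, 1, 0, 1⟩,
       ⟨1, 0, 1, 1, 0, 0⟩, ⟨1, 1, 0, 0, 1, 0⟩, ⟨0, 1, 1, 1, 0, 0⟩, ⟨1, 1, 0, 0, 0, 1⟩,
       ⟨0, 1, 1, 0, 0, 1⟩, ⟨0, 0, 1, 1, 1, 0⟩, ⟨0, 1, 0, 0, 1, 1⟩, ⟨0, 1, 0, 1, 0, 1⟩] := by
    simp only [firstTable, List.map_cons, List.map_nil, relators]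
    repeat' first | rfl | refine List.cons_congr ?_ ?_ | refine Matrix.vecCons_congr ?_ ?_
    all_goals simp [zpow_ofNat, pow_succ, mul_assoc]
  rw [h]
  simp only [List.forall_mem_map, List.forall_mem_cons]
  exact ⟨star p p p 1 rfl, star p p p (swap 1 2) rfl, star p p p (swap 1 3) rfl,
    star p p p (swap 0 1) rfl, star p p m 1 rfl, star p m p 1 rfl, star p m p (swap 1 3) rfl,
    star p m p (swap 0 1) rfl, star m p p (swap 1 3) rfl, star p p m (swap 0 1) rfl,
    star p p m (swap 1 3) rfl, star m p p (swap 0 1) rfl, path (swap 0 3) rfl,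
    path (swap 2 3) rfl, path (swap 1 3 * swap 3 2) rfl, path (swap 0 3 * swap 3 2) rfl,
    path (swap 1 3) rfl, path (swap 1 2) rfl, path (swap 1 2 * swap 2 3) rfl,
    path (swap 0 3 * swap 3 2 * swap 2 1) rfl, nofun⟩

theorem mainTheorem7 :
    (∀ r ∈ Hexatangle.firstTable, Hexatangle.IsExampleFrom
      {b | ∃ s t u : ℤ, (s = 1 ∨ s = -1) ∧ (t = 1 ∨ t = -1) ∧ (u = 1 ∨ u = -1) ∧
        (b = { α := s, β := t, γ := u, δ := 0, ε := 0, η := 0 } ∨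
         b = { α := s, β := 0, γ := u, δ := 0, ε := t, η := 0 })} r) ∧
    (∀ r ∈ Hexatangle.secondTable, Hexatangle.IsExampleFrom
      {{ α := -1, β := 0, γ := 2, δ := -1, ε := 1, η := 0 }} r) ∧
    (∀ γ : ℤ, ∀ r ∈ Hexatangle.thirdTable γ, Hexatangle.IsExampleFrom
      {{ α := 1, β := -1, γ := γ, δ := -1, ε := 1 - γ, η := 0 }} r) ∧
    (∀ γ : ℤ, ∀ r ∈ Hexatangle.fourthTable γ, Hexatangle.IsExampleFrom
      {{ α := 1, β := -1, γ := γ, δ := -2, ε := -1, η := 0 }} r) ∧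
    (∀ β : ℤ, ∀ r ∈ Hexatangle.fifthTable β, Hexatangle.IsExampleFrom
      {{ α := 1, β := β, γ := -2, δ := -1, ε := 2, η := 1 }} r) ∧
    (∀ ε : ℤ, ∀ r ∈ Hexatangle.sixthTable ε, Hexatangle.IsExampleFrom
      {{ α := -1, β := 2, γ := -2, δ := -1, ε := ε, η := 1 }} r) := by
  refine ⟨isExampleFrom_of_mem_firstTable fun s t u hs ht hu =>
      ⟨⟨s, t, u, hs, ht, hu, .inl rfl⟩, ⟨s, t, u, hs, ht, hu, .inr rfl⟩⟩,
    isExampleFrom_of_eq_map secondTable_eq ?_,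
    fun γ => isExampleFrom_of_eq_map (thirdTable_eq γ) ?_,
    fun γ => isExampleFrom_of_eq_map (fourthTable_eq γ) ?_,
    fun β => isExampleFrom_of_eq_map (fifthTable_eq β) ?_,
    fun ε => isExampleFrom_of_eq_map (sixthTable_eq ε) ?_⟩
  · exact isTrivialKnot_of_permute_eq (f := ⟨-1, 0, 1, -1, 2, 0⟩)
      (isTrivialKnot_contract (.inr ⟨rfl, rfl⟩) (.inl rfl) 0) (swap 1 2) rfl
  · exact isTrivialKnot_of_permute_eq (f := ⟨1, 0, -1, γ, 1 - γ, -1⟩)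
      (isTrivialKnot_contract (.inl ⟨rfl, rfl⟩) (.inl (add_sub_cancel γ 1)) (-1))
      (swap 0 1 * swap 2 3) rfl
  · exact isTrivialKnot_of_permute_eq (f := ⟨γ, 0, -1, 1, -2, -1⟩) (isTrivialKnot_series γ)
      (swap 0 2 * swap 2 3 * swap 3 1) rfl
  · exact isTrivialKnot_of_permute_eq (f := ⟨1, 1, -1, -2, 2, β⟩)
      (isTrivialKnot_star (.inl rfl) β) (swap 0 1 * swap 2 3) rfl
  · exact isTrivialKnot_of_permute_eq (f := ⟨1, -1, -1, -2, 2, ε⟩)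
      (isTrivialKnot_star (.inr rfl) ε) (swap 0 1 * swap 1 2 * swap 2 3) rfl
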